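/- Let $k$ be a number field of degree $n=(k:\mathbb{Q})$ with ring of integers $\mathfrak{o}_k$, $r_1$ real and $r_2$ complex places, unit rank $r=r_1+r_2-1$, class number $h$, regulator $R_k$ and group of roots of unity $\mu(k)$. An Arakelov divisor is a formal sum $D=\sum_{\mathfrak{p}}\nu_{\mathfrak{p}}\,\mathfrak{p}+\sum_{v\mid\infty}x_v\,v$ with $\nu_{\mathfrak{p}}\in\mathbb{Z}$, almost all zero, and $x_v\in\mathbb{R}$, where $\mathfrak{p}$ runs through the nonzero primes of $\mathfrak{o}_k$ and $v$ through the infinite places; the group $Z^1(X_k)=\bigoplus_{\mathfrak{p}}\mathbb{Z}\oplus\bigoplus_{v\mid\infty}\mathbb{R}$ of these divisors carries its evident topology (discrete times Euclidean). Let $\mathcal{N}(D)=\prod_{\mathfrak{p}}N\mathfrak{p}^{\nu_{\mathfrak{p}}}\prod_v e^{x_v}$ and $Z^1(X_k)^0=\ker\mathcal{N}$. For $f\in k^*$ put $\mathrm{div}(f)=\sum_{\mathfrak{p}}\mathrm{ord}_{\mathfrak{p}}(f)\,\mathfrak{p}-\sum_v e_v\log|f|_v\,v$, with $e_v=1$ for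 $v$ real and $e_v=2$ for $v$ complex. Let $CH^1(X_k)^0=Z^1(X_k)^0/\mathrm{div}(k^*)$, a compact group, and let $d^0\mathcal{D}$ be its Haar measure of total volume $hR_k$. For $D$ as above let $I(D)=\prod_{\mathfrak{p}}\mathfrak{p}^{-\nu_{\mathfrak{p}}}$ and, for $f\in k$, $\|f\|_D^2=\sum_{v\text{ real}}|f|_v^2e^{-2x_v}+2\sum_{v\text{ complex}}|f|_v^2e^{-x_v}$. For the class $\mathcal{D}=[D]\in CH^1(X_k)^0$ let $$a(\mathcal{D})=\min\{\|f\|_D^2 : 0\neq f\in I(D)\},\qquad \nu(\mathcal{D})=\bigl|\{f\in I(D) : \|f\|_D^2=a(\mathcal{D})\}\bigr|;$$ these depend only on $\mathcal{D}$. **Theorem.** For every $s\in\mathbb{C}$ the function $\mathcal{D}\mapsto\nu(\mathcal{D})\,a(\mathcal{D})^{-s}$ is integrable on $CH^1(X_k)^0$, the function $$C(s)=\int_{CH^1(X_k)^0}\nu(\mathcal{D})\,a(\mathcal{D})^{-s}\,d^0\mathcal{D}$$ is entire, and $C(s)\sim|\mu(k)|\,\alpha_k\,s^{-r/2}\,n^{-s}$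 as $\mathrm{Re}\,s\to\infty$, that is, $$\lim_{\mathrm{Re}\,s\to\infty}\frac{C(s)}{|\mu(k)|\,\alpha_k\,s^{-r/2}\,n^{-s}}=1,\qquad \alpha_k=(\pi n)^{r/2}\,2^{-r_1/2}\sqrt{2/n}\,.$$ Here $s^{-r/2}$ is the principal branch, and the limit is over all complex $s$ with $\mathrm{Re}\,s\to\infty$, uniformly in $\mathrm{Im}\,s$. -/

import Mathlib

open NumberField IsDedekindDomain MeasureTheory Filter Topology
open scoped nonZeroDivisors

namespace Arakelov

section Divisors

variable (k : Type*) [Field k] [NumberField k]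

/-- The finite part `⨁_𝔭 ℤ · 𝔭` of the group of Arakelov divisors; `𝔭` runs through the nonzero
prime ideals of the ring of integers. -/
abbrev FinDivisor : Type _ := HeightOneSpectrum (𝓞 k) →₀ ℤ

instance : TopologicalSpace (FinDivisor k) := ⊥

instance : DiscreteTopology (FinDivisor k) := ⟨rfl⟩

/-- The group `Z¹(X_k) = ⨁_𝔭 ℤ · 𝔭 ⊕ ⨁_{v ∣ ∞} ℝ · v` of Arakelov divisors, with the product of
the discrete topology and the usual topology. -/
abbrev Divisor : Type _ := FinDivisor k × (InfinitePlace k → ℝ)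

end Divisors

section Basic

variable {k : Type*} [Field k] [NumberField k]

/-- `ord_𝔭 (f)` for `f ∈ k^*`: the exponent of `𝔭` in the factorization of the fractional ideal
generated by `f`. -/
noncomputable def ord (p : HeightOneSpectrum (𝓞 k)) (f : k) : ℤ :=
  FractionalIdeal.count k p (FractionalIdeal.spanSingleton (𝓞 k)⁰ f)

theorem ord_finite (f : k) : {p : HeightOneSpectrum (𝓞 k) | ord p f ≠ 0}.Finite := by
  have := FractionalIdeal.finite_factors (FractionalIdeal.spanSingleton (𝓞 k)⁰ f)
  simpa [ord, Filter.eventually_cofinite] using this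

/-- `div (f) = ∑_𝔭 ord_𝔭 (f) 𝔭 - ∑_v e_v log |f|_v v`, where `e_v` is `1` for real `v` and `2` for
complex `v`. -/
noncomputable def div : Additive kˣ →+ Divisor k where
  toFun f :=
    (Finsupp.ofSupportFinite (fun p => ord p (f.toMul : k)) (ord_finite _),
      fun v => -((v.mult : ℝ) * Real.log (v (f.toMul : k))))
  map_zero' := by
    refine Prod.ext (Finsupp.ext fun p => ?_) (funext fun v => ?_)
    · change ord p (1 : k) = 0
      simp [ord, FractionalIdeal.spanSingleton_one, FractionalIdeal.count_one]
    · simp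
  map_add' f g := by
    refine Prod.ext (Finsupp.ext fun p => ?_) (funext fun v => ?_)
    · change ord p ((f.toMul : k) * (g.toMul : k)) = ord p (f.toMul : k) + ord p (g.toMul : k)
      rw [ord, ← FractionalIdeal.spanSingleton_mul_spanSingleton, FractionalIdeal.count_mul]
      · rfl
      · exact FractionalIdeal.spanSingleton_ne_zero_iff.mpr f.toMul.ne_zero
      · exact FractionalIdeal.spanSingleton_ne_zero_iff.mpr g.toMul.ne_zero
    · simp [Real.log_mul]
      ring

/-- The fractional ideal `I(D) = ∏_𝔭 𝔭 ^ (-ν_𝔭)`. -/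
noncomputable def ideal (D : Divisor k) : FractionalIdeal (𝓞 k)⁰ k :=
  D.1.prod
    fun p m => (p.asIdeal : FractionalIdeal (𝓞 k)⁰ k) ^ (-m)

open scoped Classical in
/-- `‖f‖²_D = ∑_{v real} |f|_v² e^{-2 x_v} + 2 ∑_{v complex} |f|_v² e^{-x_v}`. -/
noncomputable def normSq (D : Divisor k) (f : k) : ℝ :=
  ∑ v : InfinitePlace k,
    if v.IsReal then (v f) ^ 2 * Real.exp (-2 * D.2 v) else 2 * ((v f) ^ 2 * Real.exp (-D.2 v))

/-- The Arakelov norm `𝒩(D) = ∏_𝔭 N𝔭 ^ ν_𝔭 · ∏_v e^{x_v}`. -/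
noncomputable def absNorm (D : Divisor k) : ℝ :=
  (D.1.prod
    fun p m => (Ideal.absNorm p.asIdeal : ℝ) ^ m) * ∏ v, Real.exp (D.2 v)

theorem absNorm_prime_ne_zero (p : HeightOneSpectrum (𝓞 k)) :
    (Ideal.absNorm p.asIdeal : ℝ) ≠ 0 := by
  exact_mod_cast fun h => p.ne_bot (Ideal.absNorm_eq_zero_iff.mp h)

theorem absNorm_zero : absNorm (0 : Divisor k) = 1 := by
  simp [absNorm]

theorem absNorm_add (D E : Divisor k) : absNorm (D + E) = absNorm D * absNorm E := by
  have h : ∏ v, Real.exp ((D + E).2 v) =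
      (∏ v, Real.exp (D.2 v)) * ∏ v, Real.exp (E.2 v) := by
    rw [← Finset.prod_mul_distrib]
    exact Finset.prod_congr rfl fun v _ => by simp [Real.exp_add]
  rw [absNorm, absNorm, absNorm, h, Prod.fst_add, Finsupp.prod_add_index' (by simp)
    (fun p m n => zpow_add₀ (absNorm_prime_ne_zero p) m n)]
  ring

theorem continuous_absNorm : Continuous (absNorm : Divisor k → ℝ) := by
  refine Continuous.mul ?_ ?_
  · exact (continuous_of_discreteTopology (f := fun d : FinDivisor k =>
      d.prod
        fun p m => (Ideal.absNorm p.asIdeal : ℝ) ^ m)).comp continuous_fst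
  · fun_prop

theorem ideal_add (D E : Divisor k) : ideal (D + E) = ideal D * ideal E := by
  rw [ideal, Prod.fst_add, Finsupp.prod_add_index' (by simp)]
  · rfl
  · intro p m n
    rw [neg_add, zpow_add₀ (by simpa using p.ne_bot)]

theorem ideal_div (g : Additive kˣ) :
    ideal (div g) = FractionalIdeal.spanSingleton (𝓞 k)⁰ (g.toMul : k)⁻¹ := by
  have hg : FractionalIdeal.spanSingleton (𝓞 k)⁰ (g.toMul : k) ≠ 0 :=
    FractionalIdeal.spanSingleton_ne_zero_iff.mpr g.toMul.ne_zero
  rw [← FractionalIdeal.spanSingleton_inv,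
    ← FractionalIdeal.finprod_heightOneSpectrum_factorization' k hg, ideal, Finsupp.prod]
  rw [finprod_eq_prod_of_mulSupport_subset (s := (div g).1.support), ← Finset.prod_inv_distrib]
  · exact Finset.prod_congr rfl fun p _ => zpow_neg _ _
  · intro p hp
    rw [Finset.mem_coe, Finsupp.mem_support_iff]
    intro h
    have h' : FractionalIdeal.count k p
      (FractionalIdeal.spanSingleton (𝓞 k)⁰ (g.toMul : k)) = 0 := h
    exact hp (by simp [h'])

theorem mem_ideal_add_div (D : Divisor k) (g : Additive kˣ) (f : k) :
    f ∈ ideal (D + div g) ↔ f * (g.toMul : k) ∈ ideal D := by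
  have hg : (g.toMul : k) ≠ 0 := g.toMul.ne_zero
  rw [ideal_add, ideal_div, mul_comm (ideal D), FractionalIdeal.mem_singleton_mul]
  constructor
  · rintro ⟨y, hy, rfl⟩
    rwa [mul_right_comm, inv_mul_cancel₀ hg, one_mul]
  · intro h
    exact ⟨_, h, by rw [mul_left_comm, inv_mul_cancel₀ hg, mul_one]⟩

theorem normSq_add_div (D : Divisor k) (g : Additive kˣ) (f : k) :
    normSq (D + div g) f = normSq D (f * (g.toMul : k)) := by
  classical
  refine Finset.sum_congr rfl fun v _ => ?_
  have hg : 0 < v (g.toMul : k) := InfinitePlace.pos_iff.mpr g.toMul.ne_zero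
  have hd : (D + div g).2 v = D.2 v - (v.mult : ℝ) * Real.log (v (g.toMul : k)) := by
    simp [div, sub_eq_add_neg]
  have h2 : Real.exp (2 * Real.log (v (g.toMul : k))) = v (g.toMul : k) ^ 2 := by
    rw [two_mul, Real.exp_add, Real.exp_log hg, sq]
  rw [hd, map_mul]
  split_ifs with hv
  · rw [InfinitePlace.mult_isReal ⟨v, hv⟩]
    rw [show -2 * (D.2 v - ((1 : ℕ) : ℝ) * Real.log (v (g.toMul : k))) =
      -2 * D.2 v + 2 * Real.log (v (g.toMul : k)) by push_cast; ring, Real.exp_add, h2]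
    ring
  · rw [InfinitePlace.mult_isComplex ⟨v, InfinitePlace.not_isReal_iff_isComplex.mp hv⟩]
    rw [show -(D.2 v - ((2 : ℕ) : ℝ) * Real.log (v (g.toMul : k))) =
      -D.2 v + 2 * Real.log (v (g.toMul : k)) by push_cast; ring, Real.exp_add, h2]
    ring

/-- The squared length `min {‖f‖²_D | 0 ≠ f ∈ I(D)}` of the shortest nonzero vectors of the lattice
`I(D)`. -/
noncomputable def minSq (D : Divisor k) : ℝ :=
  sInf (normSq D '' {f : k | f ∈ ideal D ∧ f ≠ 0})

/-- The kissing number `|{f ∈ I(D) | ‖f‖²_D = min}|` of the lattice `I(D)`. -/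
noncomputable def kissing (D : Divisor k) : ℕ :=
  Set.ncard {f : k | f ∈ ideal D ∧ normSq D f = minSq D}

theorem minSq_add_div (D : Divisor k) (g : Additive kˣ) : minSq (D + div g) = minSq D := by
  have hg : (g.toMul : k) ≠ 0 := g.toMul.ne_zero
  unfold minSq
  congr 1
  ext t
  constructor
  · rintro ⟨f, ⟨hf, hf0⟩, rfl⟩
    exact ⟨f * (g.toMul : k), ⟨(mem_ideal_add_div D g f).mp hf, mul_ne_zero hf0 hg⟩,
      (normSq_add_div D g f).symm⟩
  · rintro ⟨f, ⟨hf, hf0⟩, rfl⟩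
    refine ⟨f * (g.toMul : k)⁻¹, ⟨(mem_ideal_add_div D g _).mpr ?_,
      mul_ne_zero hf0 (inv_ne_zero hg)⟩, ?_⟩
    · rwa [inv_mul_cancel_right₀ hg]
    · rw [normSq_add_div, inv_mul_cancel_right₀ hg]

theorem kissing_add_div (D : Divisor k) (g : Additive kˣ) :
    kissing (D + div g) = kissing D := by
  have hg : (g.toMul : k) ≠ 0 := g.toMul.ne_zero
  unfold kissing
  refine Set.ncard_congr (fun f _ => f * (g.toMul : k)) ?_ ?_ ?_
  · rintro f ⟨hf, hm⟩
    exact ⟨(mem_ideal_add_div D g f).mp hf, by rw [← normSq_add_div, hm, minSq_add_div]⟩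
  · intro f f' _ _ h
    exact mul_right_cancel₀ hg h
  · rintro f ⟨hf, hm⟩
    refine ⟨f * (g.toMul : k)⁻¹, ⟨(mem_ideal_add_div D g _).mpr ?_, ?_⟩, ?_⟩
    · rwa [inv_mul_cancel_right₀ hg]
    · rw [normSq_add_div, inv_mul_cancel_right₀ hg, hm, minSq_add_div]
    · exact inv_mul_cancel_right₀ hg f

end Basic

section Chow

variable (k : Type*) [Field k] [NumberField k]

/-- `Z¹(X_k)⁰`, the kernel of the Arakelov norm. -/
noncomputable def DivisorZero : AddSubgroup (Divisor k) where
  carrier := {D | absNorm D = 1}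
  zero_mem' := absNorm_zero
  add_mem' {D E} hD hE := by
    change absNorm (D + E) = 1
    rw [absNorm_add, show absNorm D = 1 from hD, show absNorm E = 1 from hE, one_mul]
  neg_mem' {D} hD := by
    have h := absNorm_add D (-D)
    rw [add_neg_cancel, absNorm_zero, show absNorm D = 1 from hD, one_mul] at h
    exact h.symm

/-- The subgroup `div (k^*)` of `Z¹(X_k)⁰`. -/
noncomputable def principal : AddSubgroup (DivisorZero k) :=
  (div (k := k)).range.addSubgroupOf (DivisorZero k)

/-- The degree zero Arakelov Chow group `CH¹(X_k)⁰ = Z¹(X_k)⁰ / div (k^*)`, with the quotient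
topology. -/
noncomputable abbrev ChowZero : Type _ := DivisorZero k ⧸ principal k

instance : IsTopologicalAddGroup (FinDivisor k) where
  continuous_add := continuous_of_discreteTopology
  continuous_neg := continuous_of_discreteTopology

instance : LocallyCompactSpace (DivisorZero k) :=
  ((isClosed_singleton (x := (1 : ℝ))).preimage
    continuous_absNorm).isClosedEmbedding_subtypeVal.locallyCompactSpace

noncomputable instance : MeasurableSpace (ChowZero k) := borel _

instance : BorelSpace (ChowZero k) := ⟨rfl⟩

/-- The Haar measure `d⁰𝒟` on the compact group `CH¹(X_k)⁰`, normalized so that the total volume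
is the class number times the regulator. -/
noncomputable def haar : Measure (ChowZero k) :=
  (ENNReal.ofReal (classNumber k * Units.regulator k) /
    (Measure.addHaar : Measure (ChowZero k)) Set.univ) • Measure.addHaar

theorem exists_eq_add_div {D E : DivisorZero k}
    (h : (QuotientAddGroup.leftRel (principal k)) D E) :
    ∃ g : Additive kˣ, E.1 = D.1 + div g := by
  rw [QuotientAddGroup.leftRel_apply] at h
  obtain ⟨g, hg⟩ := AddSubgroup.mem_addSubgroupOf.mp h
  exact ⟨g, by rw [hg]; simp⟩

/-- The function `a` on `CH¹(X_k)⁰`: the minimal squared length of the lattice class. -/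
noncomputable def a : ChowZero k → ℝ :=
  Quotient.lift (fun D => minSq D.1) fun _ _ h => by
    obtain ⟨g, hg⟩ := exists_eq_add_div k h
    exact (by rw [hg, minSq_add_div])

/-- The function `ν` on `CH¹(X_k)⁰`: the kissing number of the lattice class. -/
noncomputable def ν : ChowZero k → ℕ :=
  Quotient.lift (fun D => kissing D.1) fun _ _ h => by
    obtain ⟨g, hg⟩ := exists_eq_add_div k h
    exact (by rw [hg, kissing_add_div])

/-- The function `C(s) = ∫_{CH¹(X_k)⁰} ν(𝒟) a(𝒟)^{-s} d⁰𝒟`. -/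
noncomputable def C (s : ℂ) : ℂ :=
  ∫ x : ChowZero k, (ν k x : ℂ) * (a k x : ℂ) ^ (-s) ∂haar k

/-- The constant `α_k = (π n)^{r/2} 2^{-r₁/2} √(2/n)`. -/
noncomputable def α : ℝ :=
  (Real.pi * Module.finrank ℚ k) ^ ((Units.rank k : ℝ) / 2) *
    2 ^ (-(InfinitePlace.nrRealPlaces k : ℝ) / 2) * √(2 / Module.finrank ℚ k)

end Chow

end Arakelov

/-! Translating `D` by `div f` turns `f` into `1`. Hence `ν · a ^ (-s)` is the periodization, over
the principal divisors, of `|μ(k)| (‖1‖²_D) ^ (-s)` restricted to the set `minDomain` where `1` is a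
shortest vector. Unfolding the quotient (`integral_quotient_eq_integral`, with class representatives
times a fundamental domain of the unit lattice, of volume `h R_k`) gives `C(s) = |μ(k)|
∫_{minDomain} (‖1‖²_D) ^ (-s)`. The set `minDomain` is compact and involves only finitely many
finite parts `d`, namely inverses of integral ideals of bounded norm `N(d)`.

For fixed `d` put `u_v = exp (-2 x_v / m_v) / ‖1‖²_D`, with `m_v` the local degree. These
coordinates satisfy `∑ m_v u_v = 1`, and the conditions `‖1‖²_D ≤ ‖f‖²_D` become the linear
inequalities `1 ≤ ∑ m_v |f|_v² u_v`. So the slice becomes a polytope `K_d` inside the open simplex,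
and its contribution is `N(d) ^ (-2s/n) n ^ (-s) ∫_{K_d} w exp (s ψ)`, where `ψ = (1/n) ∑ m_v log
u_v + log n` is strictly concave, nonpositive, and zero exactly at the barycentre `u_v = 1/n`.
Holomorphy in `s` is then clear. The inequality of arithmetic and geometric means puts the
barycentre in the interior of `K_0`, and Laplace's method there produces `α_k`. For `d ≠ 0` one has
`N(d) ≥ 2`, so the contribution is exponentially smaller.

The difficulty is uniformity in `Im s`: everything must be compared with `|s| ^ (-r/2)`, not with
`(Re s) ^ (-r/2)`. The bound `O(|s| ^ (-r/2))` on `Re s ≥ 1`, for arbitrary polytopes, is `decays`.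
It goes by induction on the dimension: integration by parts leaves integrals over faces. At a
critical point, the integral `J` of a cutoff satisfies the Euler equation `s J' + (r/2) J = small`,
which is integrated along circular arcs starting on the real axis, where Gaussian bounds apply
(`isBigO_of_arc`). If the critical point is interior, the cutoff removes the boundary terms and `s ^
(r/2) J` is constant along arcs up to `O(|s| ^ (-1/2))`; thus the Laplace limit on the real axis
holds in the whole half plane (`tendsto_cpow_mul_osc`). -/

namespace OscillatoryIntegral

open Set
open scoped ContDiff

/-! ### Averages along segments: smooth division by coordinates. -/

section RayAverage

variable {E F : Type} [NormedAddCommGroup E] [NormedSpace ℝ E] [ProperSpace E]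
  [NormedAddCommGroup F] [NormedSpace ℝ F]

/-- The weighted average of `g` over the segment from `p` to `u`. -/
noncomputable def rayAverage (κ : ℝ → ℝ) (p : E) (g : E → F) (u : E) : F :=
  ∫ τ in (0 : ℝ)..1, κ τ • g (p + τ • (u - p))

/-- Differentiation under the integral. The chain rule brings down a factor `τ`, which is why
averages carry an arbitrary weight `κ`. -/
theorem hasFDerivAt_rayAverage {κ : ℝ → ℝ} (hκ : Continuous κ) (p : E) {g : E → F}
    (hg : ContDiff ℝ 1 g) (u : E) :
    HasFDerivAt (rayAverage κ p g) (rayAverage (fun τ => κ τ * τ) p (fderiv ℝ g) u) u := by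
  have hg' : Continuous (fderiv ℝ g) := hg.continuous_fderiv (by simp)
  have hc : Continuous fun q : ℝ × E => (κ q.1 * q.1) • fderiv ℝ g (p + q.1 • (q.2 - p)) := by
    fun_prop
  obtain ⟨B, hB⟩ := (isCompact_Icc (a := (0 : ℝ)) (b := 1)).prod
    (isCompact_closedBall u 1) |>.exists_bound_of_continuousOn hc.continuousOn
  refine intervalIntegral.hasFDerivAt_integral_of_dominated_of_fderiv_le (𝕜 := ℝ)
    (F' := fun x τ => (κ τ * τ) • fderiv ℝ g (p + τ • (x - p)))
    (bound := fun _ => B) (Metric.closedBall_mem_nhds u one_pos) ?_ ?_ ?_ ?_ ?_ ?_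
  · refine Filter.Eventually.of_forall fun x => Continuous.aestronglyMeasurable ?_
    have := hg.continuous
    fun_prop
  · refine Continuous.intervalIntegrable ?_ _ _
    have := hg.continuous
    fun_prop
  · have := secondCountableTopologyEither_of_left ℝ (E →L[ℝ] F)
    refine Continuous.aestronglyMeasurable ?_
    fun_prop
  · refine Filter.Eventually.of_forall fun τ hτ x hx => ?_
    rw [uIoc_of_le zero_le_one] at hτ
    exact hB (τ, x) ⟨⟨hτ.1.le, hτ.2⟩, hx⟩
  · simp
  · refine Filter.Eventually.of_forall fun τ _ x _ => ?_
    have h1 : HasFDerivAt (fun x : E => p + τ • (x - p)) (τ • ContinuousLinearMap.id ℝ E) x :=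
      (((hasFDerivAt_id x).sub_const p).const_smul τ).const_add p
    have h2 := ((hg.differentiable (by simp)) (p + τ • (x - p))).hasFDerivAt.comp x h1
    refine (h2.const_smul (κ τ)).congr_fderiv (ContinuousLinearMap.ext fun v => ?_)
    simp [mul_smul]

/-- The derivative of a ray average is again one, with weight `κ τ` and values in a space of linear
maps, so the induction has to range over all `F` and `κ`. -/
theorem contDiff_rayAverage_nat (n : ℕ) : ∀ {F : Type} [NormedAddCommGroup F] [NormedSpace ℝ F]
    {κ : ℝ → ℝ} (_ : Continuous κ) (p : E) {g : E → F} (_ : ContDiff ℝ ∞ g),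
    ContDiff ℝ n (rayAverage κ p g) := by
  induction n with
  | zero =>
    intro F _ _ κ hκ p g hg
    have h : Differentiable ℝ (rayAverage κ p g) := fun u =>
      (hasFDerivAt_rayAverage hκ p (hg.of_le (by exact_mod_cast le_top)) u).differentiableAt
    exact_mod_cast contDiff_zero.mpr h.continuous
  | succ n ih =>
    intro F _ _ κ hκ p g hg
    have hd := hasFDerivAt_rayAverage hκ p (hg.of_le (by exact_mod_cast le_top))
    push_cast
    rw [contDiff_succ_iff_fderiv]
    refine ⟨fun u => (hd u).differentiableAt, by simp, ?_⟩
    rw [show fderiv ℝ (rayAverage κ p g) = _ from funext fun u => (hd u).fderiv]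
    exact ih (by fun_prop) p (hg.fderiv_right (by simp))

theorem contDiff_rayAverage {κ : ℝ → ℝ} (hκ : Continuous κ) (p : E) {g : E → F}
    (hg : ContDiff ℝ ∞ g) : ContDiff ℝ ∞ (rayAverage κ p g) :=
  contDiff_infty.mpr fun n => contDiff_rayAverage_nat n hκ p hg

omit [ProperSpace E] in
-- Hadamard's lemma, that is, the fundamental theorem of calculus on the segment from `p` to `u`.
-- Applied to a smooth `g`, it writes `g - g p` as a smooth family of linear maps applied to `u -
-- p`.
theorem eq_add_rayAverage [CompleteSpace F] (p : E) {g : E → F} (hg : ContDiff ℝ 1 g) (u : E) :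
    g u = g p + rayAverage (fun _ => 1) p (fderiv ℝ g) u (u - p) := by
  have hg' : Continuous (fderiv ℝ g) := hg.continuous_fderiv (by simp)
  have hc : Continuous fun τ : ℝ => (1 : ℝ) • fderiv ℝ g (p + τ • (u - p)) := by fun_prop
  rw [rayAverage, ContinuousLinearMap.intervalIntegral_apply (hc.intervalIntegrable _ _)]
  have := intervalIntegral.integral_eq_sub_of_hasDerivAt (a := 0) (b := 1)
    (f := fun τ : ℝ => g (p + τ • (u - p)))
    (f' := fun τ : ℝ => ((1 : ℝ) • fderiv ℝ g (p + τ • (u - p))) (u - p)) (fun τ _ => ?_) ?_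
  · rw [this]; simp
  · have h1 : HasDerivAt (fun τ : ℝ => p + τ • (u - p)) (u - p) τ := by
      simpa using ((hasDerivAt_id τ).smul_const (u - p)).const_add p
    rw [one_smul]
    exact ((hg.differentiable (by simp)) _).hasFDerivAt.comp_hasDerivAt τ h1
  · exact (hc.clm_apply continuous_const).intervalIntegrable _ _

omit [ProperSpace E] in
theorem rayAverage_self [CompleteSpace F] (κ : ℝ → ℝ) (p : E) (g : E → F) :
    rayAverage κ p g p = (∫ τ in (0 : ℝ)..1, κ τ) • g p := by
  simp [rayAverage, intervalIntegral.integral_smul_const]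

end RayAverage

/-- A smooth function without zeros on a compact set has a globally smooth multiplicative inverse
on that set. -/
theorem exists_smooth_inv {E : Type*} [NormedAddCommGroup E] [NormedSpace ℝ E] {g : E → ℝ}
    (hg : ContDiff ℝ ∞ g) {K : Set E} (hK : IsCompact K) (h0 : ∀ u ∈ K, g u ≠ 0) :
    ∃ q : E → ℝ, ContDiff ℝ ∞ q ∧ ∀ u ∈ K, q u * g u = 1 := by
  obtain ⟨ε, hε, hεK⟩ : ∃ ε > 0, ∀ u ∈ K, ε ≤ g u ^ 2 := by
    rcases K.eq_empty_or_nonempty with rfl | hne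
    · exact ⟨1, one_pos, by simp⟩
    · obtain ⟨x, hx, hmin⟩ := hK.exists_isMinOn hne (hg.continuous.pow 2).continuousOn
      exact ⟨g x ^ 2, by have := h0 x hx; positivity, fun u hu => hmin hu⟩
  -- The second term vanishes once `g² ≥ ε`, in particular on `K`, and equals `ε` at the zeros of
  -- `g`; thus `d` is positive everywhere and `g / d = 1 / g` on `K`.
  set d : E → ℝ := fun u => g u ^ 2 + ε * (1 - Real.smoothTransition (g u ^ 2 / ε)) with hd
  have hdpos : ∀ u, d u ≠ 0 := by
    intro u
    have h1 := Real.smoothTransition.le_one (g u ^ 2 / ε)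
    rcases (sq_nonneg (g u)).eq_or_lt with h | h
    · simp only [hd, ← h, zero_div, Real.smoothTransition.zero]
      linarith
    · have : 0 ≤ ε * (1 - Real.smoothTransition (g u ^ 2 / ε)) := by
        apply mul_nonneg hε.le; linarith
      exact (by positivity : 0 < d u).ne'
  have hds : ContDiff ℝ ∞ d := by
    have : ContDiff ℝ ∞ fun u => Real.smoothTransition (g u ^ 2 / ε) :=
      Real.smoothTransition.contDiff.comp ((hg.pow 2).div_const ε)
    exact (hg.pow 2).add (contDiff_const.mul (contDiff_const.sub this))
  refine ⟨fun u => g u / d u, hg.div hds hdpos, fun u hu => ?_⟩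
  have h1 : d u = g u ^ 2 := by
    simp only [hd]
    rw [Real.smoothTransition.one_of_one_le ((one_le_div hε).mpr (hεK u hu))]
    ring
  have := h0 u hu
  simp only [h1]
  field_simp

end OscillatoryIntegral

/-! ### Polytopes and the divergence theorem on them. -/

namespace OscillatoryIntegral

open Set
open scoped ContDiff

/-- A compact set cut out by finitely many affine inequalities. -/
def IsPolytope {r : ℕ} (K : Set (Fin r → ℝ)) : Prop :=
  IsCompact K ∧ ∃ A : Set ((Fin r → ℝ) →ᵃ[ℝ] ℝ), A.Finite ∧ K = {u | ∀ l ∈ A, 0 ≤ l u}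

/-- The graph `u ↦ (u, g u)` of an affine function, with values in the `i`-th coordinate. -/
noncomputable def faceMap {r : ℕ} (i : Fin (r + 1)) (g : (Fin r → ℝ) →ᵃ[ℝ] ℝ) :
    (Fin r → ℝ) →ᵃ[ℝ] (Fin (r + 1) → ℝ) :=
  AffineMap.pi (i.insertNth g fun k => (LinearMap.proj k).toAffineMap)

theorem faceMap_apply {r : ℕ} (i : Fin (r + 1)) (g : (Fin r → ℝ) →ᵃ[ℝ] ℝ) (u : Fin r → ℝ) :
    faceMap i g u = i.insertNth (g u) u := by
  ext j
  refine Fin.succAboveCases i ?_ (fun k => ?_) j <;> simp [faceMap]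

theorem continuous_affine {r : ℕ} {F : Type*} [NormedAddCommGroup F] [NormedSpace ℝ F]
    (g : (Fin r → ℝ) →ᵃ[ℝ] F) : Continuous g :=
  g.continuous_of_finiteDimensional

theorem IsPolytope.isCompact {r : ℕ} {K : Set (Fin r → ℝ)} (hK : IsPolytope K) : IsCompact K := hK.1

theorem IsPolytope.convex {r : ℕ} {K : Set (Fin r → ℝ)} (hK : IsPolytope K) : Convex ℝ K := by
  obtain ⟨-, A, -, rfl⟩ := hK
  have : {u : Fin r → ℝ | ∀ l ∈ A, 0 ≤ l u} = ⋂ l ∈ A, l ⁻¹' Ici (0 : ℝ) := by ext; simp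
  rw [this]
  exact convex_iInter₂ fun l _ => (convex_Ici (0 : ℝ)).affine_preimage l

/-- Affine inequalities stay affine under composition with `faceMap`. This stability is what permits
induction on the dimension through faces. -/
theorem IsPolytope.preimage_faceMap {r : ℕ} {K : Set (Fin (r + 1) → ℝ)} (hK : IsPolytope K)
    (i : Fin (r + 1)) (g : (Fin r → ℝ) →ᵃ[ℝ] ℝ) : IsPolytope (faceMap i g ⁻¹' K) := by
  obtain ⟨hc, A, hA, hAK⟩ := hK
  refine ⟨?_, (fun l => l.comp (faceMap i g)) '' A, hA.image _, ?_⟩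
  -- Dropping the `i`-th coordinate inverts `faceMap` on the left, so the preimage is a closed
  -- subset of the projection of `K`.
  · have hp : Continuous fun u : Fin (r + 1) → ℝ => i.removeNth u :=
      continuous_pi fun k => continuous_apply _
    refine (hc.image hp).of_isClosed_subset
      (hc.isClosed.preimage (continuous_affine (faceMap i g))) ?_
    intro u hu
    exact ⟨_, hu, by rw [faceMap_apply]; simp⟩
  · ext u
    simp [hAK]

/-- A nonempty slice is the interval from the largest lower bound to the smallest upper bound; `P`
collects the constraints that do not involve `x`. All other bounds lie outside `S`, so the
indicators keep only the two end points, and injectivity keeps an end point from being counted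
twice. -/
theorem integral_slice {G : Type*} (U L : Finset G) (v : G → ℝ) (hU : InjOn v U) (hL : InjOn v L)
    {S : Set ℝ} (hS : IsCompact S) {P : Prop}
    (hSe : S = {x | P ∧ (∀ g ∈ U, x ≤ v g) ∧ ∀ g ∈ L, v g ≤ x}) {φ φ' : ℝ → ℂ}
    (hφ : ∀ x, HasDerivAt φ (φ' x) x) (hφ' : Continuous φ') :
    ∫ x in S, φ' x = ∑ g ∈ U, S.indicator φ (v g) - ∑ g ∈ L, S.indicator φ (v g) := by
  rcases S.eq_empty_or_nonempty with h | ⟨x₀, hx₀⟩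
  · simp [h]
  have hx₀' := hx₀
  rw [hSe] at hx₀'
  obtain ⟨hP, hx1, hx2⟩ := hx₀'
  -- Without an upper bound the slice would contain points arbitrarily far to the right, against
  -- compactness; likewise on the left.
  have hUne : U.Nonempty := by
    by_contra hne
    rw [Finset.not_nonempty_iff_eq_empty] at hne
    obtain ⟨B, hB⟩ := hS.bddAbove
    have : max x₀ (B + 1) ∈ S := by
      rw [hSe]
      exact ⟨hP, by simp [hne], fun g hg => (hx2 g hg).trans (le_max_left _ _)⟩
    have := (le_max_right x₀ (B + 1)).trans (hB this)
    linarith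
  have hLne : L.Nonempty := by
    by_contra hne
    rw [Finset.not_nonempty_iff_eq_empty] at hne
    obtain ⟨B, hB⟩ := hS.bddBelow
    have : min x₀ (B - 1) ∈ S := by
      rw [hSe]
      exact ⟨hP, fun g hg => (min_le_left _ _).trans (hx1 g hg), by simp [hne]⟩
    have := (hB this).trans (min_le_right x₀ (B - 1))
    linarith
  obtain ⟨g₁, hg₁, hmin⟩ := U.exists_min_image v hUne
  obtain ⟨g₂, hg₂, hmax⟩ := L.exists_max_image v hLne
  have hle : v g₂ ≤ v g₁ := (hx2 _ hg₂).trans (hx1 _ hg₁)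
  have hIcc : S = Icc (v g₂) (v g₁) := by
    rw [hSe]
    ext x
    exact ⟨fun h => ⟨h.2.2 _ hg₂, h.2.1 _ hg₁⟩,
      fun h => ⟨hP, fun g hg => h.2.trans (hmin g hg), fun g hg => (hmax g hg).trans h.1⟩⟩
  rw [Finset.sum_eq_single g₁, Finset.sum_eq_single g₂]
  · rw [hIcc, indicator_of_mem (right_mem_Icc.mpr hle), indicator_of_mem (left_mem_Icc.mpr hle),
      integral_Icc_eq_integral_Ioc, ← intervalIntegral.integral_of_le hle]
    exact intervalIntegral.integral_eq_sub_of_hasDerivAt (fun x _ => hφ x)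
      (hφ'.intervalIntegrable _ _)
  · intro g hg hne
    refine indicator_of_notMem (fun h => hne (hL hg hg₂ ?_)) _
    rw [hIcc] at h
    exact le_antisymm (hmax g hg) h.1
  · exact fun h => absurd hg₂ h
  · intro g hg hne
    refine indicator_of_notMem (fun h => hne (hU hg hg₁ ?_)) _
    rw [hIcc] at h
    exact le_antisymm h.2 (hmin g hg)
  · exact fun h => absurd hg₁ h

/-- Two different affine functions agree only on a proper affine subspace, which is null. Coinciding
bounds can therefore be ignored when integrating over slices. -/
theorem ae_injOn_eval {r : ℕ} (U : Finset ((Fin r → ℝ) →ᵃ[ℝ] ℝ)) :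
    ∀ᵐ u : Fin r → ℝ, InjOn (fun g : (Fin r → ℝ) →ᵃ[ℝ] ℝ => g u) U := by
  have h : ∀ g g' : (Fin r → ℝ) →ᵃ[ℝ] ℝ, g ≠ g' → ∀ᵐ u : Fin r → ℝ, g u ≠ g' u := by
    intro g g' hne
    obtain ⟨u₀, hu₀⟩ : ∃ u, g u ≠ g' u := by
      by_contra! h
      exact hne (AffineMap.ext h)
    have hs := Measure.addHaar_affineSubspace (volume : Measure (Fin r → ℝ))
      ((AffineSubspace.mk' (0 : ℝ) ⊥).comap (g - g')) (by
        intro htop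
        have : u₀ ∈ (AffineSubspace.mk' (0 : ℝ) ⊥).comap (g - g') := by rw [htop]; trivial
        simp [sub_eq_zero] at this
        exact hu₀ this)
    rw [ae_iff]
    convert hs using 2
    ext u
    simp [sub_eq_zero]
  have : ∀ᵐ u : Fin r → ℝ, ∀ q : U × U, q.1.1 ≠ q.2.1 → q.1.1 u ≠ q.2.1 u := by
    rw [ae_all_iff]
    intro q
    by_cases hq : q.1.1 = q.2.1
    · exact Eventually.of_forall fun u hn => absurd hq hn
    · filter_upwards [h _ _ hq] with u hu _ using hu
  filter_upwards [this] with u hu g hg g' hg' heq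
  by_contra hne
  exact hu (⟨g, hg⟩, ⟨g', hg'⟩) hne heq

theorem affine_insertNth {r : ℕ} (i : Fin (r + 1)) (l : (Fin (r + 1) → ℝ) →ᵃ[ℝ] ℝ) (x : ℝ)
    (u : Fin r → ℝ) :
    l (i.insertNth x u) = l (i.insertNth 0 u) + x * l.linear (Pi.single i 1) := by
  have : (i.insertNth x u : Fin (r + 1) → ℝ) = (x • Pi.single i (1 : ℝ)) +ᵥ i.insertNth 0 u := by
    ext j
    refine Fin.succAboveCases i ?_ (fun k => ?_) j <;> simp
  rw [this, AffineMap.map_vadd]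
  simp [add_comm]

/-- Integration of a partial derivative over a polytope: the result is a signed sum of integrals
over faces, which are the graphs of finitely many affine functions. -/
theorem IsPolytope.integral_partial {r : ℕ} {K : Set (Fin (r + 1) → ℝ)} (hK : IsPolytope K)
    (i : Fin (r + 1)) :
    ∃ U L : Finset ((Fin r → ℝ) →ᵃ[ℝ] ℝ),
      (∀ g, g ∈ U ∨ g ∈ L → ∀ u, faceMap i g u ∉ interior K) ∧
      ∀ f : (Fin (r + 1) → ℝ) → ℂ, ContDiff ℝ 1 f →
        ∫ u in K, fderiv ℝ f u (Pi.single i 1) =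
          (∑ g ∈ U, ∫ u in faceMap i g ⁻¹' K, f (faceMap i g u)) -
            ∑ g ∈ L, ∫ u in faceMap i g ⁻¹' K, f (faceMap i g u) := by
  classical
  obtain ⟨hc, A, hA, hAK⟩ := id hK
  set b : ((Fin (r + 1) → ℝ) →ᵃ[ℝ] ℝ) → ℝ := fun l => l.linear (Pi.single i 1) with hb
  -- The inequality `0 ≤ l (u, 0) + x b` is solved for `x`: it gives the upper bound `γ l` if `b <
  -- 0`, the lower bound `γ l` if `b > 0`, and a condition on `u` alone if `b = 0`. Taking images in
  -- `U` and `L` merges inequalities with the same graph.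
  set γ : ((Fin (r + 1) → ℝ) →ᵃ[ℝ] ℝ) → ((Fin r → ℝ) →ᵃ[ℝ] ℝ) :=
    fun l => (-(b l)⁻¹) • l.comp (faceMap i 0) with hγ
  have hγa : ∀ l u, γ l u = -(b l)⁻¹ * l (i.insertNth 0 u) := by
    intro l u
    simp [hγ, faceMap_apply]
  set U := (hA.toFinset.filter fun l => b l < 0).image γ with hU
  set L := (hA.toFinset.filter fun l => 0 < b l).image γ with hL
  have hmem : ∀ x u, (i.insertNth x u : Fin (r + 1) → ℝ) ∈ K ↔
      (∀ l ∈ A, b l = 0 → 0 ≤ l (i.insertNth 0 u)) ∧ (∀ g ∈ U, x ≤ g u) ∧ ∀ g ∈ L, g u ≤ x := by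
    intro x u
    have key : ∀ l, 0 ≤ l (i.insertNth x u : Fin (r + 1) → ℝ) ↔
        (b l = 0 → 0 ≤ l (i.insertNth 0 u)) ∧ (b l < 0 → x ≤ γ l u) ∧ (0 < b l → γ l u ≤ x) := by
      intro l
      rw [affine_insertNth, hγa]
      change 0 ≤ _ + x * b l ↔ _
      rcases lt_trichotomy (b l) 0 with h | h | h
      · have h1 : -(b l)⁻¹ * l (i.insertNth 0 u) = l (i.insertNth 0 u) / (-b l) := by
          field_simp
        simp only [h, h.ne, h.not_gt, false_imp_iff, true_imp_iff, and_true, true_and, h1]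
        rw [le_div_iff₀ (by linarith)]
        constructor <;> intro _ <;> linarith
      · simp [h]
      · have h1 : -(b l)⁻¹ * l (i.insertNth 0 u) = (-l (i.insertNth 0 u)) / (b l) := by
          field_simp
        simp only [h, h.ne', h.not_gt, false_imp_iff, true_imp_iff, true_and, h1]
        rw [div_le_iff₀ h]
        constructor <;> intro _ <;> linarith
    rw [hAK]
    simp only [mem_ofPred_eq, key, hU, hL, Finset.forall_mem_image, Finset.mem_filter,
      Set.Finite.mem_toFinset]
    exact ⟨fun h => ⟨fun l hl => (h l hl).1, fun l hl => (h l hl.1).2.1 hl.2,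
      fun l hl => (h l hl.1).2.2 hl.2⟩, fun h l hl => ⟨h.1 l hl, fun hn => h.2.1 ⟨hl, hn⟩,
      fun hn => h.2.2 ⟨hl, hn⟩⟩⟩
  have hins : ∀ u : Fin r → ℝ, Continuous fun x : ℝ => (i.insertNth x u : Fin (r + 1) → ℝ) :=
    fun u => Continuous.finInsertNth i continuous_id continuous_const
  have hslice : ∀ u : Fin r → ℝ, IsCompact {x : ℝ | (i.insertNth x u : Fin (r + 1) → ℝ) ∈ K} := by
    intro u
    refine (hc.image (continuous_apply i)).of_isClosed_subset (hc.isClosed.preimage (hins u)) ?_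
    intro x hx
    exact ⟨_, hx, by simp⟩
  refine ⟨U, L, ?_, fun f hf => ?_⟩
  -- A small move in the `i`-th direction off the graph, upwards for an upper bound and downwards
  -- for a lower one, violates that bound.
  · intro g hg u hu
    rw [faceMap_apply] at hu
    have hev : ∀ᶠ x in 𝓝 (g u), (i.insertNth x u : Fin (r + 1) → ℝ) ∈ K :=
      (hins u).continuousAt.eventually (mem_interior_iff_mem_nhds.mp hu)
    obtain ⟨ε, hε, hball⟩ := Metric.eventually_nhds_iff.mp hev
    rcases hg with hg | hg
    · have := ((hmem _ u).mp (hball (y := g u + ε / 2)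
        (by rw [Real.dist_eq, add_sub_cancel_left, abs_of_pos (by positivity)]; linarith))).2.1 g hg
      linarith
    · have := ((hmem _ u).mp (hball (y := g u - ε / 2)
        (by rw [Real.dist_eq, sub_sub_cancel_left, abs_neg, abs_of_pos (by positivity)]; linarith))).2.2 g hg
      linarith
  have hf' : Continuous fun u => fderiv ℝ f u (Pi.single i 1) :=
    (hf.continuous_fderiv (by simp)).clm_apply continuous_const
  have hKm : MeasurableSet K := hc.measurableSet
  have hint : Integrable (K.indicator fun u => fderiv ℝ f u (Pi.single i 1)) :=
    (integrable_indicator_iff hKm).mpr (hf'.continuousOn.integrableOn_compact hc)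
  have hmp := (volume_preserving_piFinSuccAbove (fun _ : Fin (r + 1) => ℝ) i).symm
  have hface : ∀ g : (Fin r → ℝ) →ᵃ[ℝ] ℝ,
      Integrable ((faceMap i g ⁻¹' K).indicator fun u => f (faceMap i g u)) := by
    intro g
    have := (hK.preimage_faceMap i g).isCompact
    refine (integrable_indicator_iff this.measurableSet).mpr ?_
    exact (hf.continuous.comp (continuous_affine _)).continuousOn.integrableOn_compact this
  have hfm : ∀ g : (Fin r → ℝ) →ᵃ[ℝ] ℝ, MeasurableSet (faceMap i g ⁻¹' K) := fun g =>
    (hK.preimage_faceMap i g).isCompact.measurableSet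
  -- Fubini with the `i`-th coordinate innermost reduces the claim to the slice formula for almost
  -- every `u`.
  rw [← integral_indicator hKm, ← hmp.integral_comp' , Measure.volume_eq_prod, integral_prod_symm]
  · simp_rw [← integral_indicator (hfm _)]
    rw [← integral_finsetSum _ fun g _ => hface g, ← integral_finsetSum _ fun g _ => hface g,
      ← integral_sub (integrable_finsetSum _ fun g _ => hface g)
        (integrable_finsetSum _ fun g _ => hface g)]
    refine integral_congr_ae ?_
    filter_upwards [ae_injOn_eval U, ae_injOn_eval L] with u hUi hLi
    have := integral_slice U L (fun g => g u) hUi hLi (hslice u)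
      (P := ∀ l ∈ A, b l = 0 → 0 ≤ l (i.insertNth 0 u)) (by ext x; exact hmem x u)
      (φ := fun x => f (i.insertNth x u))
      (φ' := fun x => fderiv ℝ f (i.insertNth x u) (Pi.single i 1)) (fun x => ?_)
      (hf'.comp (hins u))
    · rw [← integral_indicator (hslice u).measurableSet] at this
      refine Eq.trans ?_ (this.trans ?_)
      · rfl
      refine congrArg₂ _ (Finset.sum_congr rfl fun g _ => ?_) (Finset.sum_congr rfl fun g _ => ?_) <;>
      simp only [indicator, mem_preimage, faceMap_apply, mem_ofPred_eq]
    · have h1 : HasDerivAt (fun x : ℝ => (i.insertNth x u : Fin (r + 1) → ℝ)) (Pi.single i 1) x := by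
        rw [hasDerivAt_pi]
        intro j
        refine Fin.succAboveCases i ?_ (fun k => ?_) j
        · simpa using hasDerivAt_id' x
        · simpa using hasDerivAt_const x (u k)
      exact ((hf.differentiable (by simp)) _).hasFDerivAt.comp_hasDerivAt x h1
  · rw [← Measure.volume_eq_prod]
    exact hmp.integrable_comp_of_integrable hint

end OscillatoryIntegral

/-! ### Concave phases and vector fields adapted to them. -/

namespace OscillatoryIntegral

open Set
open scoped ContDiff

/-- The partial derivative of `f` in the `i`-th coordinate. -/
noncomputable def partialDeriv {r : ℕ} {F : Type*} [NormedAddCommGroup F] [NormedSpace ℝ F]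
    (i : Fin r) (f : (Fin r → ℝ) → F) (u : Fin r → ℝ) : F :=
  fderiv ℝ f u (Pi.single i 1)

/-- The divergence of a vector field. -/
noncomputable def divergence {r : ℕ} (X : Fin r → (Fin r → ℝ) → ℂ) (u : Fin r → ℝ) : ℂ :=
  ∑ i, partialDeriv i (X i) u

/-- A globally smooth function that is nonpositive and has a negative definite Hessian on `K`. -/
structure IsPhase {r : ℕ} (K : Set (Fin r → ℝ)) (ψ : (Fin r → ℝ) → ℝ) : Prop where
  smooth : ContDiff ℝ ∞ ψ
  nonpos : ∀ u ∈ K, ψ u ≤ 0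
  concave : ∀ u ∈ K, ∀ h ≠ 0, fderiv ℝ (fderiv ℝ ψ) u h h < 0

theorem contDiff_partialDeriv {r : ℕ} {F : Type*} [NormedAddCommGroup F] [NormedSpace ℝ F]
    (i : Fin r) {f : (Fin r → ℝ) → F} (hf : ContDiff ℝ ∞ f) : ContDiff ℝ ∞ (partialDeriv i f) :=
  (hf.fderiv_right (m := ∞) (by simp)).clm_apply contDiff_const

theorem contDiff_divergence {r : ℕ} {X : Fin r → (Fin r → ℝ) → ℂ}
    (hX : ∀ i, ContDiff ℝ ∞ (X i)) : ContDiff ℝ ∞ (divergence X) :=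
  ContDiff.sum fun i _ => contDiff_partialDeriv i (hX i)

theorem clm_apply_eq_sum {r : ℕ} {F : Type*} [NormedAddCommGroup F] [NormedSpace ℝ F]
    (A : (Fin r → ℝ) →L[ℝ] F) (v : Fin r → ℝ) : A v = ∑ l, v l • A (Pi.single l 1) := by
  have hv : v = ∑ l, v l • (Pi.single l 1 : Fin r → ℝ) := by
    ext j
    simp [Finset.sum_apply, Pi.single_apply]
  conv_lhs => rw [hv]
  simp

theorem linear_faceMap_ne_zero {r : ℕ} (i : Fin (r + 1)) (g : (Fin r → ℝ) →ᵃ[ℝ] ℝ)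
    {h : Fin r → ℝ} (hh : h ≠ 0) : (faceMap i g).linear h ≠ 0 := by
  intro h0
  apply hh
  have h1 := (faceMap i g).map_vadd 0 h
  rw [h0, zero_vadd, vadd_eq_add, add_zero, faceMap_apply, faceMap_apply] at h1
  ext k
  have := congrFun h1 (i.succAbove k)
  simpa using this

theorem hasFDerivAt_affine {r n : ℕ} (m : (Fin r → ℝ) →ᵃ[ℝ] (Fin n → ℝ)) (u : Fin r → ℝ) :
    HasFDerivAt m (LinearMap.toContinuousLinearMap m.linear) u := by
  have : (m : (Fin r → ℝ) → Fin n → ℝ) =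
      fun u => LinearMap.toContinuousLinearMap m.linear u + m 0 := by
    funext u
    have := m.map_vadd 0 u
    simpa using this
  rw [this]
  exact (ContinuousLinearMap.hasFDerivAt _).add_const _

theorem contDiff_affine {r n : ℕ} (m : (Fin r → ℝ) →ᵃ[ℝ] (Fin n → ℝ)) : ContDiff ℝ ∞ m := by
  have : (m : (Fin r → ℝ) → Fin n → ℝ) =
      fun u => LinearMap.toContinuousLinearMap m.linear u + m 0 := by
    funext u
    have := m.map_vadd 0 u
    simpa using this
  rw [this]
  exact (ContinuousLinearMap.contDiff _).add contDiff_const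

theorem fderiv_comp_affine {r n : ℕ} {F : Type*} [NormedAddCommGroup F] [NormedSpace ℝ F]
    {f : (Fin n → ℝ) → F} (hf : Differentiable ℝ f)
    (m : (Fin r → ℝ) →ᵃ[ℝ] (Fin n → ℝ)) (u : Fin r → ℝ) :
    fderiv ℝ (fun u => f (m u)) u =
      (fderiv ℝ f (m u)).comp (LinearMap.toContinuousLinearMap m.linear) :=
  ((hf (m u)).hasFDerivAt.comp u (hasFDerivAt_affine m u)).fderiv

theorem fderiv_fderiv_comp_affine {r n : ℕ} {f : (Fin n → ℝ) → ℝ} (hf : ContDiff ℝ ∞ f)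
    (m : (Fin r → ℝ) →ᵃ[ℝ] (Fin n → ℝ)) (u h : Fin r → ℝ) :
    fderiv ℝ (fderiv ℝ (fun u => f (m u))) u h h =
      fderiv ℝ (fderiv ℝ f) (m u) (m.linear h) (m.linear h) := by
  have hd : Differentiable ℝ (fderiv ℝ f) :=
    (hf.fderiv_right (m := ∞) (by simp)).differentiable (by simp)
  have h1 : fderiv ℝ (fun u => f (m u)) = fun u =>
      ((ContinuousLinearMap.compL ℝ (Fin r → ℝ) (Fin n → ℝ) ℝ).flip
        (LinearMap.toContinuousLinearMap m.linear)) (fderiv ℝ f (m u)) := by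
    funext u
    rw [fderiv_comp_affine (hf.differentiable (by simp))]
    rfl
  have h2 : HasFDerivAt (fun u =>
      ((ContinuousLinearMap.compL ℝ (Fin r → ℝ) (Fin n → ℝ) ℝ).flip
        (LinearMap.toContinuousLinearMap m.linear)) (fderiv ℝ f (m u))) _ u :=
    (ContinuousLinearMap.hasFDerivAt _).comp u
      ((hd (m u)).hasFDerivAt.comp u (hasFDerivAt_affine m u))
  rw [h1, h2.fderiv]
  rfl

/-- The linear part of `faceMap` is injective, so the restricted Hessian stays negative definite. -/
theorem IsPhase.face {r : ℕ} {K : Set (Fin (r + 1) → ℝ)} {ψ : (Fin (r + 1) → ℝ) → ℝ}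
    (hψ : IsPhase K ψ) (i : Fin (r + 1)) (g : (Fin r → ℝ) →ᵃ[ℝ] ℝ) :
    IsPhase (faceMap i g ⁻¹' K) fun u => ψ (faceMap i g u) where
  smooth := hψ.smooth.comp (contDiff_affine _)
  nonpos u hu := hψ.nonpos _ hu
  concave u hu h hh := by
    rw [fderiv_fderiv_comp_affine hψ.smooth]
    exact hψ.concave _ hu _ (linear_faceMap_ne_zero i g hh)

/-- Take `X = w ∇ψ / |∇ψ|²`, with the denominator inverted smoothly by `exists_smooth_inv`. Writing
`w = X · ∇ψ` makes `s w exp (s ψ)` a divergence up to a term without the factor `s`. -/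
theorem IsPhase.exists_field_of_forall_ne {r : ℕ} {K : Set (Fin r → ℝ)} (hK : IsPolytope K)
    {ψ : (Fin r → ℝ) → ℝ} (hψ : IsPhase K ψ) (hne : ∀ u ∈ K, fderiv ℝ ψ u ≠ 0)
    {w : (Fin r → ℝ) → ℂ} (hw : ContDiff ℝ ∞ w) :
    ∃ X : Fin r → (Fin r → ℝ) → ℂ, (∀ i, ContDiff ℝ ∞ (X i)) ∧
      ∀ u ∈ K, w u = ∑ i, X i u * ((partialDeriv i ψ u : ℝ) : ℂ) := by
  have hp := fun i => contDiff_partialDeriv i hψ.smooth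
  obtain ⟨q, hq, hqK⟩ := exists_smooth_inv (g := fun u => ∑ i, partialDeriv i ψ u ^ 2)
    (ContDiff.sum fun i _ => (hp i).pow 2) hK.isCompact (by
      intro u hu h0
      apply hne u hu
      rw [Finset.sum_eq_zero_iff_of_nonneg fun i _ => sq_nonneg _] at h0
      ext v
      rw [clm_apply_eq_sum]
      refine Finset.sum_eq_zero fun i hi => ?_
      have := pow_eq_zero_iff (two_ne_zero) |>.mp (h0 i hi)
      rw [partialDeriv] at this
      rw [this, smul_zero])
  refine ⟨fun i u => w u * ((partialDeriv i ψ u * q u : ℝ) : ℂ), fun i =>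
    hw.mul (Complex.ofRealCLM.contDiff.comp ((hp i).mul hq)), fun u hu => ?_⟩
  have h1 : ∑ i, w u * ((partialDeriv i ψ u * q u : ℝ) : ℂ) * ((partialDeriv i ψ u : ℝ) : ℂ) =
      w u * ((q u * ∑ i, partialDeriv i ψ u ^ 2 : ℝ) : ℂ) := by
    push_cast
    rw [Finset.mul_sum, Finset.mul_sum]
    exact Finset.sum_congr rfl fun i _ => by ring
  rw [h1, hqK u hu]
  simp

section Critical

variable {r : ℕ} {K : Set (Fin r → ℝ)} {ψ : (Fin r → ℝ) → ℝ} {p : Fin r → ℝ}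

theorem segment_mem (hK : Convex ℝ K) (hp : p ∈ K) {u : Fin r → ℝ} (hu : u ∈ K) {τ : ℝ}
    (hτ : τ ∈ Icc (0 : ℝ) 1) : p + τ • (u - p) ∈ K :=
  hK.add_smul_sub_mem hp hu hτ

theorem rayAverage_hessian_apply (hψ : ContDiff ℝ ∞ ψ) {κ : ℝ → ℝ} (hκ : Continuous κ)
    (u v : Fin r → ℝ) :
    rayAverage κ p (fderiv ℝ (fderiv ℝ ψ)) u v v =
      ∫ τ in (0 : ℝ)..1, κ τ * fderiv ℝ (fderiv ℝ ψ) (p + τ • (u - p)) v v := by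
  have h2 : Continuous (fderiv ℝ (fderiv ℝ ψ)) :=
    ((hψ.fderiv_right (m := ∞) (by simp)).fderiv_right (m := ∞) (by simp)).continuous
  have hc : Continuous fun τ : ℝ => κ τ • fderiv ℝ (fderiv ℝ ψ) (p + τ • (u - p)) := by fun_prop
  rw [rayAverage, ContinuousLinearMap.intervalIntegral_apply (hc.intervalIntegrable _ _),
    ContinuousLinearMap.intervalIntegral_apply]
  · rfl
  · exact (hc.clm_apply continuous_const).intervalIntegrable _ _

theorem fderiv_eq_rayAverage_hessian (hψ : ContDiff ℝ ∞ ψ) (hcrit : fderiv ℝ ψ p = 0)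
    (u : Fin r → ℝ) :
    fderiv ℝ ψ u = rayAverage (fun _ => 1) p (fderiv ℝ (fderiv ℝ ψ)) u (u - p) := by
  have h := eq_add_rayAverage p (g := fderiv ℝ ψ) ((hψ.fderiv_right (m := ∞) (by simp)).of_le
    (by exact_mod_cast le_top)) u
  rwa [hcrit, zero_add] at h

/-- Near a critical point the coordinates are smooth combinations of the partial derivatives. -/
theorem IsPhase.exists_inverse_hessian (hK : IsPolytope K) (hψ : IsPhase K ψ) (hp : p ∈ K)
    (hcrit : fderiv ℝ ψ p = 0) :
    ∃ N : Fin r → Fin r → (Fin r → ℝ) → ℝ, (∀ l j, ContDiff ℝ ∞ (N l j)) ∧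
      (∀ u ∈ K, ∀ l, u l - p l = ∑ j, N l j u * partialDeriv j ψ u) ∧
      ∑ j, ∑ l, N l j p * fderiv ℝ (fderiv ℝ ψ) p (Pi.single l 1) (Pi.single j 1) = r := by
  classical
  set A := rayAverage (fun _ => 1) p (fderiv ℝ (fderiv ℝ ψ)) with hA
  have hs2 : ContDiff ℝ ∞ (fderiv ℝ (fderiv ℝ ψ)) :=
    (hψ.smooth.fderiv_right (m := ∞) (by simp)).fderiv_right (m := ∞) (by simp)
  have hAs : ContDiff ℝ ∞ A := contDiff_rayAverage continuous_const p hs2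
  set M : (Fin r → ℝ) → Matrix (Fin r) (Fin r) ℝ :=
    fun u => Matrix.of fun j l => A u (Pi.single l 1) (Pi.single j 1) with hM
  have hMs : ∀ j l, ContDiff ℝ ∞ fun u => M u j l := fun j l =>
    (hAs.clm_apply contDiff_const).clm_apply contDiff_const
  have hdet : ∀ f : (Fin r → ℝ) → Matrix (Fin r) (Fin r) ℝ, (∀ j l, ContDiff ℝ ∞ fun u => f u j l) →
      ContDiff ℝ ∞ fun u => (f u).det := by
    intro f hf
    simp_rw [Matrix.det_apply']
    exact ContDiff.sum fun σ _ => contDiff_const.mul (contDiff_prod fun i _ => hf _ _)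
  -- A kernel vector `v` would give `A u v v = 0`, yet this number is an average of negative Hessian
  -- values along a segment that stays in `K` by convexity.
  have hinv : ∀ u ∈ K, (M u).det ≠ 0 := by
    intro u hu h0
    obtain ⟨v, hv, hMv⟩ := Matrix.exists_mulVec_eq_zero_iff.mpr h0
    have h1 : A u v v = ∑ j, v j * (M u).mulVec v j := by
      rw [clm_apply_eq_sum (A u v) v]
      refine Finset.sum_congr rfl fun j _ => ?_
      rw [clm_apply_eq_sum (A u) v, Matrix.mulVec, dotProduct, smul_eq_mul]
      congr 1
      simp [hM, mul_comm]
    rw [hMv, hA, rayAverage_hessian_apply hψ.smooth continuous_const] at h1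
    simp only [Pi.zero_apply, mul_zero, Finset.sum_const_zero, one_mul] at h1
    have h2 : 0 < ∫ τ in (0 : ℝ)..1, -fderiv ℝ (fderiv ℝ ψ) (p + τ • (u - p)) v v := by
      refine intervalIntegral.intervalIntegral_pos_of_pos_on ?_ (fun τ hτ => ?_) one_pos
      · have := hs2.continuous
        refine Continuous.intervalIntegrable ?_ _ _
        fun_prop
      · exact neg_pos.mpr (hψ.concave _ (segment_mem hK.convex hp hu ⟨hτ.1.le, hτ.2.le⟩) v hv)
    rw [intervalIntegral.integral_neg, h1] at h2
    simp at h2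
  obtain ⟨q, hq, hqK⟩ := exists_smooth_inv (hdet M hMs) hK.isCompact hinv
  -- This is the inverse of the averaged Hessian `M`, expressed through the adjugate so that it is
  -- smooth everywhere.
  refine ⟨fun l j u => q u * (M u).adjugate l j, fun l j => hq.mul ?_, ?_, ?_⟩
  · simp_rw [Matrix.adjugate_apply]
    refine hdet _ fun a b => ?_
    by_cases hab : a = j
    · subst hab
      simp only [Matrix.updateRow_self]
      exact contDiff_const
    · simp only [Matrix.updateRow_ne hab]
      exact hMs a b
  · intro u hu l
    have h1 : ∀ j, partialDeriv j ψ u = (M u).mulVec (u - p) j := by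
      intro j
      rw [partialDeriv, fderiv_eq_rayAverage_hessian hψ.smooth hcrit u]
      change A u (u - p) (Pi.single j 1) = _
      rw [clm_apply_eq_sum (A u) (u - p), Matrix.mulVec, dotProduct]
      simp [hM, mul_comm]
    have h2 : ∑ j, q u * (M u).adjugate l j * partialDeriv j ψ u =
        q u * ((M u).adjugate.mulVec ((M u).mulVec (u - p))) l := by
      rw [Matrix.mulVec, dotProduct, Finset.mul_sum]
      exact Finset.sum_congr rfl fun j _ => by rw [h1, mul_assoc]
    rw [h2, Matrix.mulVec_mulVec, Matrix.adjugate_mul, Matrix.smul_mulVec, Matrix.one_mulVec,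
      Pi.smul_apply, smul_eq_mul, ← mul_assoc, hqK u hu, one_mul, Pi.sub_apply]
  -- At `p` the average is the Hessian itself, so the double sum is the trace of the identity. It
  -- yields the divergence of the radial field.
  · have h1 : ∀ j l, fderiv ℝ (fderiv ℝ ψ) p (Pi.single l 1) (Pi.single j 1) = M p j l := by
      intro j l
      simp [hM, hA, rayAverage_self]
    have h2 : ∀ j, ∑ l, q p * (M p).adjugate l j * M p j l = 1 := by
      intro j
      have := congrFun (congrFun (Matrix.mul_adjugate (M p)) j) j
      rw [Matrix.mul_apply, Matrix.smul_apply, Matrix.one_apply_eq, smul_eq_mul, mul_one] at this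
      rw [← hqK p hp, ← this, Finset.mul_sum]
      exact Finset.sum_congr rfl fun l _ => by ring
    simp_rw [h1, h2]
    simp

/-- Hadamard's lemma gives `w = D(u)(u - p)`, and `u - p` is a smooth combination of the partial
derivatives of `ψ`. Vanishing of `w` at `p` replaces the absence of critical points. -/
theorem IsPhase.exists_field_of_critical (hK : IsPolytope K) (hψ : IsPhase K ψ) (hp : p ∈ K)
    (hcrit : fderiv ℝ ψ p = 0) {w : (Fin r → ℝ) → ℂ} (hw : ContDiff ℝ ∞ w) (hwp : w p = 0) :
    ∃ X : Fin r → (Fin r → ℝ) → ℂ, (∀ i, ContDiff ℝ ∞ (X i)) ∧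
      ∀ u ∈ K, w u = ∑ i, X i u * ((partialDeriv i ψ u : ℝ) : ℂ) := by
  obtain ⟨N, hN, hNK, -⟩ := hψ.exists_inverse_hessian hK hp hcrit
  set D := rayAverage (fun _ => 1) p (fderiv ℝ w) with hD
  have hDs : ContDiff ℝ ∞ D :=
    contDiff_rayAverage continuous_const p (hw.fderiv_right (m := ∞) (by simp))
  refine ⟨fun j u => ∑ l, (N l j u : ℂ) * D u (Pi.single l 1), fun j => ContDiff.sum fun l _ =>
    (Complex.ofRealCLM.contDiff.comp (hN l j)).mul (hDs.clm_apply contDiff_const),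
    fun u hu => ?_⟩
  rw [eq_add_rayAverage p (hw.of_le (by exact_mod_cast le_top)) u, hwp, zero_add]
  change D u (u - p) = _
  rw [clm_apply_eq_sum (D u) (u - p)]
  simp_rw [Finset.sum_mul]
  rw [Finset.sum_comm]
  refine Finset.sum_congr rfl fun l _ => ?_
  rw [Pi.sub_apply, hNK u hu l, Complex.real_smul]
  push_cast
  rw [Finset.sum_mul]
  exact Finset.sum_congr rfl fun j _ => by ring

theorem fderiv_apply_sub {F : Type*} [NormedAddCommGroup F] [NormedSpace ℝ F]
    {T : (Fin r → ℝ) → (Fin r → ℝ) →L[ℝ] F}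
    (hT : DifferentiableAt ℝ T p) : fderiv ℝ (fun u => T u (u - p)) p = T p := by
  have : HasFDerivAt (fun u => T u (u - p)) _ p :=
    hT.hasFDerivAt.clm_apply ((hasFDerivAt_id p).sub_const p)
  rw [this.fderiv]
  ext v
  simp

/-- The phase is a derivative of itself along a field that looks like half the radial field at the
critical point. -/
theorem IsPhase.exists_radial_field (hK : IsPolytope K) (hψ : IsPhase K ψ) (hp : p ∈ K)
    (hcrit : fderiv ℝ ψ p = 0) (hp0 : ψ p = 0) :
    ∃ Y : Fin r → (Fin r → ℝ) → ℂ, (∀ i, ContDiff ℝ ∞ (Y i)) ∧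
      (∀ u ∈ K, (ψ u : ℂ) = ∑ i, Y i u * ((partialDeriv i ψ u : ℝ) : ℂ)) ∧
      (∀ i, Y i p = 0) ∧ divergence Y p = r / 2 := by
  obtain ⟨N, hN, hNK, hNt⟩ := hψ.exists_inverse_hessian hK hp hcrit
  have hs1 : ContDiff ℝ ∞ (fderiv ℝ ψ) := hψ.smooth.fderiv_right (by simp)
  set B := rayAverage (fun _ => 1) p (fderiv ℝ ψ) with hB
  have hBs : ContDiff ℝ ∞ B := contDiff_rayAverage continuous_const p hs1
  set C := rayAverage (fun _ => 1) p (fderiv ℝ B) with hC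
  have hCs : ContDiff ℝ ∞ C :=
    contDiff_rayAverage continuous_const p (hBs.fderiv_right (m := ∞) (by simp))
  have hBp : B p = 0 := by simp [hB, rayAverage_self, hcrit]
  have hCp : C p = (2⁻¹ : ℝ) • fderiv ℝ (fderiv ℝ ψ) p := by
    rw [hC, rayAverage_self, hB, (hasFDerivAt_rayAverage continuous_const p
      (hs1.of_le (by exact_mod_cast le_top)) p).fderiv, rayAverage_self]
    simp
  -- Applying Hadamard's lemma twice gives `ψ = C(u)(u - p)(u - p)`; one of the two factors `u - p`
  -- is then expressed through `∇ψ` by means of `N`. As `C p` is half the Hessian, the field is `(u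
  -- - p) / 2` to first order.
  set T : Fin r → (Fin r → ℝ) → ((Fin r → ℝ) →L[ℝ] ℝ) := fun j u =>
    ∑ l, N l j u • C u (Pi.single l 1) with hT
  have hTs : ∀ j, ContDiff ℝ ∞ (T j) := fun j => ContDiff.sum fun l _ =>
    (hN l j).smul (hCs.clm_apply contDiff_const)
  have hYs : ∀ j, ContDiff ℝ ∞ fun u => T j u (u - p) := fun j =>
    (hTs j).clm_apply (contDiff_id.sub contDiff_const)
  refine ⟨fun j u => ((T j u (u - p) : ℝ) : ℂ), fun j => Complex.ofRealCLM.contDiff.comp (hYs j),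
    fun u hu => ?_, fun j => by simp, ?_⟩
  · have h1 : ψ u = C u (u - p) (u - p) := by
      rw [eq_add_rayAverage p (hψ.smooth.of_le (by exact_mod_cast le_top)) u, hp0, zero_add]
      change B u (u - p) = _
      rw [eq_add_rayAverage p (hBs.of_le (by exact_mod_cast le_top)) u, hBp, zero_add]
    have h2 : ψ u = ∑ j, T j u (u - p) * partialDeriv j ψ u := by
      rw [h1, clm_apply_eq_sum (C u) (u - p)]
      simp only [hT, _root_.sum_apply, _root_.smul_apply, smul_eq_mul, Finset.sum_mul]
      rw [Finset.sum_comm]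
      refine Finset.sum_congr rfl fun l _ => ?_
      rw [Pi.sub_apply, hNK u hu l, Finset.sum_mul]
      exact Finset.sum_congr rfl fun j _ => by ring
    rw [h2]
    push_cast
    rfl
  · have h1 : ∀ j, partialDeriv j (fun u => ((T j u (u - p) : ℝ) : ℂ)) p =
        ((T j p (Pi.single j 1) : ℝ) : ℂ) := by
      intro j
      have h2 : HasFDerivAt (fun u => T j u (u - p)) (T j p) p := by
        rw [← fderiv_apply_sub ((hTs j).differentiable (by simp) p)]
        exact ((hYs j).differentiable (by simp) p).hasFDerivAt
      have h3 : HasFDerivAt (fun u => ((T j u (u - p) : ℝ) : ℂ)) _ p :=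
        Complex.ofRealCLM.hasFDerivAt.comp p h2
      rw [partialDeriv, h3.fderiv]
      rfl
    rw [divergence, Finset.sum_congr rfl fun j _ => h1 j]
    have h3 : ∑ j, T j p (Pi.single j 1) = (r : ℝ) / 2 := by
      rw [← hNt, Finset.sum_div]
      refine Finset.sum_congr rfl fun j _ => ?_
      simp only [hT, _root_.sum_apply, _root_.smul_apply, smul_eq_mul, hCp, Finset.sum_div]
      exact Finset.sum_congr rfl fun l _ => by ring
    rw [← Complex.ofReal_sum, h3]
    simp

end Critical

end OscillatoryIntegral

/-! ### Oscillatory integrals and integration by parts. -/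

namespace OscillatoryIntegral

open Set Asymptotics
open scoped ContDiff

/-- The integral of `w * exp (s * ψ)` over `K`. -/
noncomputable def osc {r : ℕ} (K : Set (Fin r → ℝ)) (ψ : (Fin r → ℝ) → ℝ) (w : (Fin r → ℝ) → ℂ)
    (s : ℂ) : ℂ :=
  ∫ u in K, w u * Complex.exp (s * ψ u)

/-- The half plane `1 ≤ Re s`. -/
def halfPlane : Set ℂ := {s | 1 ≤ s.re}

theorem one_le_norm {s : ℂ} (hs : s ∈ halfPlane) : 1 ≤ ‖s‖ :=
  le_trans hs (Complex.re_le_norm s)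

theorem isBigO_rpow_of_le {e e' : ℝ} (h : e ≤ e') :
    (fun s : ℂ => ‖s‖ ^ e) =O[𝓟 halfPlane] fun s : ℂ => ‖s‖ ^ e' := by
  refine IsBigO.of_bound 1 ?_
  filter_upwards [mem_principal_self halfPlane] with s hs
  have h1 := one_le_norm hs
  rw [one_mul, Real.norm_of_nonneg (by positivity), Real.norm_of_nonneg (by positivity)]
  exact Real.rpow_le_rpow_of_exponent_le h1 h

section Basic

variable {r : ℕ} {K : Set (Fin r → ℝ)} {ψ : (Fin r → ℝ) → ℝ} {w w' : (Fin r → ℝ) → ℂ}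

theorem integrableOn_osc (hK : IsCompact K) (hψ : Continuous ψ) (hw : Continuous w) (s : ℂ) :
    IntegrableOn (fun u => w u * Complex.exp (s * ψ u)) K := by
  refine ContinuousOn.integrableOn_compact hK (Continuous.continuousOn ?_)
  fun_prop

theorem osc_congr (hK : IsCompact K) (h : ∀ u ∈ K, w u = w' u) (s : ℂ) :
    osc K ψ w s = osc K ψ w' s :=
  setIntegral_congr_fun hK.measurableSet fun u hu => by simp only [h u hu]

theorem osc_add (hK : IsCompact K) (hψ : Continuous ψ) (hw : Continuous w) (hw' : Continuous w')
    (s : ℂ) : osc K ψ (fun u => w u + w' u) s = osc K ψ w s + osc K ψ w' s := by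
  rw [osc, osc, osc, ← integral_add (integrableOn_osc hK hψ hw s) (integrableOn_osc hK hψ hw' s)]
  simp only [add_mul]

theorem osc_const_mul (c s : ℂ) : osc K ψ (fun u => c * w u) s = c * osc K ψ w s := by
  rw [osc, osc, ← integral_const_mul]
  simp only [mul_assoc]

theorem osc_zero (s : ℂ) : osc K ψ (fun _ => 0) s = 0 := by
  simp [osc]

theorem isBigO_one_osc (hK : IsCompact K) (hψ0 : ∀ u ∈ K, ψ u ≤ 0) (hw : Continuous w) :
    osc K ψ w =O[𝓟 halfPlane] fun _ => (1 : ℝ) := by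
  obtain ⟨B, hB⟩ := hK.exists_bound_of_continuousOn hw.continuousOn
  refine IsBigO.of_bound (B * volume.real K) ?_
  filter_upwards [mem_principal_self halfPlane] with s hs
  rw [norm_one, mul_one]
  refine norm_setIntegral_le_of_norm_le_const hK.measure_lt_top fun u hu => ?_
  rw [norm_mul, Complex.norm_exp]
  have h1 : (s * ψ u).re ≤ 0 := by
    rw [Complex.re_mul_ofReal]
    exact mul_nonpos_of_nonneg_of_nonpos (zero_le_one.trans hs) (hψ0 u hu)
  calc ‖w u‖ * Real.exp (s * ψ u).re ≤ B * 1 :=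
        mul_le_mul (hB u hu) (Real.exp_le_one_iff.mpr h1) (Real.exp_pos _).le
          ((norm_nonneg _).trans (hB u hu))
    _ = B := mul_one B

theorem hasDerivAt_osc (hK : IsCompact K) (hψ : Continuous ψ) (hw : Continuous w) (s : ℂ) :
    HasDerivAt (osc K ψ w) (osc K ψ (fun u => w u * ψ u) s) s := by
  have hc : Continuous fun q : ℂ × (Fin r → ℝ) =>
      w q.2 * ψ q.2 * Complex.exp (q.1 * ψ q.2) := by fun_prop
  obtain ⟨B, hB⟩ := ((isCompact_closedBall s 1).prod hK).exists_bound_of_continuousOn hc.continuousOn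
  refine (hasDerivAt_integral_of_dominated_loc_of_deriv_le (μ := volume.restrict K)
    (F' := fun s u => w u * ψ u * Complex.exp (s * ψ u)) (bound := fun _ => B)
    (Metric.closedBall_mem_nhds s one_pos) ?_ ?_ ?_ ?_ ?_ ?_).2
  · refine Eventually.of_forall fun s => Continuous.aestronglyMeasurable ?_
    fun_prop
  · exact integrableOn_osc hK hψ hw s
  · refine Continuous.aestronglyMeasurable ?_
    fun_prop
  · filter_upwards [ae_restrict_mem hK.measurableSet] with u hu s' hs'
    exact hB (s', u) ⟨hs', hu⟩
  · exact integrableOn_const hK.measure_lt_top.ne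
  · refine Eventually.of_forall fun u s' _ => ?_
    have h1 : HasDerivAt (fun s : ℂ => s * (ψ u : ℂ)) (ψ u : ℂ) s' := by
      simpa using (hasDerivAt_id' s').mul_const (ψ u : ℂ)
    refine (h1.cexp.const_mul (w u)).congr_deriv ?_
    ring

end Basic

theorem partialDeriv_mul_cexp {r : ℕ} {ψ : (Fin r → ℝ) → ℝ} (hψ : ContDiff ℝ ∞ ψ)
    {f : (Fin r → ℝ) → ℂ} (hf : ContDiff ℝ ∞ f) (s : ℂ) (i : Fin r) (u : Fin r → ℝ) :
    partialDeriv i (fun u => f u * Complex.exp (s * ψ u)) u =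
      partialDeriv i f u * Complex.exp (s * ψ u) +
        s * (f u * ((partialDeriv i ψ u : ℝ) : ℂ) * Complex.exp (s * ψ u)) := by
  have h1 : HasFDerivAt (fun u => (ψ u : ℂ)) (Complex.ofRealCLM.comp (fderiv ℝ ψ u)) u :=
    Complex.ofRealCLM.hasFDerivAt.comp u (hψ.differentiable (by simp) u).hasFDerivAt
  have h2 := (hf.differentiable (by simp) u).hasFDerivAt.mul ((h1.const_mul s).cexp)
  have h3 : HasFDerivAt (fun u => f u * Complex.exp (s * ψ u)) _ u := h2
  rw [partialDeriv, h3.fderiv, partialDeriv, partialDeriv]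
  simp
  ring

/-- The divergence of `X exp (s ψ)` is `(div X + s X · ∇ψ) exp (s ψ)`; the right-hand side is the
boundary contribution. -/
theorem integration_by_parts {r : ℕ} {K : Set (Fin r → ℝ)} (hK : IsCompact K)
    {ψ : (Fin r → ℝ) → ℝ} (hψ : ContDiff ℝ ∞ ψ) {X : Fin r → (Fin r → ℝ) → ℂ}
    (hX : ∀ i, ContDiff ℝ ∞ (X i)) (s : ℂ) :
    s * osc K ψ (fun u => ∑ i, X i u * ((partialDeriv i ψ u : ℝ) : ℂ)) s +
        osc K ψ (divergence X) s =
      ∑ i, ∫ u in K, partialDeriv i (fun u => X i u * Complex.exp (s * ψ u)) u := by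
  have hp := fun i => (contDiff_partialDeriv i hψ).continuous
  have hpX := fun i => (contDiff_partialDeriv i (hX i)).continuous
  have hXc := fun i => (hX i).continuous
  have hψc := hψ.continuous
  simp_rw [partialDeriv_mul_cexp hψ (hX _)]
  rw [← integral_finsetSum, osc, osc, ← integral_const_mul, ← integral_add]
  · refine integral_congr_ae (Eventually.of_forall fun u => ?_)
    simp only [divergence, Finset.sum_mul, Finset.mul_sum, ← Finset.sum_add_distrib]
    exact Finset.sum_congr rfl fun i _ => by ring
  · refine ContinuousOn.integrableOn_compact hK (Continuous.continuousOn ?_)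
    fun_prop
  · exact integrableOn_osc hK hψc (contDiff_divergence hX).continuous s
  · intro i _
    refine ContinuousOn.integrableOn_compact hK (Continuous.continuousOn ?_)
    have := hXc i
    have := hpX i
    have := hp i
    fun_prop

/-- The boundary contribution is a signed sum of oscillatory integrals over lower-dimensional
polytopes, so a bound on each face is a bound on the whole. The list of faces depends on `K` alone,
and no face meets the interior, so amplitudes vanishing off the interior have no boundary term. -/
theorem IsPolytope.exists_faces {r : ℕ} {K : Set (Fin (r + 1) → ℝ)} (hK : IsPolytope K) :
    ∃ Φ : Set (Fin (r + 1) × ((Fin r → ℝ) →ᵃ[ℝ] ℝ)), Φ.Finite ∧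
      (∀ q ∈ Φ, ∀ u, faceMap q.1 q.2 u ∉ interior K) ∧
      ∀ ψ : (Fin (r + 1) → ℝ) → ℝ, ContDiff ℝ ∞ ψ → ∀ X : Fin (r + 1) → (Fin (r + 1) → ℝ) → ℂ,
        (∀ i, ContDiff ℝ ∞ (X i)) → ∀ e : ℝ,
        (∀ q ∈ Φ, osc (faceMap q.1 q.2 ⁻¹' K) (fun u => ψ (faceMap q.1 q.2 u))
          (fun u => X q.1 (faceMap q.1 q.2 u)) =O[𝓟 halfPlane] fun s => ‖s‖ ^ e) →
        (fun s => s * osc K ψ (fun u => ∑ i, X i u * ((partialDeriv i ψ u : ℝ) : ℂ)) s +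
          osc K ψ (divergence X) s) =O[𝓟 halfPlane] fun s => ‖s‖ ^ e := by
  choose U L hint h using fun i => hK.integral_partial i
  refine ⟨⋃ i, Prod.mk i '' {g | g ∈ U i ∨ g ∈ L i}, ?_, ?_, ?_⟩
  · refine finite_iUnion fun i => Set.Finite.image _ ?_
    exact ((U i).finite_toSet.union (L i).finite_toSet)
  · intro q hq
    simp only [mem_iUnion, mem_image] at hq
    obtain ⟨i, g, hg, rfl⟩ := hq
    exact hint i g hg
  · intro ψ hψ X hX e hq
    simp_rw [integration_by_parts hK.isCompact hψ hX]
    refine IsBigO.fun_sum fun i _ => ?_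
    have hC : ∀ s : ℂ, ContDiff ℝ 1 fun u => X i u * Complex.exp (s * ψ u) := by
      intro s
      exact ((hX i).mul (contDiff_const.mul (Complex.ofRealCLM.contDiff.comp hψ)).cexp).of_le
        (by exact_mod_cast le_top)
    have hs := fun s => h i _ (hC s)
    simp only [partialDeriv]
    simp_rw [hs]
    refine IsBigO.sub (IsBigO.fun_sum fun g hg => ?_) (IsBigO.fun_sum fun g hg => ?_)
    · exact hq (i, g) (mem_iUnion.mpr ⟨i, g, Or.inl hg, rfl⟩)
    · exact hq (i, g) (mem_iUnion.mpr ⟨i, g, Or.inr hg, rfl⟩)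

end OscillatoryIntegral

/-! ### Gaussian bounds on the real axis and transport along arcs. -/

namespace OscillatoryIntegral

open Set Asymptotics
open scoped ContDiff

section Quadratic

variable {r : ℕ} {K : Set (Fin r → ℝ)} {ψ : (Fin r → ℝ) → ℝ} {p : Fin r → ℝ}

theorem IsPhase.exists_hessian_le (hK : IsPolytope K) (hψ : IsPhase K ψ) :
    ∃ c > 0, ∀ u ∈ K, ∀ v, fderiv ℝ (fderiv ℝ ψ) u v v ≤ -c * ‖v‖ ^ 2 := by
  have h2 : Continuous (fderiv ℝ (fderiv ℝ ψ)) :=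
    ((hψ.smooth.fderiv_right (m := ∞) (by simp)).fderiv_right (m := ∞) (by simp)).continuous
  have hc : Continuous fun q : (Fin r → ℝ) × (Fin r → ℝ) =>
      fderiv ℝ (fderiv ℝ ψ) q.1 q.2 q.2 := by fun_prop
  obtain ⟨c, hc0, hcK⟩ : ∃ c > 0, ∀ u ∈ K, ∀ v ∈ Metric.sphere (0 : Fin r → ℝ) 1,
      fderiv ℝ (fderiv ℝ ψ) u v v ≤ -c := by
    have hcomp := hK.isCompact.prod (isCompact_sphere (0 : Fin r → ℝ) 1)
    rcases (K ×ˢ Metric.sphere (0 : Fin r → ℝ) 1).eq_empty_or_nonempty with he | hne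
    · refine ⟨1, one_pos, fun u hu v hv => ?_⟩
      have : (u, v) ∈ (∅ : Set ((Fin r → ℝ) × (Fin r → ℝ))) := he ▸ ⟨hu, hv⟩
      exact this.elim
    · obtain ⟨q, hq, hmax⟩ := hcomp.exists_isMaxOn hne hc.continuousOn
      refine ⟨-fderiv ℝ (fderiv ℝ ψ) q.1 q.2 q.2, neg_pos.mpr (hψ.concave _ hq.1 _ ?_),
        fun u hu v hv => ?_⟩
      · rintro h0
        have := hq.2
        rw [h0] at this
        simp at this
      · rw [neg_neg]
        exact hmax (show (u, v) ∈ _ from ⟨hu, hv⟩)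
  refine ⟨c, hc0, fun u hu v => ?_⟩
  rcases eq_or_ne v 0 with rfl | hv
  · simp
  · have hn : 0 < ‖v‖ := norm_pos_iff.mpr hv
    have h3 := hcK u hu (‖v‖⁻¹ • v) (by simp [norm_smul, hn.ne'])
    simp only [map_smul, _root_.smul_apply, smul_eq_mul] at h3
    have h4 : fderiv ℝ (fderiv ℝ ψ) u v v =
        ‖v‖ ^ 2 * (‖v‖⁻¹ * (‖v‖⁻¹ * fderiv ℝ (fderiv ℝ ψ) u v v)) := by
      field_simp
    rw [h4]
    nlinarith [mul_le_mul_of_nonneg_left h3 (sq_nonneg ‖v‖)]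

/-- Integrating the uniform Hessian bound along the segment from `p` bounds the radial derivative;
integrating again bounds `ψ`. In particular a critical point is the unique maximum on `K`. -/
theorem IsPhase.exists_le_sub (hK : IsPolytope K) (hψ : IsPhase K ψ) (hp : p ∈ K)
    (hcrit : fderiv ℝ ψ p = 0) : ∃ c > 0, ∀ u ∈ K, ψ u ≤ ψ p - c * ‖u - p‖ ^ 2 := by
  obtain ⟨c, hc, hH⟩ := hψ.exists_hessian_le hK
  have hs1 : ContDiff ℝ ∞ (fderiv ℝ ψ) := hψ.smooth.fderiv_right (by simp)
  have hc1 := hs1.continuous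
  have h2 : Continuous (fderiv ℝ (fderiv ℝ ψ)) := (hs1.fderiv_right (m := ∞) (by simp)).continuous
  have hgrad : ∀ u ∈ K, fderiv ℝ ψ u (u - p) ≤ -c * ‖u - p‖ ^ 2 := by
    intro u hu
    rw [fderiv_eq_rayAverage_hessian hψ.smooth hcrit, rayAverage_hessian_apply hψ.smooth
      continuous_const]
    have := intervalIntegral.integral_mono_on (a := 0) (b := 1) (μ := volume) zero_le_one
      (f := fun τ : ℝ => 1 * fderiv ℝ (fderiv ℝ ψ) (p + τ • (u - p)) (u - p) (u - p))
      (g := fun _ => -c * ‖u - p‖ ^ 2) (Continuous.intervalIntegrable (by fun_prop) _ _)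
      (by simp) (fun τ hτ => by
        rw [one_mul]
        exact hH _ (segment_mem hK.convex hp hu hτ) _)
    simpa using this
  refine ⟨c / 2, by positivity, fun u hu => ?_⟩
  have hcc : Continuous fun τ : ℝ => (1 : ℝ) • fderiv ℝ ψ (p + τ • (u - p)) := by fun_prop
  rw [eq_add_rayAverage p (hψ.smooth.of_le (by exact_mod_cast le_top)) u, rayAverage,
    ContinuousLinearMap.intervalIntegral_apply (hcc.intervalIntegrable _ _)]
  have := intervalIntegral.integral_mono_on (a := 0) (b := 1) (μ := volume) zero_le_one
    (f := fun τ : ℝ => ((1 : ℝ) • fderiv ℝ ψ (p + τ • (u - p))) (u - p))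
    (g := fun τ => τ * (-c * ‖u - p‖ ^ 2)) (Continuous.intervalIntegrable (by fun_prop) _ _)
    (Continuous.intervalIntegrable (by fun_prop) _ _) (fun τ hτ => by
      rw [one_smul]
      -- The gradient bound at `p + τ (u - p)` is tested on `τ (u - p)`, so a factor `τ` has to be
      -- cancelled; at `τ = 0` both sides vanish.
      rcases hτ.1.eq_or_lt with h0 | h0
      · simp [← h0, hcrit]
      · have := hgrad _ (segment_mem hK.convex hp hu hτ)
        rw [add_sub_cancel_left, map_smul, smul_eq_mul, norm_smul, Real.norm_of_nonneg hτ.1] at this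
        refine le_of_mul_le_mul_left (this.trans_eq ?_) h0
        ring)
  rw [intervalIntegral.integral_mul_const, integral_id] at this
  linarith

theorem integrable_exp_neg_mul_sq_norm {c : ℝ} (hc : 0 < c) :
    Integrable fun v : Fin r → ℝ => Real.exp (-c * ‖v‖ ^ 2) := by
  rcases Nat.eq_zero_or_pos r with rfl | hr
  · exact Integrable.of_finite
  have hr' : (0 : ℝ) < r := by exact_mod_cast hr
  have h1 : Integrable fun v : Fin r → ℝ => ∏ i, Real.exp (-(c / r) * v i ^ 2) :=
    Integrable.fintype_prod fun i => integrable_exp_neg_mul_sq (by positivity)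
  refine h1.mono' (by fun_prop) (Eventually.of_forall fun v => ?_)
  rw [Real.norm_of_nonneg (Real.exp_pos _).le, ← Real.exp_sum, Real.exp_le_exp, ← Finset.mul_sum]
  have h2 : ∑ i, v i ^ 2 ≤ r * ‖v‖ ^ 2 := by
    calc ∑ i, v i ^ 2 ≤ ∑ _i : Fin r, ‖v‖ ^ 2 := Finset.sum_le_sum fun i _ => by
          rw [← sq_abs]
          exact pow_le_pow_left₀ (abs_nonneg _) (norm_le_pi_norm v i) 2
      _ = r * ‖v‖ ^ 2 := by simp
  have h3 : c / r * ∑ i, v i ^ 2 ≤ c / r * (r * ‖v‖ ^ 2) := by gcongr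
  have h4 : c / r * (r * ‖v‖ ^ 2) = c * ‖v‖ ^ 2 := by field_simp
  linarith

theorem integral_exp_neg_mul_sq_norm_smul (c : ℝ) {ρ : ℝ} (hρ : 0 < ρ) (p : Fin r → ℝ) :
    ∫ u : Fin r → ℝ, Real.exp (-c * (ρ * ‖u - p‖ ^ 2)) =
      ρ ^ (-(r : ℝ) / 2) * ∫ v : Fin r → ℝ, Real.exp (-c * ‖v‖ ^ 2) := by
  rw [integral_sub_right_eq_self (fun u : Fin r → ℝ => Real.exp (-c * (ρ * ‖u‖ ^ 2))) p]
  have h := Measure.integral_comp_smul (volume : Measure (Fin r → ℝ))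
    (fun v => Real.exp (-c * ‖v‖ ^ 2)) (√ρ)
  have h1 : ∀ u : Fin r → ℝ, ‖√ρ • u‖ ^ 2 = ρ * ‖u‖ ^ 2 := by
    intro u
    rw [norm_smul, mul_pow, Real.norm_of_nonneg (Real.sqrt_nonneg _), Real.sq_sqrt hρ.le]
  simp only [h1] at h
  rw [h, smul_eq_mul, Module.finrank_fin_fun, abs_of_nonneg (by positivity)]
  congr 1
  rw [Real.sqrt_eq_rpow, ← Real.rpow_natCast, ← Real.rpow_mul hρ.le, ← Real.rpow_neg hρ.le]
  congr 1
  ring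

/-- The integrand is dominated by a Gaussian of width `ρ ^ (-1/2)`. For complex `s` absolute values
would only give decay in `Re s`, hence the restriction to real parameters. -/
theorem IsPhase.exists_bound_osc_real (hK : IsPolytope K) (hψ : IsPhase K ψ) (hp : p ∈ K)
    (hcrit : fderiv ℝ ψ p = 0) {w : (Fin r → ℝ) → ℂ} (hw : Continuous w) :
    ∃ C, ∀ ρ : ℝ, 1 ≤ ρ → ‖osc K ψ w ρ‖ ≤ C * ρ ^ (-(r : ℝ) / 2) := by
  obtain ⟨c, hc, hle⟩ := hψ.exists_le_sub hK hp hcrit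
  obtain ⟨B, hB⟩ := hK.isCompact.exists_bound_of_continuousOn hw.continuousOn
  have hB0 : 0 ≤ B := (norm_nonneg _).trans (hB p hp)
  refine ⟨B * ∫ v : Fin r → ℝ, Real.exp (-c * ‖v‖ ^ 2), fun ρ hρ => ?_⟩
  have hρ0 : 0 < ρ := one_pos.trans_le hρ
  have hint : Integrable fun u : Fin r → ℝ => Real.exp (-c * (ρ * ‖u - p‖ ^ 2)) := by
    have := (integrable_exp_neg_mul_sq_norm (r := r) (c := c * ρ) (by positivity)).comp_sub_right p
    refine this.congr (Eventually.of_forall fun u => ?_)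
    simp only
    ring_nf
  calc ‖osc K ψ w ρ‖ ≤ ∫ u in K, B * Real.exp (-c * (ρ * ‖u - p‖ ^ 2)) := by
        refine norm_integral_le_of_norm_le (hint.const_mul B).integrableOn ?_
        filter_upwards [ae_restrict_mem hK.isCompact.measurableSet] with u hu
        rw [norm_mul, Complex.norm_exp]
        refine mul_le_mul (hB u hu) (Real.exp_le_exp.mpr ?_) (Real.exp_pos _).le hB0
        rw [Complex.re_mul_ofReal, Complex.ofReal_re]
        have h1 := hle u hu
        have h2 := hψ.nonpos p hp
        have : ψ u ≤ -(c * ‖u - p‖ ^ 2) := by linarith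
        nlinarith
    _ ≤ ∫ u, B * Real.exp (-c * (ρ * ‖u - p‖ ^ 2)) :=
        setIntegral_le_integral (hint.const_mul B) (Eventually.of_forall fun u => by positivity)
    _ = _ := by
        rw [integral_const_mul, integral_exp_neg_mul_sq_norm_smul c hρ0]
        ring

end Quadratic

section Arc

/-- The point of the arc from `‖s‖` to `s` with parameter `t`. -/
noncomputable def arc (s : ℂ) (t : ℝ) : ℂ := ‖s‖ * Complex.exp ((s.arg * t : ℝ) * Complex.I)

theorem norm_arc (s : ℂ) (t : ℝ) : ‖arc s t‖ = ‖s‖ := by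
  rw [arc, norm_mul, Complex.norm_exp_ofReal_mul_I, mul_one, Complex.norm_real, norm_norm]

theorem arc_zero (s : ℂ) : arc s 0 = ‖s‖ := by simp [arc]

theorem arc_one (s : ℂ) : arc s 1 = s := by simp [arc]

/-- Moving from `s` back along the arc decreases the absolute value of the argument, so its cosine,
and with it the real part, can only grow. -/
theorem arc_mem {s : ℂ} (hs : s ∈ halfPlane) {t : ℝ} (ht : t ∈ Icc (0 : ℝ) 1) :
    arc s t ∈ halfPlane := by
  have h1 : (arc s t).re = ‖s‖ * Real.cos (s.arg * t) := by
    rw [arc, Complex.re_ofReal_mul, Complex.exp_ofReal_mul_I_re]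
  have h2 : s.re = ‖s‖ * Real.cos s.arg := by
    rw [← Complex.norm_mul_cos_arg]
  have h3 : Real.cos s.arg ≤ Real.cos (s.arg * t) := by
    rw [← Real.cos_abs s.arg, ← Real.cos_abs (s.arg * t)]
    refine Real.cos_le_cos_of_nonneg_of_le_pi (abs_nonneg _) (Complex.abs_arg_le_pi s) ?_
    rw [abs_mul, abs_of_nonneg ht.1]
    exact mul_le_of_le_one_right (abs_nonneg _) ht.2
  change 1 ≤ (arc s t).re
  have hs' : 1 ≤ s.re := hs
  rw [h1]
  rw [h2] at hs'
  exact hs'.trans (mul_le_mul_of_nonneg_left h3 (norm_nonneg _))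

theorem hasDerivAt_arc (s : ℂ) (t : ℝ) :
    HasDerivAt (arc s) (arc s t * (s.arg * Complex.I)) t := by
  have h1 : HasDerivAt (fun t : ℝ => ((s.arg * t : ℝ) : ℂ) * Complex.I) (s.arg * Complex.I) t := by
    have := ((hasDerivAt_id' t).const_mul s.arg).ofReal_comp.mul_const Complex.I
    simpa using this
  refine (h1.cexp.const_mul (‖s‖ : ℂ)).congr_deriv ?_
  rw [arc]
  ring

/-- The function `J` along the arc from `‖s‖` to `s`, twisted by the phase of `s ^ κ`. -/
noncomputable def twist (κ : ℝ) (J : ℂ → ℂ) (s : ℂ) (t : ℝ) : ℂ :=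
  Complex.exp (κ * ((s.arg * t : ℝ) * Complex.I)) * J (arc s t)

theorem norm_twist (κ : ℝ) (J : ℂ → ℂ) (s : ℂ) (t : ℝ) : ‖twist κ J s t‖ = ‖J (arc s t)‖ := by
  rw [twist, norm_mul, ← mul_assoc, ← Complex.ofReal_mul, Complex.norm_exp_ofReal_mul_I, one_mul]

/-- The twist is `s ^ κ J` without its modulus. Its derivative along the circle is the Euler
operator `s J' + κ J` times a factor of modulus `|arg s|`. -/
theorem hasDerivAt_twist (κ : ℝ) {J J' : ℂ → ℂ} (hJ : ∀ s, HasDerivAt J (J' s) s) (s : ℂ) (t : ℝ) :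
    HasDerivAt (twist κ J s) (Complex.exp (κ * ((s.arg * t : ℝ) * Complex.I)) *
      (s.arg * Complex.I) * (arc s t * J' (arc s t) + κ * J (arc s t))) t := by
  have h1 : HasDerivAt (fun t : ℝ => (κ : ℂ) * (((s.arg * t : ℝ) : ℂ) * Complex.I))
      (κ * (s.arg * Complex.I)) t := by
    have := (((hasDerivAt_id' t).const_mul s.arg).ofReal_comp.mul_const Complex.I).const_mul (κ : ℂ)
    simpa using this
  have h2 : HasDerivAt (fun t => J (arc s t)) (J' (arc s t) * (arc s t * (s.arg * Complex.I))) t :=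
    (hJ (arc s t)).comp t (hasDerivAt_arc s t)
  refine (h1.cexp.mul h2).congr_deriv ?_
  ring

theorem norm_deriv_twist_le (κ : ℝ) (J J' : ℂ → ℂ) (s : ℂ) (t : ℝ) :
    ‖Complex.exp (κ * ((s.arg * t : ℝ) * Complex.I)) *
      (s.arg * Complex.I) * (arc s t * J' (arc s t) + κ * J (arc s t))‖ ≤
      Real.pi * ‖arc s t * J' (arc s t) + κ * J (arc s t)‖ := by
  rw [norm_mul, norm_mul, ← mul_assoc, ← Complex.ofReal_mul, Complex.norm_exp_ofReal_mul_I, one_mul,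
    norm_mul, Complex.norm_I, mul_one, Complex.norm_real]
  exact mul_le_mul_of_nonneg_right (Complex.abs_arg_le_pi s) (norm_nonneg _)

/-- Grönwall's inequality for `|s| ^ κ` times the twist: the value at the start of the arc is
bounded by `C` on the real axis, and since the angle is at most `π` the constants do not depend on
`s`. -/
theorem isBigO_of_arc {κ : ℝ} {J J' : ℂ → ℂ} (hJ : ∀ s, HasDerivAt J (J' s) s)
    (hE : (fun s => s * J' s + κ * J s) =O[𝓟 halfPlane] fun s => ‖s‖ ^ (-κ) + ‖J s‖)
    (hreal : ∃ C, ∀ ρ : ℝ, 1 ≤ ρ → ‖J ρ‖ ≤ C * ρ ^ (-κ)) :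
    J =O[𝓟 halfPlane] fun s => ‖s‖ ^ (-κ) := by
  obtain ⟨A, hA⟩ := hE.bound
  obtain ⟨C, hC⟩ := hreal
  rw [eventually_principal] at hA
  refine IsBigO.of_bound (gronwallBound C (Real.pi * |A|) (Real.pi * |A|) 1) ?_
  filter_upwards [mem_principal_self halfPlane] with s hs
  have hn := one_le_norm hs
  have hn0 : 0 < ‖s‖ := one_pos.trans_le hn
  have hpow : 0 < ‖s‖ ^ κ := by positivity
  have hpm : ‖s‖ ^ κ * ‖s‖ ^ (-κ) = 1 := by
    rw [← Real.rpow_add hn0, add_neg_cancel, Real.rpow_zero]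
  have key := norm_le_gronwallBound_of_norm_deriv_right_le
    (f := fun t => ((‖s‖ ^ κ : ℝ) : ℂ) * twist κ J s t) (a := 0) (b := 1) (δ := C)
    (K := Real.pi * |A|) (ε := Real.pi * |A|)
    (fun t _ => ((hasDerivAt_twist κ hJ s t).const_mul _).continuousAt.continuousWithinAt)
    (fun t _ => ((hasDerivAt_twist κ hJ s t).const_mul _).hasDerivWithinAt) ?_ ?_ 1 (by simp)
  · simp only [norm_mul, norm_twist, arc_one, sub_zero, Complex.norm_real,
      Real.norm_of_nonneg hpow.le] at key
    rw [Real.norm_of_nonneg (by positivity)]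
    calc ‖J s‖ = ‖s‖ ^ κ * ‖J s‖ * ‖s‖ ^ (-κ) := by
          rw [mul_right_comm, hpm, one_mul]
      _ ≤ _ := mul_le_mul_of_nonneg_right key (by positivity)
  · simp only [norm_mul, norm_twist, arc_zero, Complex.norm_real, Real.norm_of_nonneg hpow.le]
    calc ‖s‖ ^ κ * ‖J ‖s‖‖ ≤ ‖s‖ ^ κ * (C * ‖s‖ ^ (-κ)) :=
          mul_le_mul_of_nonneg_left (hC _ hn) hpow.le
      _ = C := by rw [mul_left_comm, hpm, mul_one]
  · intro t ht
    have h1 := hA (arc s t) (arc_mem hs ⟨ht.1, ht.2.le⟩)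
    rw [norm_arc, Real.norm_of_nonneg (by positivity)] at h1
    rw [norm_mul, norm_mul _ (twist κ J s t), norm_twist, Complex.norm_real,
      Real.norm_of_nonneg hpow.le]
    calc _ ≤ ‖s‖ ^ κ * (Real.pi * (|A| * (‖s‖ ^ (-κ) + ‖J (arc s t)‖))) := by
          refine mul_le_mul_of_nonneg_left ((norm_deriv_twist_le κ J J' s t).trans ?_) hpow.le
          refine mul_le_mul_of_nonneg_left (h1.trans ?_) Real.pi_pos.le
          exact mul_le_mul_of_nonneg_right (le_abs_self A) (by positivity)
      _ = Real.pi * |A| * (‖s‖ ^ κ * ‖J (arc s t)‖) +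
            Real.pi * |A| * (‖s‖ ^ κ * ‖s‖ ^ (-κ)) := by ring
      _ = _ := by rw [hpm, mul_one]

/-- With an error free of `J` the mean value inequality suffices: `s ^ κ J` varies little along the
arc. This carries asymptotics, not only bounds, away from the real axis. -/
theorem isBigO_sub_of_arc {κ e : ℝ} {J J' : ℂ → ℂ} (hJ : ∀ s, HasDerivAt J (J' s) s)
    (hE : (fun s => s * J' s + κ * J s) =O[𝓟 halfPlane] fun s => ‖s‖ ^ e) :
    (fun s => s ^ (κ : ℂ) * J s - (‖s‖ : ℂ) ^ (κ : ℂ) * J ‖s‖) =O[𝓟 halfPlane]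
      fun s => ‖s‖ ^ (κ + e) := by
  obtain ⟨A, hA⟩ := hE.bound
  rw [eventually_principal] at hA
  refine IsBigO.of_bound (Real.pi * |A|) ?_
  filter_upwards [mem_principal_self halfPlane] with s hs
  have hn := one_le_norm hs
  have hn0 : 0 < ‖s‖ := one_pos.trans_le hn
  have hs0 : s ≠ 0 := norm_pos_iff.mp hn0
  have hpow : 0 < ‖s‖ ^ κ := by positivity
  have h1 : (‖s‖ : ℂ) ^ (κ : ℂ) = ((‖s‖ ^ κ : ℝ) : ℂ) := by
    rw [Complex.ofReal_cpow hn0.le]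
  have h2 : s ^ (κ : ℂ) = ((‖s‖ ^ κ : ℝ) : ℂ) * Complex.exp (κ * (s.arg * Complex.I)) := by
    rw [Complex.cpow_def_of_ne_zero hs0, Complex.log, ← h1,
      Complex.cpow_def_of_ne_zero (by exact_mod_cast hn0.ne'), ← Complex.exp_add,
      ← Complex.ofReal_log hn0.le]
    congr 1
    ring
  have h3 : s ^ (κ : ℂ) * J s - (‖s‖ : ℂ) ^ (κ : ℂ) * J ‖s‖ =
      ((‖s‖ ^ κ : ℝ) : ℂ) * (twist κ J s 1 - twist κ J s 0) := by
    rw [h1, h2, twist, twist, arc_one, arc_zero]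
    simp
    ring
  rw [h3, norm_mul, Complex.norm_real, Real.norm_of_nonneg hpow.le,
    Real.norm_of_nonneg (by positivity), Real.rpow_add hn0]
  have h4 : ‖twist κ J s 1 - twist κ J s 0‖ ≤ Real.pi * |A| * ‖s‖ ^ e * (1 - 0) := by
    refine norm_image_sub_le_of_norm_deriv_le_segment' (a := 0) (b := 1)
      (fun t _ => (hasDerivAt_twist κ hJ s t).hasDerivWithinAt) (fun t ht => ?_) 1 (by simp)
    have h5 := hA (arc s t) (arc_mem hs ⟨ht.1, ht.2.le⟩)
    rw [norm_arc, Real.norm_of_nonneg (by positivity)] at h5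
    refine (norm_deriv_twist_le κ J J' s t).trans ?_
    rw [mul_assoc]
    refine mul_le_mul_of_nonneg_left (h5.trans ?_) Real.pi_pos.le
    exact mul_le_mul_of_nonneg_right (le_abs_self A) (by positivity)
  calc _ ≤ ‖s‖ ^ κ * (Real.pi * |A| * ‖s‖ ^ e * (1 - 0)) := mul_le_mul_of_nonneg_left h4 hpow.le
    _ = _ := by ring

end Arc

end OscillatoryIntegral

/-! ### Decay in the half plane, by induction on the dimension. -/

namespace OscillatoryIntegral

open Set Asymptotics
open scoped ContDiff

/-- The decay of oscillatory integrals over polytopes in dimension `r`. -/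
def Decays (r : ℕ) : Prop :=
  ∀ (K : Set (Fin r → ℝ)) (ψ : (Fin r → ℝ) → ℝ), IsPolytope K → IsPhase K ψ →
    (∀ w : (Fin r → ℝ) → ℂ, ContDiff ℝ ∞ w →
      osc K ψ w =O[𝓟 halfPlane] fun s => ‖s‖ ^ (-(r : ℝ) / 2)) ∧
    ∀ p ∈ K, fderiv ℝ ψ p = 0 → ∀ w : (Fin r → ℝ) → ℂ, ContDiff ℝ ∞ w → w p = 0 →
      osc K ψ w =O[𝓟 halfPlane] fun s => ‖s‖ ^ (-((r : ℝ) + 1) / 2)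

theorem decays_zero : Decays 0 := by
  intro K ψ hK hψ
  refine ⟨fun w hw => ?_, fun p _ _ w _ hwp => ?_⟩
  · simpa using isBigO_one_osc hK.isCompact hψ.nonpos hw.continuous
  · have : w = fun _ => 0 := by
      funext u
      rw [Subsingleton.elim u p, hwp]
    rw [this]
    refine IsBigO.of_bound 1 (Eventually.of_forall fun s => ?_)
    rw [osc_zero, norm_zero]
    positivity

theorem isBigO_inv_mul {f : ℂ → ℂ} {F : ℂ → ℝ}
    (h : (fun s => s * f s) =O[𝓟 halfPlane] F) : f =O[𝓟 halfPlane] fun s => ‖s‖⁻¹ * F s := by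
  have h1 := (isBigO_refl (fun s : ℂ => s⁻¹) (𝓟 halfPlane)).norm_right.mul h
  refine h1.congr' ?_ ?_
  · filter_upwards [mem_principal_self halfPlane] with s hs
    have : s ≠ 0 := norm_pos_iff.mp (one_pos.trans_le (one_le_norm hs))
    field_simp
  · exact Eventually.of_forall fun s => by simp only [norm_inv]

theorem inv_mul_rpow {s : ℂ} (hs : s ∈ halfPlane) (e : ℝ) : ‖s‖⁻¹ * ‖s‖ ^ e = ‖s‖ ^ (e - 1) := by
  have := one_pos.trans_le (one_le_norm hs)
  rw [Real.rpow_sub_one this.ne', div_eq_inv_mul]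

theorem rpow_le_of_mem {s : ℂ} (hs : s ∈ halfPlane) {e e' : ℝ} (h : e ≤ e') :
    ‖s‖ ^ e ≤ ‖s‖ ^ e' :=
  Real.rpow_le_rpow_of_exponent_le (one_le_norm hs) h

theorem isBigO_of_le_of_mem {f g : ℂ → ℝ} (h : ∀ s ∈ halfPlane, 0 ≤ f s ∧ f s ≤ g s) :
    f =O[𝓟 halfPlane] g := by
  refine IsBigO.of_bound 1 ?_
  filter_upwards [mem_principal_self halfPlane] with s hs
  obtain ⟨h0, h1⟩ := h s hs
  rw [one_mul, Real.norm_of_nonneg h0, Real.norm_of_nonneg (h0.trans h1)]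
  exact h1

theorem osc_add_const_mul {n : ℕ} {K : Set (Fin n → ℝ)} (hK : IsCompact K)
    {ψ : (Fin n → ℝ) → ℝ} (hψ : Continuous ψ) {w χ : (Fin n → ℝ) → ℂ} (hw : Continuous w)
    (hχ : Continuous χ) (c s : ℂ) :
    osc K ψ (fun u => w u + c * χ u) s = osc K ψ w s + c * osc K ψ χ s := by
  rw [osc_add hK hψ hw (by fun_prop), osc_const_mul]

section Recursion

variable {r : ℕ} {K : Set (Fin (r + 1) → ℝ)} {ψ : (Fin (r + 1) → ℝ) → ℝ} {p : Fin (r + 1) → ℝ}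

/-- Integration by parts expresses `s · osc w` as a boundary contribution minus `osc (div X)`; the
faces have dimension `r`, where decay is already known. -/
theorem Decays.isBigO_mul_osc (hT : Decays r) (hK : IsPolytope K) (hψ : IsPhase K ψ)
    {X : Fin (r + 1) → (Fin (r + 1) → ℝ) → ℂ} (hX : ∀ i, ContDiff ℝ ∞ (X i))
    {w : (Fin (r + 1) → ℝ) → ℂ}
    (hw : ∀ u ∈ K, w u = ∑ i, X i u * ((partialDeriv i ψ u : ℝ) : ℂ)) {F : ℂ → ℝ}
    (hF : (fun s : ℂ => ‖s‖ ^ (-(r : ℝ) / 2)) =O[𝓟 halfPlane] F)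
    (hdiv : osc K ψ (divergence X) =O[𝓟 halfPlane] F) :
    (fun s => s * osc K ψ w s) =O[𝓟 halfPlane] F := by
  obtain ⟨Φ, -, -, hΦ⟩ := hK.exists_faces
  have h := hΦ ψ hψ.smooth X hX (-(r : ℝ) / 2) fun q _ =>
    (hT _ _ (hK.preimage_faceMap q.1 q.2) (hψ.face q.1 q.2)).1 _
      ((hX q.1).comp (contDiff_affine _))
  refine ((h.trans hF).sub hdiv).congr_left fun s => ?_
  rw [osc_congr hK.isCompact hw]
  ring

/-- Each integration by parts improves the bound for all amplitudes at once. Half a power per round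
is enough, until the limit `r / 2 + 1` set by the boundary terms is reached. -/
theorem Decays.isBigO_of_forall_ne (hT : Decays r) (hK : IsPolytope K) (hψ : IsPhase K ψ)
    (hne : ∀ u ∈ K, fderiv ℝ ψ u ≠ 0) (m : ℕ) (hm : m ≤ r + 2) :
    ∀ w : (Fin (r + 1) → ℝ) → ℂ, ContDiff ℝ ∞ w →
      osc K ψ w =O[𝓟 halfPlane] fun s => ‖s‖ ^ (-(m : ℝ) / 2) := by
  induction m with
  | zero =>
    intro w hw
    simpa using isBigO_one_osc hK.isCompact hψ.nonpos hw.continuous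
  | succ m ih =>
    intro w hw
    have hm' : (m : ℝ) + 1 ≤ r + 2 := by exact_mod_cast hm
    obtain ⟨X, hX, hwX⟩ := hψ.exists_field_of_forall_ne hK hne hw
    have h := hT.isBigO_mul_osc hK hψ hX hwX (F := fun s => ‖s‖ ^ (-((m : ℝ) - 1) / 2))
      (isBigO_rpow_of_le (by linarith))
      ((ih (by lia) _ (contDiff_divergence hX)).trans (isBigO_rpow_of_le (by linarith)))
    refine (isBigO_inv_mul h).trans (isBigO_of_le_of_mem fun s hs => ⟨by positivity, ?_⟩)
    rw [inv_mul_rpow hs]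
    refine rpow_le_of_mem hs ?_
    push_cast
    linarith

variable {χ : (Fin (r + 1) → ℝ) → ℂ}

/-- Since `w - w(p) χ` vanishes at the critical point, it can be integrated by parts. Repeating this
reduces every amplitude to the single one `χ`, up to the stated power. -/
theorem Decays.isBigO_of_critical (hT : Decays r) (hK : IsPolytope K) (hψ : IsPhase K ψ)
    (hp : p ∈ K) (hcrit : fderiv ℝ ψ p = 0) (hχ : ContDiff ℝ ∞ χ) (hχp : χ p = 1)
    (m : ℕ) (hm : m ≤ r + 1) :
    ∀ w : (Fin (r + 1) → ℝ) → ℂ, ContDiff ℝ ∞ w →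
      osc K ψ w =O[𝓟 halfPlane] fun s => ‖osc K ψ χ s‖ + ‖s‖ ^ (-(m : ℝ) / 2) := by
  induction m with
  | zero =>
    intro w hw
    refine (isBigO_one_osc hK.isCompact hψ.nonpos hw.continuous).trans
      (isBigO_of_le_of_mem fun s hs => ⟨zero_le_one, ?_⟩)
    simp
  | succ m ih =>
    intro w hw
    have hm' : (m : ℝ) + 1 ≤ r + 1 := by exact_mod_cast hm
    have hw1 : ContDiff ℝ ∞ fun u => w u + -w p * χ u := hw.add (contDiff_const.mul hχ)
    obtain ⟨X, hX, hwX⟩ := hψ.exists_field_of_critical hK hp hcrit hw1 (by simp [hχp])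
    have h := hT.isBigO_mul_osc hK hψ hX hwX
      (F := fun s => ‖osc K ψ χ s‖ + ‖s‖ ^ (-((m : ℝ) - 1) / 2))
      (isBigO_of_le_of_mem fun s hs => ⟨by positivity,
        (rpow_le_of_mem hs (by linarith)).trans (le_add_of_nonneg_left (norm_nonneg _))⟩)
      ((ih (by lia) _ (contDiff_divergence hX)).trans (isBigO_of_le_of_mem fun s hs =>
        ⟨by positivity, add_le_add_right (rpow_le_of_mem hs (by linarith)) _⟩))
    have h1 : osc K ψ (fun u => w u + -w p * χ u) =O[𝓟 halfPlane]
        fun s => ‖osc K ψ χ s‖ + ‖s‖ ^ (-((m + 1 : ℕ) : ℝ) / 2) := by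
      refine (isBigO_inv_mul h).trans (isBigO_of_le_of_mem fun s hs => ⟨by positivity, ?_⟩)
      rw [mul_add, inv_mul_rpow hs]
      refine add_le_add (mul_le_of_le_one_left (norm_nonneg _)
        (inv_le_one_of_one_le₀ (one_le_norm hs))) (rpow_le_of_mem hs ?_)
      push_cast
      linarith
    have h2 : (fun s => w p * osc K ψ χ s) =O[𝓟 halfPlane]
        fun s => ‖osc K ψ χ s‖ + ‖s‖ ^ (-((m + 1 : ℕ) : ℝ) / 2) := by
      refine ((isBigO_refl (osc K ψ χ) _).norm_right.trans (isBigO_of_le_of_mem fun s hs =>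
        ⟨norm_nonneg _, le_add_of_nonneg_right (by positivity)⟩)).const_mul_left _
    refine (h1.add h2).congr_left fun s => ?_
    rw [osc_add_const_mul hK.isCompact hψ.smooth.continuous hw.continuous hχ.continuous]
    ring

/-- One further integration by parts shows that amplitudes vanishing at `p` gain a factor `1 / s`
over the cutoff integral, apart from the contribution of the faces. -/
theorem Decays.isBigO_mul_of_eq_zero (hT : Decays r) (hK : IsPolytope K) (hψ : IsPhase K ψ)
    (hp : p ∈ K) (hcrit : fderiv ℝ ψ p = 0) (hχ : ContDiff ℝ ∞ χ) (hχp : χ p = 1)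
    {w : (Fin (r + 1) → ℝ) → ℂ} (hw : ContDiff ℝ ∞ w) (hwp : w p = 0) :
    osc K ψ w =O[𝓟 halfPlane]
      fun s => ‖s‖⁻¹ * ‖osc K ψ χ s‖ + ‖s‖ ^ (-((r : ℝ) + 2) / 2) := by
  obtain ⟨X, hX, hwX⟩ := hψ.exists_field_of_critical hK hp hcrit hw hwp
  have h := hT.isBigO_mul_osc hK hψ hX hwX
    (F := fun s => ‖osc K ψ χ s‖ + ‖s‖ ^ (-(r : ℝ) / 2))
    (isBigO_of_le_of_mem fun s hs => ⟨by positivity, le_add_of_nonneg_left (norm_nonneg _)⟩)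
    ((hT.isBigO_of_critical hK hψ hp hcrit hχ hχp (r + 1) le_rfl _ (contDiff_divergence hX)).trans
      (isBigO_of_le_of_mem fun s hs => ⟨by positivity, add_le_add_right (rpow_le_of_mem hs (by
        push_cast
        linarith)) _⟩))
  refine (isBigO_inv_mul h).trans (isBigO_of_le_of_mem fun s hs => ⟨by positivity, ?_⟩)
  rw [mul_add, inv_mul_rpow hs]
  refine add_le_add_right (rpow_le_of_mem hs ?_) _
  linarith

theorem partialDeriv_mul {n : ℕ} {f g : (Fin n → ℝ) → ℂ} (hf : ContDiff ℝ ∞ f)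
    (hg : ContDiff ℝ ∞ g) (i : Fin n) (u : Fin n → ℝ) :
    partialDeriv i (fun u => f u * g u) u = f u * partialDeriv i g u + g u * partialDeriv i f u := by
  have h : HasFDerivAt (fun u => f u * g u) _ u :=
    (hf.differentiable (by simp) u).hasFDerivAt.mul (hg.differentiable (by simp) u).hasFDerivAt
  rw [partialDeriv, h.fderiv]
  simp [partialDeriv]

/-- The differential equation satisfied by the integral of a cutoff function at the critical
point, up to the boundary term. -/
theorem Decays.isBigO_euler (hT : Decays r) (hK : IsPolytope K) (hψ : IsPhase K ψ)
    (hp : p ∈ K) (hcrit : fderiv ℝ ψ p = 0) (hχ : ContDiff ℝ ∞ χ) (hχp : χ p = 1)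
    {Y : Fin (r + 1) → (Fin (r + 1) → ℝ) → ℂ} (hY : ∀ i, ContDiff ℝ ∞ (Y i))
    (hψY : ∀ u ∈ K, (ψ u : ℂ) = ∑ i, Y i u * ((partialDeriv i ψ u : ℝ) : ℂ))
    (hYp : ∀ i, Y i p = 0) (hYd : divergence Y p = (r + 1 : ℕ) / 2) {e : ℝ}
    (he : -((r : ℝ) + 2) / 2 ≤ e)
    (hB : (fun s => s * osc K ψ (fun u => ∑ i, χ u * Y i u * ((partialDeriv i ψ u : ℝ) : ℂ)) s +
      osc K ψ (divergence fun i u => χ u * Y i u) s) =O[𝓟 halfPlane] fun s => ‖s‖ ^ e) :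
    (fun s => s * osc K ψ (fun u => χ u * ψ u) s +
      ((((r : ℝ) + 1) / 2 : ℝ) : ℂ) * osc K ψ χ s) =O[𝓟 halfPlane]
      fun s => ‖s‖ ^ e + ‖s‖⁻¹ * ‖osc K ψ χ s‖ := by
  have hX : ∀ i, ContDiff ℝ ∞ fun u => χ u * Y i u := fun i => hχ.mul (hY i)
  set c : ℂ := ((((r : ℝ) + 1) / 2 : ℝ) : ℂ) with hc
  have hdiv := contDiff_divergence hX
  have hw1 : ContDiff ℝ ∞ fun u => divergence (fun i u => χ u * Y i u) u + -c * χ u :=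
    hdiv.add (contDiff_const.mul hχ)
  -- Because `Y` vanishes at `p`, the gradient of `χ` does not enter, and `div (χ Y)` takes the
  -- value `div Y = (r + 1) / 2` there. So `osc (div (χ Y))` may be replaced by `c · osc χ` with a
  -- remainder whose amplitude vanishes at `p`.
  have hw1p : divergence (fun i u => χ u * Y i u) p + -c * χ p = 0 := by
    have : divergence (fun i u => χ u * Y i u) p = divergence Y p := by
      simp only [divergence]
      exact Finset.sum_congr rfl fun i _ => by rw [partialDeriv_mul hχ (hY i), hχp, hYp]; simp
    rw [this, hYd, hχp, hc]
    push_cast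
    ring
  have h := hT.isBigO_mul_of_eq_zero hK hψ hp hcrit hχ hχp hw1 hw1p
  have hB' := hB.trans (isBigO_of_le_of_mem (g := fun s => ‖s‖ ^ e + ‖s‖⁻¹ * ‖osc K ψ χ s‖)
    fun s hs => ⟨by positivity, le_add_of_nonneg_right (by positivity)⟩)
  have h' := h.trans (isBigO_of_le_of_mem (g := fun s => ‖s‖ ^ e + ‖s‖⁻¹ * ‖osc K ψ χ s‖)
    fun s hs => ⟨by positivity, by
      rw [add_comm]
      exact add_le_add_left (rpow_le_of_mem hs he) _⟩)
  refine (hB'.sub h').congr_left fun s => ?_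
  rw [osc_add_const_mul hK.isCompact hψ.smooth.continuous hdiv.continuous hχ.continuous,
    osc_congr hK.isCompact (w := fun u => χ u * ψ u)
      (w' := fun u => ∑ i, χ u * Y i u * ((partialDeriv i ψ u : ℝ) : ℂ))]
  · ring
  · intro u hu
    rw [hψY u hu, Finset.mul_sum]
    exact Finset.sum_congr rfl fun i _ => by ring

theorem exists_cutoff {n : ℕ} {p : Fin n → ℝ} {W : Set (Fin n → ℝ)} (hW : W ∈ 𝓝 p) :
    ∃ χ : (Fin n → ℝ) → ℂ, ContDiff ℝ ∞ χ ∧ χ p = 1 ∧ ∀ u ∉ W, χ u = 0 := by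
  obtain ⟨ε, hε, hball⟩ := Metric.mem_nhds_iff.mp hW
  let f : ContDiffBump p := ⟨ε / 2, ε, by positivity, by linarith⟩
  refine ⟨fun u => (f u : ℂ), Complex.ofRealCLM.contDiff.comp f.contDiff, ?_, fun u hu => ?_⟩
  · simp only
    rw [f.one_of_mem_closedBall (Metric.mem_closedBall_self f.rIn_pos.le), Complex.ofReal_one]
  · have : u ∉ Function.support f := by
      rw [f.support_eq]
      exact fun h => hu (hball h)
    simp only
    rw [Function.notMem_support.mp this, Complex.ofReal_zero]

/-- The Euler equation for a cutoff `χ`, combined with the bound on the real axis, controls `osc χ`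
by Grönwall along arcs; the other amplitudes are compared with `χ`. Faces may pass through `p`, but
there `p` is critical for the restricted phase and the amplitude `χ Y` vanishes, so the second half
of the induction hypothesis supplies the extra half power. -/
theorem Decays.isBigO_of_critical_of_eq_zero (hT : Decays r) (hK : IsPolytope K)
    (hψ : IsPhase K ψ) (hp : p ∈ K) (hcrit : fderiv ℝ ψ p = 0) (hp0 : ψ p = 0) :
    (∀ w : (Fin (r + 1) → ℝ) → ℂ, ContDiff ℝ ∞ w →
      osc K ψ w =O[𝓟 halfPlane] fun s => ‖s‖ ^ (-((r : ℝ) + 1) / 2)) ∧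
    (∀ w : (Fin (r + 1) → ℝ) → ℂ, ContDiff ℝ ∞ w → w p = 0 →
      osc K ψ w =O[𝓟 halfPlane] fun s => ‖s‖ ^ (-((r : ℝ) + 2) / 2)) := by
  obtain ⟨Φ, hΦf, -, hΦ⟩ := hK.exists_faces
  obtain ⟨Y, hY, hψY, hYp, hYd⟩ := hψ.exists_radial_field hK hp hcrit hp0
  -- The cutoff is supported off the finitely many faces that miss `p`, so only faces through `p`
  -- contribute.
  have hW : (⋃ q ∈ {q ∈ Φ | p ∉ faceMap q.1 q.2 '' (faceMap q.1 q.2 ⁻¹' K)},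
      faceMap q.1 q.2 '' (faceMap q.1 q.2 ⁻¹' K))ᶜ ∈ 𝓝 p := by
    refine IsOpen.mem_nhds (isOpen_compl_iff.mpr ?_) ?_
    · refine (hΦf.subset (sep_subset _ _)).isClosed_biUnion fun q _ => ?_
      exact ((hK.preimage_faceMap q.1 q.2).isCompact.image (continuous_affine _)).isClosed
    · simp only [mem_compl_iff, mem_iUnion, not_exists]
      exact fun q hq => hq.2
  obtain ⟨χ, hχ, hχp, hχW⟩ := exists_cutoff hW
  have hB := hΦ ψ hψ.smooth (fun i u => χ u * Y i u) (fun i => hχ.mul (hY i))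
    (-((r : ℝ) + 1) / 2) (by
      intro q hq
      by_cases hpq : p ∈ faceMap q.1 q.2 '' (faceMap q.1 q.2 ⁻¹' K)
      · obtain ⟨q₀, hq₀, hq₀p⟩ := hpq
        refine (hT _ _ (hK.preimage_faceMap q.1 q.2) (hψ.face q.1 q.2)).2 q₀ hq₀ ?_ _
          ((hχ.mul (hY q.1)).comp (contDiff_affine _)) ?_
        · rw [fderiv_comp_affine (hψ.smooth.differentiable (by simp)), hq₀p, hcrit]
          simp
        · rw [hq₀p, hYp, mul_zero]
      · refine IsBigO.of_bound 1 (Eventually.of_forall fun s => ?_)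
        rw [osc_congr (hK.preimage_faceMap q.1 q.2).isCompact (w' := fun _ => 0), osc_zero,
          norm_zero]
        · positivity
        · intro u hu
          rw [hχW, zero_mul]
          rw [notMem_compl_iff]
          exact mem_biUnion (show q ∈ {q ∈ Φ | _} from ⟨hq, hpq⟩) ⟨u, hu, rfl⟩)
  have hE := hT.isBigO_euler hK hψ hp hcrit hχ hχp hY hψY hYp hYd (by linarith) hB
  have hχb : osc K ψ χ =O[𝓟 halfPlane] fun s => ‖s‖ ^ (-((r : ℝ) + 1) / 2) := by
    have := isBigO_of_arc (κ := ((r : ℝ) + 1) / 2)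
      (hasDerivAt_osc hK.isCompact hψ.smooth.continuous hχ.continuous)
      (hE.trans (isBigO_of_le_of_mem fun s hs => ⟨by positivity,
        add_le_add (le_of_eq (by rw [neg_div])) (mul_le_of_le_one_left (norm_nonneg _)
          (inv_le_one_of_one_le₀ (one_le_norm hs)))⟩)) (by
        obtain ⟨C, hC⟩ := hψ.exists_bound_osc_real hK hp hcrit hχ.continuous
        refine ⟨C, fun ρ hρ => (hC ρ hρ).trans_eq ?_⟩
        push_cast
        rw [neg_div])
    simpa only [neg_div] using this
  refine ⟨fun w hw => ?_, fun w hw hwp => ?_⟩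
  · refine (hT.isBigO_of_critical hK hψ hp hcrit hχ hχp (r + 1) le_rfl w hw).trans ?_
    refine hχb.norm_left.add ?_
    push_cast
    exact isBigO_refl _ _
  · refine (hT.isBigO_mul_of_eq_zero hK hψ hp hcrit hχ hχp hw hwp).trans ?_
    refine IsBigO.add ?_ (isBigO_refl _ _)
    refine ((isBigO_refl (fun s : ℂ => ‖s‖⁻¹) _).mul hχb.norm_left).trans
      (isBigO_of_le_of_mem fun s hs => ⟨by positivity, ?_⟩)
    rw [inv_mul_rpow hs]
    exact rpow_le_of_mem hs (by linarith)

theorem IsPhase.sub_const {n : ℕ} {K : Set (Fin n → ℝ)} {ψ : (Fin n → ℝ) → ℝ} {p : Fin n → ℝ}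
    (hK : IsPolytope K) (hψ : IsPhase K ψ) (hp : p ∈ K) (hcrit : fderiv ℝ ψ p = 0) :
    IsPhase K fun u => ψ u - ψ p where
  smooth := hψ.smooth.sub contDiff_const
  nonpos u hu := by
    obtain ⟨c, hc, h⟩ := hψ.exists_le_sub hK hp hcrit
    have := h u hu
    have : 0 ≤ c * ‖u - p‖ ^ 2 := by positivity
    linarith
  concave u hu h hh := by
    have : fderiv ℝ (fun u => ψ u - ψ p) = fderiv ℝ ψ := by
      funext u
      rw [fderiv_sub_const]
    rw [this]
    exact hψ.concave u hu h hh

theorem osc_eq_cexp_mul_osc_sub {n : ℕ} (K : Set (Fin n → ℝ)) (ψ : (Fin n → ℝ) → ℝ)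
    (w : (Fin n → ℝ) → ℂ) (c : ℝ) (s : ℂ) :
    osc K ψ w s = Complex.exp (s * c) * osc K (fun u => ψ u - c) w s := by
  rw [osc, osc, ← integral_const_mul]
  congr 1
  funext u
  rw [mul_left_comm, ← Complex.exp_add]
  push_cast
  ring_nf

/-- A critical value `ψ(p)` may be normalized to `0`, since the factor `exp (s ψ(p))` has modulus at
most `1` in the half plane. Without a critical point on `K`, integration by parts alone suffices. -/
theorem Decays.succ (hT : Decays r) : Decays (r + 1) := by
  intro K ψ hK hψ
  by_cases hex : ∃ p ∈ K, fderiv ℝ ψ p = 0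
  · obtain ⟨p, hp, hcrit⟩ := hex
    have key : ∀ p ∈ K, fderiv ℝ ψ p = 0 → ∀ (w : (Fin (r + 1) → ℝ) → ℂ) (e : ℝ),
        osc K (fun u => ψ u - ψ p) w =O[𝓟 halfPlane] (fun s => ‖s‖ ^ e) →
        osc K ψ w =O[𝓟 halfPlane] fun s => ‖s‖ ^ e := by
      intro p hp _ w e h
      refine IsBigO.trans (IsBigO.of_bound 1 ?_) h
      filter_upwards [mem_principal_self halfPlane] with s hs
      rw [osc_eq_cexp_mul_osc_sub K ψ w (ψ p), norm_mul]
      refine mul_le_mul_of_nonneg_right ?_ (norm_nonneg _)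
      rw [Complex.norm_exp, Complex.re_mul_ofReal, Real.exp_le_one_iff]
      exact mul_nonpos_of_nonneg_of_nonpos (zero_le_one.trans hs) (hψ.nonpos p hp)
    have h := fun p hp (hcrit : fderiv ℝ ψ p = 0) =>
      hT.isBigO_of_critical_of_eq_zero hK (hψ.sub_const hK hp hcrit) hp
        (by rw [fderiv_sub_const]; exact hcrit) (sub_self _)
    refine ⟨fun w hw => key p hp hcrit w _ ?_, fun p hp hcrit w hw hwp =>
      key p hp hcrit w _ ?_⟩
    · push_cast
      exact (h p hp hcrit).1 w hw
    · have := (h p hp hcrit).2 w hw hwp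
      push_cast
      convert this using 4
      ring
  · push Not at hex
    refine ⟨fun w hw => ?_, fun p hp hcrit => absurd hcrit (hex p hp)⟩
    exact hT.isBigO_of_forall_ne hK hψ hex (r + 1) (by lia) w hw

end Recursion

theorem decays (r : ℕ) : Decays r := by
  induction r with
  | zero => exact decays_zero
  | succ r ih => exact ih.succ

/-- Away from the real axis the integral behaves like on the real axis if the critical point is an
interior point. -/
theorem isBigO_osc_sub_osc_norm {r : ℕ} {K : Set (Fin r → ℝ)} {ψ : (Fin r → ℝ) → ℝ}
    {p : Fin r → ℝ} (hK : IsPolytope K) (hψ : IsPhase K ψ) (hp : p ∈ interior K)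
    (hcrit : fderiv ℝ ψ p = 0) (hp0 : ψ p = 0) {w : (Fin r → ℝ) → ℂ} (hw : ContDiff ℝ ∞ w) :
    (fun s : ℂ => s ^ ((r : ℂ) / 2) * osc K ψ w s -
      (‖s‖ : ℂ) ^ ((r : ℂ) / 2) * osc K ψ w ‖s‖) =O[𝓟 halfPlane]
      fun s => ‖s‖ ^ (-(1 : ℝ) / 2) := by
  have hpK := interior_subset hp
  rcases r with _ | r
  -- In dimension zero the space is the point `p`, where `ψ` vanishes, so the integral does not
  -- depend on `s`.
  · have h1 : ∀ s : ℂ, osc K ψ w s = osc K ψ w 0 := by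
      intro s
      rw [osc, osc]
      congr 1
      funext u
      rw [Subsingleton.elim u p, hp0]
      simp
    refine IsBigO.of_bound 1 (Eventually.of_forall fun s => ?_)
    simp only [Nat.cast_zero, zero_div, Complex.cpow_zero, one_mul, h1, sub_self, norm_zero]
    positivity
  · have hT := decays r
    obtain ⟨Φ, -, hΦi, hΦ⟩ := hK.exists_faces
    obtain ⟨Y, hY, hψY, hYp, hYd⟩ := hψ.exists_radial_field hK hpK hcrit hp0
    -- A cutoff vanishing outside the interior of `K` kills every boundary term, so the Euler
    -- equation holds with the error `|s| ^ (-(r + 2) / 2)`, half a power better than for general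
    -- `K`.
    obtain ⟨χ, hχ, hχp, hχW⟩ := exists_cutoff (isOpen_interior.mem_nhds hp)
    have hB := hΦ ψ hψ.smooth (fun i u => χ u * Y i u) (fun i => hχ.mul (hY i))
      (-((r : ℝ) + 2) / 2) (by
        intro q hq
        refine IsBigO.of_bound 1 (Eventually.of_forall fun s => ?_)
        rw [osc_congr (hK.preimage_faceMap q.1 q.2).isCompact (w' := fun _ => 0), osc_zero,
          norm_zero]
        · positivity
        · intro u hu
          rw [hχW _ (hΦi q hq u), zero_mul])
    have hE := hT.isBigO_euler hK hψ hpK hcrit hχ hχp hY hψY hYp hYd le_rfl hB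
    obtain ⟨hb, hbz⟩ := hT.isBigO_of_critical_of_eq_zero hK hψ hpK hcrit hp0
    have hE' : (fun s => s * osc K ψ (fun u => χ u * ψ u) s +
        ((((r : ℝ) + 1) / 2 : ℝ) : ℂ) * osc K ψ χ s) =O[𝓟 halfPlane]
        fun s => ‖s‖ ^ (-((r : ℝ) + 2) / 2) := by
      refine hE.trans ((isBigO_refl _ _).add ?_)
      refine ((isBigO_refl (fun s : ℂ => ‖s‖⁻¹) _).mul (hb χ hχ).norm_left).trans
        (isBigO_of_le_of_mem fun s hs => ⟨by positivity, ?_⟩)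
      rw [inv_mul_rpow hs]
      exact rpow_le_of_mem hs (by linarith)
    have hχs := isBigO_sub_of_arc
      (hasDerivAt_osc hK.isCompact hψ.smooth.continuous hχ.continuous) hE'
    have hw1 : ContDiff ℝ ∞ fun u => w u + -w p * χ u := hw.add (contDiff_const.mul hχ)
    have hrest := hbz _ hw1 (by simp [hχp])
    have hcast : (((((r : ℝ) + 1) / 2 : ℝ) : ℂ)) = ((r + 1 : ℕ) : ℂ) / 2 := by push_cast; ring
    rw [hcast] at hχs
    obtain ⟨A, hA⟩ := hrest.bound
    rw [eventually_principal] at hA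
    -- The remainder `w - w(p) χ` vanishes at `p`, so it is small at `s` and at `|s|` separately and
    -- needs no transport.
    have hn : ∀ s ∈ halfPlane, ∀ z : ℂ, ‖z‖ = ‖s‖ → z ∈ halfPlane →
        ‖z ^ (((r + 1 : ℕ) : ℂ) / 2) * osc K ψ (fun u => w u + -w p * χ u) z‖ ≤
          A * ‖s‖ ^ (-(1 : ℝ) / 2) := by
      intro s hs z hz hzp
      have hz0 : 0 < ‖z‖ := one_pos.trans_le (one_le_norm hzp)
      have h1 : ‖z ^ (((r + 1 : ℕ) : ℂ) / 2)‖ = ‖z‖ ^ (((r : ℝ) + 1) / 2) := by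
        rw [← hcast, Complex.norm_cpow_of_ne_zero (norm_pos_iff.mp hz0)]
        simp
      have h2 := hA z hzp
      rw [Real.norm_of_nonneg (by positivity)] at h2
      rw [norm_mul, h1]
      calc _ ≤ ‖z‖ ^ (((r : ℝ) + 1) / 2) * (A * ‖z‖ ^ (-((r : ℝ) + 2) / 2)) :=
            mul_le_mul_of_nonneg_left h2 (by positivity)
        _ = A * ‖s‖ ^ (-(1 : ℝ) / 2) := by
            rw [mul_left_comm, ← Real.rpow_add hz0, hz]
            congr 2
            ring
    have hdiff : (fun s : ℂ => s ^ (((r + 1 : ℕ) : ℂ) / 2) *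
        osc K ψ (fun u => w u + -w p * χ u) s - (‖s‖ : ℂ) ^ (((r + 1 : ℕ) : ℂ) / 2) *
        osc K ψ (fun u => w u + -w p * χ u) ‖s‖) =O[𝓟 halfPlane] fun s => ‖s‖ ^ (-(1 : ℝ) / 2) := by
      refine IsBigO.of_bound (A + A) ?_
      filter_upwards [mem_principal_self halfPlane] with s hs
      rw [Real.norm_of_nonneg (by positivity), add_mul]
      refine (norm_sub_le _ _).trans (add_le_add (hn s hs s rfl hs) (hn s hs ‖s‖ (by simp) ?_))
      change 1 ≤ ((‖s‖ : ℂ)).re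
      rw [Complex.ofReal_re]
      exact one_le_norm hs
    refine ((hχs.const_mul_left (w p)).trans (isBigO_of_le_of_mem fun s hs => ⟨by positivity,
      rpow_le_of_mem hs (by linarith)⟩) |>.add hdiff).congr_left fun s => ?_
    simp only [osc_add_const_mul hK.isCompact hψ.smooth.continuous hw.continuous hχ.continuous]
    ring

end OscillatoryIntegral

/-! ### Gaussian integrals and Laplace's method. -/

namespace OscillatoryIntegral

open Set Asymptotics
open scoped ContDiff

section Gaussian

open Matrix

variable {r : ℕ}

theorem integral_exp_neg_sum_sq :
    ∫ v : Fin r → ℝ, Real.exp (-∑ i, v i ^ 2) = √Real.pi ^ r := by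
  have h := integral_fintype_prod_volume_eq_pow (ι := Fin r) (fun x : ℝ => Real.exp (-1 * x ^ 2))
  rw [integral_gaussian, div_one, Fintype.card_fin] at h
  rw [← h]
  simp [← Real.exp_sum, Finset.sum_neg_distrib]

theorem integral_exp_neg_sum_mulVec_sq (B : Matrix (Fin r) (Fin r) ℝ) (hB : 0 < B.det) :
    ∫ v : Fin r → ℝ, Real.exp (-∑ i, (B *ᵥ v) i ^ 2) = √Real.pi ^ r / B.det := by
  have hmap := Real.map_matrix_volume_pi_eq_smul_volume_pi hB.ne'
  have hcont : Continuous (Matrix.toLin' B) := LinearMap.continuous_of_finiteDimensional _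
  have h := integral_map (μ := volume) hcont.aemeasurable
    (f := fun v : Fin r → ℝ => Real.exp (-∑ i, v i ^ 2))
    (by exact Continuous.aestronglyMeasurable (by fun_prop))
  simp only [Matrix.toLin'_apply] at h
  rw [← h, hmap, integral_smul_measure, integral_exp_neg_sum_sq,
    ENNReal.toReal_ofReal (abs_nonneg _), abs_of_pos (inv_pos.mpr hB), smul_eq_mul]
  field_simp

/-- The Gaussian integral of a rank one perturbation of a diagonal quadratic form. -/
theorem integral_exp_neg_diag_add_sq {a : Fin r → ℝ} (ha : ∀ i, 0 < a i) (c : Fin r → ℝ) {b : ℝ}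
    (hb : 0 ≤ b) :
    ∫ v : Fin r → ℝ, Real.exp (-(∑ i, a i * v i ^ 2 + b * (∑ i, c i * v i) ^ 2)) =
      √Real.pi ^ r / √((∏ i, a i) * (1 + b * ∑ i, c i ^ 2 / a i)) := by
  set E := ∑ i, c i ^ 2 / a i with hE
  have hE0 : 0 ≤ E := Finset.sum_nonneg fun i _ => div_nonneg (sq_nonneg _) (ha i).le
  set q := √(1 + b * E) with hq
  have hq2 : q ^ 2 = 1 + b * E := Real.sq_sqrt (by positivity)
  have hq0 : 0 ≤ q := Real.sqrt_nonneg _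
  have hq1 : 0 < q := by
    rw [hq]
    positivity
  -- Chosen so that `(1 + κ e eᵀ)² = 1 + b e eᵀ`, that is, `2 κ + κ² E = b`. The form `b / (q + 1)`
  -- of the root `(q - 1) / E` avoids dividing by `E`, which may vanish.
  set κ := b / (q + 1) with hκ
  have hκE : 1 + κ * E = q := by
    rw [hκ]
    field_simp
    nlinarith
  have hκb : 2 * κ + κ ^ 2 * E = b := by
    have h1 : κ * (q + 1) = b := by
      rw [hκ]
      field_simp
    calc 2 * κ + κ ^ 2 * E = κ * ((1 + κ * E) + 1) := by ring
      _ = b := by rw [hκE, h1]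
  set d : Fin r → ℝ := fun i => √(a i) with hd
  have hd0 : ∀ i, 0 < d i := fun i => Real.sqrt_pos.mpr (ha i)
  have hd2 : ∀ i, d i ^ 2 = a i := fun i => Real.sq_sqrt (ha i).le
  set e : Fin r → ℝ := fun i => c i / d i with he
  have hee : ∑ i, e i ^ 2 = E := Finset.sum_congr rfl fun i _ => by
    rw [he, div_pow, hd2]
  have hed : ∀ i, e i * d i = c i := fun i => div_mul_cancel₀ _ (hd0 i).ne'
  -- With this `B` the quadratic form is `|B v|²`, and the matrix determinant lemma gives `det B`.
  set B : Matrix (Fin r) (Fin r) ℝ :=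
    (1 + replicateCol Unit (κ • e) * replicateRow Unit e) * diagonal d with hBdef
  have hdet : B.det = √((∏ i, a i) * (1 + b * E)) := by
    rw [hBdef, det_mul, det_one_add_replicateCol_mul_replicateRow, det_diagonal, dotProduct_smul,
      Real.sqrt_mul (Finset.prod_nonneg fun i _ => (ha i).le), Real.sqrt_prod _ fun i _ => (ha i).le,
      mul_comm]
    congr 1
    rw [← hq, ← hκE, ← hee, dotProduct, smul_eq_mul]
    simp [sq]
  have hpos : 0 < B.det := by
    rw [hdet]
    have : 0 < ∏ i, a i := Finset.prod_pos fun i _ => ha i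
    positivity
  have hBv : ∀ v : Fin r → ℝ, ∀ i, (B *ᵥ v) i = d i * v i + κ * e i * ∑ j, c j * v j := by
    intro v i
    have h1 : diagonal d *ᵥ v = fun j => d j * v j := by
      ext j
      rw [mulVec_diagonal]
    rw [hBdef, ← mulVec_mulVec, h1, add_mulVec, one_mulVec, Pi.add_apply, ← mulVec_mulVec]
    congr 1
    simp only [mulVec, dotProduct, replicateCol_apply, replicateRow_apply, Finset.univ_unique,
      Finset.sum_const, Finset.card_singleton, one_smul, Pi.smul_apply, smul_eq_mul]
    congr 1
    exact Finset.sum_congr rfl fun j _ => by rw [← mul_assoc, hed]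
  rw [← hdet, ← integral_exp_neg_sum_mulVec_sq B hpos]
  congr 1 with v
  congr 2
  simp only [hBv]
  set L := ∑ j, c j * v j with hL
  calc ∑ i, a i * v i ^ 2 + b * L ^ 2
      = ∑ i, a i * v i ^ 2 + (2 * κ * L * L + κ ^ 2 * L ^ 2 * E) := by rw [← hκb]; ring
    _ = ∑ i, (a i * v i ^ 2 + (2 * κ * L * (c i * v i) + κ ^ 2 * L ^ 2 * e i ^ 2)) := by
        rw [Finset.sum_add_distrib, Finset.sum_add_distrib, ← Finset.mul_sum, ← Finset.mul_sum, hee]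
    _ = ∑ i, (d i * v i + κ * e i * L) ^ 2 := Finset.sum_congr rfl fun i _ => by
        rw [← hd2, ← hed]
        ring

end Gaussian

section Laplace

variable {r : ℕ} {K : Set (Fin r → ℝ)} {ψ : (Fin r → ℝ) → ℝ} {p : Fin r → ℝ}

theorem tendsto_mul_sub_of_fderiv_eq_zero (hψ : ContDiff ℝ ∞ ψ) (hcrit : fderiv ℝ ψ p = 0)
    (v : Fin r → ℝ) :
    Tendsto (fun ρ : ℝ => ρ * (ψ (p + (√ρ)⁻¹ • v) - ψ p)) atTop
      (𝓝 (fderiv ℝ (fderiv ℝ ψ) p v v / 2)) := by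
  have hs : ContDiff ℝ ∞ (fderiv ℝ ψ) := hψ.fderiv_right (by simp)
  have h := convex_univ.taylor_approx_two_segment (f := ψ) (f' := fderiv ℝ ψ)
    (f'' := fderiv ℝ (fderiv ℝ ψ) p) (x := p) (v := 0) (w := v)
    (fun x _ => (hψ.differentiable (by simp) x).hasFDerivAt) (mem_univ p)
    ((hs.differentiable (by simp) p).hasFDerivAt.hasFDerivWithinAt) (by simp) (by simp)
  have h0 : Tendsto (fun ρ : ℝ => (√ρ)⁻¹) atTop (𝓝[>] 0) :=
    tendsto_inv_atTop_nhdsGT_zero.comp Real.tendsto_sqrt_atTop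
  have h1 := (h.comp_tendsto h0).tendsto_div_nhds_zero
  have h2 := h1.add_const (fderiv ℝ (fderiv ℝ ψ) p v v / 2)
  rw [zero_add] at h2
  refine h2.congr' ?_
  filter_upwards [eventually_gt_atTop 0] with ρ hρ
  have hsq : (√ρ)⁻¹ ^ 2 = ρ⁻¹ := by rw [inv_pow, Real.sq_sqrt hρ.le]
  simp only [Function.comp_apply, smul_zero, add_zero, hcrit, map_zero, hsq,
    _root_.zero_apply, smul_eq_mul]
  field_simp
  ring

/-- Laplace's method for a nondegenerate interior maximum. -/
theorem tendsto_rpow_mul_osc (hK : IsPolytope K) (hψ : IsPhase K ψ) (hp : p ∈ interior K)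
    (hcrit : fderiv ℝ ψ p = 0) (hp0 : ψ p = 0) {w : (Fin r → ℝ) → ℂ} (hw : Continuous w) :
    Tendsto (fun ρ : ℝ => (ρ : ℂ) ^ ((r : ℂ) / 2) * osc K ψ w ρ) atTop
      (𝓝 (w p * (∫ v, Real.exp (fderiv ℝ (fderiv ℝ ψ) p v v / 2) : ℝ))) := by
  have hpK := interior_subset hp
  obtain ⟨c, hc, hle⟩ := hψ.exists_le_sub hK hpK hcrit
  obtain ⟨B, hB⟩ := hK.isCompact.exists_bound_of_continuousOn hw.continuousOn
  have hB0 : 0 ≤ B := (norm_nonneg _).trans (hB p hpK)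
  set g : ℝ → (Fin r → ℝ) → ℂ := fun ρ =>
    K.indicator fun u => w u * Complex.exp ((ρ : ℂ) * ψ u) with hg
  have hmeas : ∀ ρ, Measurable (g ρ) := fun ρ =>
    (Continuous.measurable (by have := hψ.smooth.continuous; fun_prop)).indicator
      hK.isCompact.measurableSet
  -- Substitution `u = p + v / √ρ`; its Jacobian is the power of `ρ` in the statement.
  have hscale : ∀ ρ : ℝ, 0 < ρ → ∫ v, g ρ (p + (√ρ)⁻¹ • v) =
      (ρ : ℂ) ^ ((r : ℂ) / 2) * osc K ψ w ρ := by
    intro ρ hρ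
    rw [Measure.integral_comp_smul volume (fun v => g ρ (p + v)),
      integral_add_left_eq_self (g ρ) p, hg, integral_indicator hK.isCompact.measurableSet,
      Module.finrank_fintype_fun_eq_card, Fintype.card_fin, inv_pow, inv_inv,
      abs_of_nonneg (by positivity), Real.sqrt_eq_rpow, ← Real.rpow_natCast,
      ← Real.rpow_mul hρ.le, osc, Complex.real_smul, Complex.ofReal_cpow hρ.le]
    congr 2
    push_cast
    ring
  have hlim : Tendsto (fun ρ : ℝ => ∫ v, g ρ (p + (√ρ)⁻¹ • v)) atTop
      (𝓝 (∫ v, w p * Complex.exp ((fderiv ℝ (fderiv ℝ ψ) p v v / 2 : ℝ) : ℂ))) := by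
    refine tendsto_integral_filter_of_dominated_convergence
      (fun v => B * Real.exp (-c * ‖v‖ ^ 2)) ?_ ?_
      ((integrable_exp_neg_mul_sq_norm hc).const_mul B) ?_
    · exact Eventually.of_forall fun ρ =>
        ((hmeas ρ).comp (by fun_prop : Measurable fun v : Fin r → ℝ =>
          p + (√ρ)⁻¹ • v)).aestronglyMeasurable
    · filter_upwards [eventually_gt_atTop 0] with ρ hρ
      refine Eventually.of_forall fun v => ?_
      by_cases hv : p + (√ρ)⁻¹ • v ∈ K
      · rw [hg]
        simp only [indicator_of_mem hv]
        rw [norm_mul]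
        refine mul_le_mul (hB _ hv) ?_ (norm_nonneg _) hB0
        rw [Complex.norm_exp, ← Complex.ofReal_mul, Complex.ofReal_re, Real.exp_le_exp]
        have h := hle _ hv
        rw [hp0, add_sub_cancel_left, norm_smul, mul_pow, norm_inv,
          Real.norm_of_nonneg (Real.sqrt_nonneg _), inv_pow, Real.sq_sqrt hρ.le] at h
        calc ρ * ψ (p + (√ρ)⁻¹ • v) ≤ ρ * (0 - c * (ρ⁻¹ * ‖v‖ ^ 2)) :=
              mul_le_mul_of_nonneg_left h hρ.le
          _ = -c * ‖v‖ ^ 2 := by field_simp; ring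
      · rw [hg]
        simp only [indicator_of_notMem hv, norm_zero]
        positivity
    · refine Eventually.of_forall fun v => ?_
      have h0 : Tendsto (fun ρ : ℝ => p + (√ρ)⁻¹ • v) atTop (𝓝 p) := by
        have : Tendsto (fun ρ : ℝ => (√ρ)⁻¹) atTop (𝓝 0) :=
          tendsto_inv_atTop_zero.comp Real.tendsto_sqrt_atTop
        simpa using (this.smul_const v).const_add p
      have h1 := tendsto_mul_sub_of_fderiv_eq_zero hψ.smooth hcrit v
      rw [hp0] at h1
      have h2 := ((hw.tendsto p).comp h0).mul
        ((Complex.continuous_exp.comp Complex.continuous_ofReal).tendsto _ |>.comp h1)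
      refine h2.congr' ?_
      -- Interiority of `p` enters here: for fixed `v` the rescaled point eventually lies in `K`, so
      -- the limit is a Gaussian on the whole space.
      filter_upwards [h0.eventually (mem_interior_iff_mem_nhds.mp hp)] with ρ hρ
      rw [hg]
      simp only [Function.comp_apply, sub_zero]
      rw [indicator_of_mem hρ]
      push_cast
      rfl
  have heq : ∫ v, w p * Complex.exp ((fderiv ℝ (fderiv ℝ ψ) p v v / 2 : ℝ) : ℂ) =
      w p * (∫ v, Real.exp (fderiv ℝ (fderiv ℝ ψ) p v v / 2) : ℝ) := by
    rw [integral_const_mul, ← integral_complex_ofReal]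
    simp only [Complex.ofReal_exp]
  rw [← heq]
  refine hlim.congr' ?_
  filter_upwards [eventually_gt_atTop 0] with ρ hρ using hscale ρ hρ

/-- The asymptotics in the half plane of an oscillatory integral with an interior critical point. -/
theorem tendsto_cpow_mul_osc (hK : IsPolytope K) (hψ : IsPhase K ψ) (hp : p ∈ interior K)
    (hcrit : fderiv ℝ ψ p = 0) (hp0 : ψ p = 0) {w : (Fin r → ℝ) → ℂ} (hw : ContDiff ℝ ∞ w) :
    Tendsto (fun s : ℂ => s ^ ((r : ℂ) / 2) * osc K ψ w s) (comap Complex.re atTop)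
      (𝓝 (w p * (∫ v, Real.exp (fderiv ℝ (fderiv ℝ ψ) p v v / 2) : ℝ))) := by
  have hn : Tendsto (fun s : ℂ => ‖s‖) (comap Complex.re atTop) atTop :=
    tendsto_atTop_mono Complex.re_le_norm tendsto_comap
  have hle : comap Complex.re atTop ≤ 𝓟 halfPlane := by
    rw [le_principal_iff]
    exact preimage_mem_comap (Ici_mem_atTop 1)
  have h1 := (tendsto_rpow_mul_osc hK hψ hp hcrit hp0 hw.continuous).comp hn
  have h2 := ((isBigO_osc_sub_osc_norm hK hψ hp hcrit hp0 hw).mono hle).trans_tendsto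
    ((tendsto_rpow_neg_atTop (by norm_num : (0 : ℝ) < 1 / 2)).comp hn |>.congr fun s => by
      simp [neg_div])
  have h3 := h2.add h1
  rw [zero_add] at h3
  exact h3.congr fun s => by simp

end Laplace

end OscillatoryIntegral

/-! ### The chart of logarithmic space by a simplex. -/

namespace OscillatoryIntegral

open Set Asymptotics
open scoped ContDiff

section SimplexChart

variable {r : ℕ} (m : Fin r → ℝ) (m₀ : ℝ)

/-- The total weight. -/
noncomputable def weight : ℝ := m₀ + ∑ i, m i

/-- The remaining coordinate of a point of the simplex `∑ mᵢ uᵢ + m₀ u₀ = 1`. -/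
noncomputable def lastCoord (u : Fin r → ℝ) : ℝ := (1 - ∑ i, m i * u i) / m₀

/-- The weighted mean of the logarithms of the simplex coordinates. -/
noncomputable def logMean (u : Fin r → ℝ) : ℝ :=
  (∑ i, m i * Real.log (u i) + m₀ * Real.log (lastCoord m m₀ u)) / weight m m₀

/-- The chart of logarithmic space by the open simplex. -/
noncomputable def simplexChart (u : Fin r → ℝ) (i : Fin r) : ℝ :=
  -(m i / 2) * (Real.log (u i) - logMean m m₀ u)

/-- The squared length of a vector of logarithmic space. -/
noncomputable def height (x : Fin r → ℝ) : ℝ :=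
  ∑ i, m i * Real.exp (-(2 / m i) * x i) + m₀ * Real.exp (2 / m₀ * ∑ i, x i)

/-- The normalized squared lengths of the components of a vector of logarithmic space. -/
noncomputable def simplexCoord (x : Fin r → ℝ) (i : Fin r) : ℝ :=
  Real.exp (-(2 / m i) * x i) / height m m₀ x

/-- The points whose simplex coordinates are all at least `ε`. -/
def simplexCore (ε : ℝ) : Set (Fin r → ℝ) := {u | (∀ i, ε ≤ u i) ∧ ε ≤ lastCoord m m₀ u}

theorem continuous_lastCoord : Continuous (lastCoord m m₀) := by
  unfold lastCoord
  fun_prop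

variable {m m₀} (hm : ∀ i, 0 < m i) (hm₀ : 0 < m₀)

include hm hm₀ in
theorem weight_pos : 0 < weight m m₀ :=
  add_pos_of_pos_of_nonneg hm₀ (Finset.sum_nonneg fun i _ => (hm i).le)

include hm hm₀ in
theorem height_pos (x : Fin r → ℝ) : 0 < height m m₀ x :=
  add_pos_of_nonneg_of_pos (Finset.sum_nonneg fun i _ => by have := hm i; positivity)
    (by positivity)

include hm₀ in
theorem sum_add_lastCoord (u : Fin r → ℝ) : ∑ i, m i * u i + m₀ * lastCoord m m₀ u = 1 := by
  rw [lastCoord]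
  field_simp
  ring

include hm hm₀ in
theorem weight_mul_logMean (u : Fin r → ℝ) : weight m m₀ * logMean m m₀ u =
    ∑ i, m i * Real.log (u i) + m₀ * Real.log (lastCoord m m₀ u) := by
  rw [logMean, mul_div_cancel₀ _ (weight_pos hm hm₀).ne']

include hm hm₀ in
theorem sum_simplexChart (u : Fin r → ℝ) :
    ∑ i, simplexChart m m₀ u i = m₀ / 2 * (Real.log (lastCoord m m₀ u) - logMean m m₀ u) := by
  have h := weight_mul_logMean hm hm₀ u
  have h1 : ∑ i, simplexChart m m₀ u i =
      -(∑ i, m i * Real.log (u i)) / 2 + (∑ i, m i) * logMean m m₀ u / 2 := by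
    rw [neg_div, Finset.sum_div, Finset.sum_mul, Finset.sum_div, ← Finset.sum_neg_distrib,
      ← Finset.sum_add_distrib]
    exact Finset.sum_congr rfl fun i _ => by rw [simplexChart]; ring
  rw [h1]
  rw [weight] at h
  linarith

include hm in
theorem exp_simplexChart {u : Fin r → ℝ} {i : Fin r} (hu : 0 < u i) :
    Real.exp (-(2 / m i) * simplexChart m m₀ u i) = u i * Real.exp (-logMean m m₀ u) := by
  have := (hm i).ne'
  rw [simplexChart, show -(2 / m i) * (-(m i / 2) * (Real.log (u i) - logMean m m₀ u)) =
    Real.log (u i) + -logMean m m₀ u by field_simp; ring, Real.exp_add, Real.exp_log hu]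

include hm hm₀ in
-- The relation `∑ m_i u_i + m₀ u₀ = 1` collapses the sum, so powers of `height` become exponentials
-- of `s · logMean`.
theorem height_simplexChart {u : Fin r → ℝ} (hu : ∀ i, 0 < u i) (hu₀ : 0 < lastCoord m m₀ u) :
    height m m₀ (simplexChart m m₀ u) = Real.exp (-logMean m m₀ u) := by
  rw [height, sum_simplexChart hm hm₀, ← mul_assoc, show 2 / m₀ * (m₀ / 2) = 1 by field_simp,
    one_mul, sub_eq_add_neg, Real.exp_add, Real.exp_log hu₀]
  rw [Finset.sum_congr rfl fun i _ => by rw [exp_simplexChart hm (hu i), ← mul_assoc],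
    ← Finset.sum_mul, ← mul_assoc, ← add_mul, sum_add_lastCoord hm₀, one_mul]

include hm hm₀ in
theorem simplexCoord_simplexChart {u : Fin r → ℝ} (hu : ∀ i, 0 < u i)
    (hu₀ : 0 < lastCoord m m₀ u) : simplexCoord m m₀ (simplexChart m m₀ u) = u := by
  funext i
  rw [simplexCoord, height_simplexChart hm hm₀ hu hu₀, exp_simplexChart hm (hu i),
    mul_div_cancel_right₀ _ (Real.exp_pos _).ne']

include hm hm₀ in
theorem lastCoord_simplexCoord (x : Fin r → ℝ) : lastCoord m m₀ (simplexCoord m m₀ x) =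
    Real.exp (2 / m₀ * ∑ i, x i) / height m m₀ x := by
  have hh := (height_pos hm hm₀ x).ne'
  have h1 : ∑ i, m i * simplexCoord m m₀ x i =
      (∑ i, m i * Real.exp (-(2 / m i) * x i)) / height m m₀ x := by
    rw [Finset.sum_div]
    exact Finset.sum_congr rfl fun i _ => by rw [simplexCoord, mul_div_assoc]
  rw [lastCoord, h1, div_eq_div_iff hm₀.ne' hh, sub_mul, div_mul_cancel₀ _ hh]
  rw [height]
  ring

include hm hm₀ in
-- The weighted mean of the logarithms of the coordinates is `-log height`, because the exponents of
-- the terms of `height` have weighted sum zero. The chart thus covers all of logarithmic space.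
theorem simplexChart_simplexCoord (x : Fin r → ℝ) :
    simplexChart m m₀ (simplexCoord m m₀ x) = x := by
  have hh := height_pos hm hm₀ x
  have hw := (weight_pos hm hm₀).ne'
  have h1 : ∀ i, Real.log (simplexCoord m m₀ x i) =
      -(2 / m i) * x i - Real.log (height m m₀ x) := fun i => by
    rw [simplexCoord, Real.log_div (Real.exp_pos _).ne' hh.ne', Real.log_exp]
  have h2 : logMean m m₀ (simplexCoord m m₀ x) = -Real.log (height m m₀ x) := by
    refine mul_left_cancel₀ hw ?_
    rw [weight_mul_logMean hm hm₀, lastCoord_simplexCoord hm hm₀,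
      Real.log_div (Real.exp_pos _).ne' hh.ne', Real.log_exp]
    have h3 : ∑ i, m i * Real.log (simplexCoord m m₀ x i) =
        -2 * ∑ i, x i - (∑ i, m i) * Real.log (height m m₀ x) := by
      rw [Finset.mul_sum, Finset.sum_mul, ← Finset.sum_sub_distrib]
      refine Finset.sum_congr rfl fun i _ => ?_
      have := (hm i).ne'
      rw [h1]
      field_simp
    rw [h3, weight]
    field_simp
    ring
  funext i
  have := (hm i).ne'
  rw [simplexChart, h1, h2]
  field_simp
  ring

/-- The gradient of `logMean`. -/
noncomputable def logMeanGrad (m : Fin r → ℝ) (m₀ : ℝ) (u : Fin r → ℝ) (j : Fin r) : ℝ :=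
  m j / weight m m₀ * ((u j)⁻¹ - (lastCoord m m₀ u)⁻¹)

theorem hasFDerivAt_lastCoord (u : Fin r → ℝ) :
    HasFDerivAt (lastCoord m m₀)
      (∑ j, (-(m j / m₀)) • (ContinuousLinearMap.proj j : (Fin r → ℝ) →L[ℝ] ℝ)) u := by
  have h1 : HasFDerivAt (fun u : Fin r → ℝ => ∑ j, m j * u j)
      (∑ j, m j • (ContinuousLinearMap.proj j : (Fin r → ℝ) →L[ℝ] ℝ)) u :=
    HasFDerivAt.fun_sum fun j _ => (hasFDerivAt_apply j u).const_mul (m j)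
  have h2 : HasFDerivAt (fun u : Fin r → ℝ => (1 - ∑ j, m j * u j) * m₀⁻¹) _ u :=
    (h1.const_sub 1).mul_const m₀⁻¹
  refine (h2.congr_fderiv ?_)
  ext v
  simp [_root_.sum_apply, Finset.mul_sum]
  exact Finset.sum_congr rfl fun i _ => by ring

include hm₀ in
theorem hasFDerivAt_logMean {u : Fin r → ℝ} (hu : ∀ i, 0 < u i) (hu₀ : 0 < lastCoord m m₀ u) :
    HasFDerivAt (logMean m m₀)
      (∑ j, logMeanGrad m m₀ u j • (ContinuousLinearMap.proj j : (Fin r → ℝ) →L[ℝ] ℝ)) u := by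
  have h1 : HasFDerivAt (fun u : Fin r → ℝ => ∑ j, m j * Real.log (u j))
      (∑ j, m j • ((u j)⁻¹ • (ContinuousLinearMap.proj j : (Fin r → ℝ) →L[ℝ] ℝ))) u :=
    HasFDerivAt.fun_sum fun j _ => ((hasFDerivAt_apply j u).log (hu j).ne').const_mul (m j)
  have h2 : HasFDerivAt (fun u => (∑ j, m j * Real.log (u j) +
      m₀ * Real.log (lastCoord m m₀ u)) * (weight m m₀)⁻¹) _ u :=
    (h1.add (((hasFDerivAt_lastCoord u).log hu₀.ne').const_mul m₀)).mul_const (weight m m₀)⁻¹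
  refine (h2.congr_fderiv ?_)
  ext v
  simp only [_root_.sum_apply, _root_.smul_apply, _root_.add_apply, ContinuousLinearMap.proj_apply,
    smul_eq_mul, Finset.mul_sum, ← Finset.sum_add_distrib, logMeanGrad]
  refine Finset.sum_congr rfl fun i _ => ?_
  field_simp
  ring

/-- The matrix of the derivative of the simplex chart. -/
noncomputable def simplexChartMatrix (m : Fin r → ℝ) (m₀ : ℝ) (u : Fin r → ℝ) :
    Matrix (Fin r) (Fin r) ℝ :=
  Matrix.diagonal (fun i => -(m i / (2 * u i))) *
    (1 + Matrix.replicateCol Unit u * Matrix.replicateRow Unit (-logMeanGrad m m₀ u))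

theorem simplexChartMatrix_apply {u : Fin r → ℝ} (hu : ∀ i, 0 < u i) (i j : Fin r) :
    simplexChartMatrix m m₀ u i j =
      -(m i / 2) * ((u i)⁻¹ * (if i = j then 1 else 0) - logMeanGrad m m₀ u j) := by
  have := (hu i).ne'
  rw [simplexChartMatrix, Matrix.diagonal_mul, Matrix.add_apply, Matrix.one_apply, Matrix.mul_apply]
  simp only [Finset.univ_unique, Finset.sum_const, Finset.card_singleton, one_smul,
    Matrix.replicateCol_apply, Matrix.replicateRow_apply, Pi.neg_apply]
  field_simp
  ring

include hm₀ in
theorem hasFDerivAt_simplexChart {u : Fin r → ℝ} (hu : ∀ i, 0 < u i)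
    (hu₀ : 0 < lastCoord m m₀ u) :
    HasFDerivAt (simplexChart m m₀)
      (LinearMap.toContinuousLinearMap (Matrix.toLin' (simplexChartMatrix m m₀ u))) u := by
  rw [hasFDerivAt_pi']
  intro i
  have h : HasFDerivAt (fun u => -(m i / 2) * (Real.log (u i) - logMean m m₀ u)) _ u :=
    (((hasFDerivAt_apply i u).log (hu i).ne').sub (hasFDerivAt_logMean hm₀ hu hu₀)).const_mul
      (-(m i / 2))
  refine h.congr_fderiv ?_
  ext v
  simp only [_root_.smul_apply, _root_.sub_apply, _root_.sum_apply, ContinuousLinearMap.proj_apply,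
    smul_eq_mul, ContinuousLinearMap.comp_apply, LinearMap.coe_toContinuousLinearMap',
    Matrix.toLin'_apply, Matrix.mulVec, dotProduct, simplexChartMatrix_apply hu]
  simp only [mul_assoc, ← Finset.mul_sum, sub_mul, Finset.sum_sub_distrib, ite_mul, one_mul,
    zero_mul, Finset.sum_ite_eq, Finset.mem_univ, if_true, mul_ite, mul_zero]

include hm hm₀ in
-- A diagonal matrix times a rank one perturbation of the identity: the matrix determinant lemma
-- contributes the factor `1 - ∇ logMean · u = 1 / (weight · u₀)`.
theorem det_simplexChartMatrix {u : Fin r → ℝ} (hu : ∀ i, 0 < u i)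
    (hu₀ : 0 < lastCoord m m₀ u) : |(simplexChartMatrix m m₀ u).det| =
      (∏ i, m i / 2 * (u i)⁻¹) * (lastCoord m m₀ u)⁻¹ / weight m m₀ := by
  have hw := weight_pos hm hm₀
  have h1 : -logMeanGrad m m₀ u ⬝ᵥ u = -1 + (lastCoord m m₀ u)⁻¹ / weight m m₀ := by
    rw [neg_dotProduct, dotProduct]
    have h2 : ∑ i, logMeanGrad m m₀ u i * u i =
        (∑ i, m i) / weight m m₀ -
          (lastCoord m m₀ u)⁻¹ * (∑ i, m i * u i) / weight m m₀ := by
      rw [Finset.mul_sum, Finset.sum_div, Finset.sum_div, ← Finset.sum_sub_distrib]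
      refine Finset.sum_congr rfl fun i _ => ?_
      have := (hu i).ne'
      rw [logMeanGrad]
      field_simp
    rw [h2]
    have h3 := sum_add_lastCoord (m := m) hm₀ u
    have h4 : ∑ i, m i = weight m m₀ - m₀ := by rw [weight]; ring
    rw [h4, eq_sub_of_add_eq h3]
    field_simp
    ring
  rw [simplexChartMatrix, Matrix.det_mul, Matrix.det_diagonal,
    Matrix.det_one_add_replicateCol_mul_replicateRow, h1, add_neg_cancel_left, abs_mul,
    Finset.abs_prod, abs_of_pos (by positivity), mul_div_assoc]
  congr 1
  refine Finset.prod_congr rfl fun i _ => ?_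
  have := hm i
  have := hu i
  rw [abs_neg, abs_of_pos (by positivity)]
  field_simp

/-- A smooth function on the line that agrees with the logarithm on `[ε / 2, ∞)`. -/
noncomputable def smoothLog (ε t : ℝ) : ℝ :=
  Real.smoothTransition ((t - ε / 4) / (ε / 4)) * Real.log t

theorem contDiff_smoothLog {ε : ℝ} (hε : 0 < ε) : ContDiff ℝ ∞ (smoothLog ε) := by
  rw [contDiff_iff_contDiffAt]
  intro t
  rcases lt_or_ge t (ε / 4) with ht | ht
  · refine (contDiffAt_const (c := (0 : ℝ))).congr_of_eventuallyEq ?_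
    filter_upwards [Iio_mem_nhds ht] with y hy
    rw [smoothLog, Real.smoothTransition.zero_of_nonpos, zero_mul]
    exact div_nonpos_of_nonpos_of_nonneg (sub_nonpos.mpr (le_of_lt hy)) (by positivity)
  · have h0 : t ≠ 0 := by
      have := div_pos hε four_pos
      exact (this.trans_le ht).ne'
    exact (Real.smoothTransition.contDiffAt.comp t (by fun_prop)).mul
      (Real.contDiffAt_log.mpr h0)

theorem smoothLog_eq {ε t : ℝ} (hε : 0 < ε) (ht : ε / 2 ≤ t) : smoothLog ε t = Real.log t := by
  rw [smoothLog, Real.smoothTransition.one_of_one_le, one_mul]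
  rw [le_div_iff₀ (by positivity)]
  linarith

/-- The phase function of the simplex chart, made globally smooth. -/
noncomputable def simplexPhase (m : Fin r → ℝ) (m₀ ε : ℝ) (u : Fin r → ℝ) : ℝ :=
  (∑ i, m i * smoothLog ε (u i) + m₀ * smoothLog ε (lastCoord m m₀ u)) / weight m m₀ +
    Real.log (weight m m₀)

/-- The Jacobian of the simplex chart, made globally smooth. -/
noncomputable def simplexAmplitude (m : Fin r → ℝ) (m₀ ε : ℝ) (u : Fin r → ℝ) : ℝ :=
  (∏ i, m i / 2 * Real.exp (-smoothLog ε (u i))) *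
    Real.exp (-smoothLog ε (lastCoord m m₀ u)) / weight m m₀

theorem contDiff_lastCoord : ContDiff ℝ ∞ (lastCoord m m₀) := by
  unfold lastCoord
  exact (contDiff_const.sub (ContDiff.sum fun i _ =>
    contDiff_const.mul (contDiff_apply ℝ ℝ i))).div_const _

theorem contDiff_simplexPhase {ε : ℝ} (hε : 0 < ε) : ContDiff ℝ ∞ (simplexPhase m m₀ ε) := by
  have h := contDiff_smoothLog hε
  unfold simplexPhase
  exact (((ContDiff.sum fun i _ => contDiff_const.mul (h.comp (contDiff_apply ℝ ℝ i))).add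
    (contDiff_const.mul (h.comp contDiff_lastCoord))).div_const _).add contDiff_const

theorem contDiff_simplexAmplitude {ε : ℝ} (hε : 0 < ε) :
    ContDiff ℝ ∞ (simplexAmplitude m m₀ ε) := by
  have h := contDiff_smoothLog hε
  unfold simplexAmplitude
  exact ((contDiff_prod fun i _ => contDiff_const.mul
    (h.comp (contDiff_apply ℝ ℝ i)).neg.exp).mul (h.comp contDiff_lastCoord).neg.exp).div_const _

theorem simplexPhase_eq {ε : ℝ} (hε : 0 < ε) {u : Fin r → ℝ}
    (hu : u ∈ simplexCore m m₀ (ε / 2)) :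
    simplexPhase m m₀ ε u = logMean m m₀ u + Real.log (weight m m₀) := by
  rw [simplexPhase, logMean, smoothLog_eq hε hu.2]
  simp only [smoothLog_eq hε (hu.1 _)]

theorem simplexCore_pos {ε : ℝ} (hε : 0 < ε) {u : Fin r → ℝ} (hu : u ∈ simplexCore m m₀ ε) :
    (∀ i, 0 < u i) ∧ 0 < lastCoord m m₀ u :=
  ⟨fun i => hε.trans_le (hu.1 i), hε.trans_le hu.2⟩

/-- The smoothed logarithm is exact already from `ε / 2` on, so on the core at level `ε` the
derivatives of the smoothed phase are also those of `logMean`. -/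
theorem simplexCore_mem_nhds {ε : ℝ} (hε : 0 < ε) {u : Fin r → ℝ} (hu : u ∈ simplexCore m m₀ ε) :
    simplexCore m m₀ (ε / 2) ∈ 𝓝 u := by
  have h1 : ∀ᶠ v in 𝓝 u, ∀ i, ε / 2 ≤ v i := by
    rw [eventually_all]
    intro i
    exact ((continuous_apply i).tendsto u).eventually
      (Ici_mem_nhds (by linarith [hu.1 i]))
  have h2 : ∀ᶠ v in 𝓝 u, ε / 2 ≤ lastCoord m m₀ v :=
    ((continuous_lastCoord m m₀).tendsto u).eventually (Ici_mem_nhds (by linarith [hu.2]))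
  filter_upwards [h1, h2] with v hv1 hv2 using ⟨hv1, hv2⟩

include hm hm₀ in
theorem simplexAmplitude_eq {ε : ℝ} (hε : 0 < ε) {u : Fin r → ℝ} (hu : u ∈ simplexCore m m₀ ε) :
    simplexAmplitude m m₀ ε u = |(simplexChartMatrix m m₀ u).det| := by
  obtain ⟨h1, h2⟩ := simplexCore_pos hε hu
  have hε' : ε / 2 ≤ ε := by linarith
  rw [det_simplexChartMatrix hm hm₀ h1 h2, simplexAmplitude, smoothLog_eq hε (hε'.trans hu.2),
    Real.exp_neg, Real.exp_log h2]
  congr 2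
  refine Finset.prod_congr rfl fun i _ => ?_
  rw [smoothLog_eq hε (hε'.trans (hu.1 i)), Real.exp_neg, Real.exp_log (h1 i)]

include hm₀ in
theorem fderiv_simplexPhase {ε : ℝ} (hε : 0 < ε) {u : Fin r → ℝ} (hu : u ∈ simplexCore m m₀ ε) :
    fderiv ℝ (simplexPhase m m₀ ε) u =
      ∑ j, logMeanGrad m m₀ u j • (ContinuousLinearMap.proj j : (Fin r → ℝ) →L[ℝ] ℝ) := by
  obtain ⟨h1, h2⟩ := simplexCore_pos hε hu
  refine (((hasFDerivAt_logMean hm₀ h1 h2).add_const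
    (Real.log (weight m m₀))).congr_of_eventuallyEq ?_).fderiv
  filter_upwards [simplexCore_mem_nhds hε hu] with v hv using simplexPhase_eq hε hv

end SimplexChart

end OscillatoryIntegral

/-! ### Hessian of the simplex phase and its integrals over polytopes. -/

namespace OscillatoryIntegral

open Set Asymptotics
open scoped ContDiff

section SimplexIntegral

variable {r : ℕ} {m : Fin r → ℝ} {m₀ : ℝ} (hm : ∀ i, 0 < m i) (hm₀ : 0 < m₀)

theorem lastCoord_add_smul (u h : Fin r → ℝ) (t : ℝ) :
    lastCoord m m₀ (u + t • h) = lastCoord m m₀ u - t * ((∑ i, m i * h i) / m₀) := by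
  have : ∑ i, m i * (u + t • h) i = ∑ i, m i * u i + t * ∑ i, m i * h i := by
    rw [Finset.mul_sum, ← Finset.sum_add_distrib]
    exact Finset.sum_congr rfl fun i _ => by simp; ring
  rw [lastCoord, this, lastCoord]
  ring

theorem hasDerivAt_fderiv_line {ψ : (Fin r → ℝ) → ℝ} (hψ : ContDiff ℝ ∞ ψ) (u h : Fin r → ℝ) :
    HasDerivAt (fun t : ℝ => fderiv ℝ ψ (u + t • h) h) (fderiv ℝ (fderiv ℝ ψ) u h h) 0 := by
  have hs : ContDiff ℝ ∞ (fderiv ℝ ψ) := hψ.fderiv_right (by simp)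
  have hline : HasDerivAt (fun t : ℝ => u + t • h) h 0 := by
    simpa using ((hasDerivAt_id' (0 : ℝ)).smul_const h).const_add u
  have hd : HasFDerivAt (fun v => fderiv ℝ ψ v h)
      ((fderiv ℝ (fderiv ℝ ψ) u).flip h) (u + (0 : ℝ) • h) := by
    rw [zero_smul, add_zero]
    have := (hs.differentiable (by simp) u).hasFDerivAt.clm_apply (hasFDerivAt_const h u)
    refine this.congr_fderiv ?_
    ext v
    simp
  exact hd.comp_hasDerivAt (0 : ℝ) hline

include hm hm₀ in
theorem fderiv_fderiv_simplexPhase {ε : ℝ} (hε : 0 < ε) {u : Fin r → ℝ}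
    (hu : u ∈ simplexCore m m₀ ε) (h : Fin r → ℝ) :
    fderiv ℝ (fderiv ℝ (simplexPhase m m₀ ε)) u h h =
      -((∑ i, m i * (h i / u i) ^ 2 + m₀ * ((∑ i, m i * h i) / m₀ / lastCoord m m₀ u) ^ 2) /
        weight m m₀) := by
  obtain ⟨h1, h2⟩ := simplexCore_pos hε hu
  have hw := weight_pos hm hm₀
  have hA := hasDerivAt_fderiv_line (contDiff_simplexPhase (m := m) (m₀ := m₀) hε) u h
  set κ := (∑ i, m i * h i) / m₀ with hκ
  -- It is enough to differentiate the explicit gradient along the line `u + t h`, on which every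
  -- coordinate, the last one included, is affine in `t`.
  have hB : HasDerivAt (fun t : ℝ => ∑ j, m j / weight m m₀ *
      ((u j + t * h j)⁻¹ - (lastCoord m m₀ u - t * κ)⁻¹) * h j)
      (∑ j, m j / weight m m₀ * (-h j / u j ^ 2 - κ / lastCoord m m₀ u ^ 2) * h j) 0 := by
    refine HasDerivAt.fun_sum fun j _ => ?_
    have ha : HasDerivAt (fun t : ℝ => u j + t * h j) (h j) 0 := by
      simpa using ((hasDerivAt_id' (0 : ℝ)).mul_const (h j)).const_add (u j)
    have hb : HasDerivAt (fun t : ℝ => lastCoord m m₀ u - t * κ) (-κ) 0 := by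
      simpa using ((hasDerivAt_id' (0 : ℝ)).mul_const κ).const_sub (lastCoord m m₀ u)
    have ha' := ha.fun_inv (by simpa using (h1 j).ne')
    have hb' := hb.fun_inv (by simpa using h2.ne')
    refine (((ha'.sub hb').const_mul (m j / weight m m₀)).mul_const (h j)).congr_deriv ?_
    simp
  have hev : (fun t : ℝ => fderiv ℝ (simplexPhase m m₀ ε) (u + t • h) h) =ᶠ[𝓝 0]
      fun t : ℝ => ∑ j, m j / weight m m₀ *
        ((u j + t * h j)⁻¹ - (lastCoord m m₀ u - t * κ)⁻¹) * h j := by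
    have hmem : ∀ᶠ v in 𝓝 u, v ∈ simplexCore m m₀ (ε / 2) := simplexCore_mem_nhds hε hu
    have hev' : ∀ᶠ v in 𝓝 u, fderiv ℝ (simplexPhase m m₀ ε) v =
        ∑ j, logMeanGrad m m₀ v j • (ContinuousLinearMap.proj j : (Fin r → ℝ) →L[ℝ] ℝ) := by
      filter_upwards [eventually_eventually_nhds.mpr hmem] with v hv
      obtain ⟨hv1, hv2⟩ := simplexCore_pos (half_pos hε) hv.self_of_nhds
      refine (((hasFDerivAt_logMean hm₀ hv1 hv2).add_const
        (Real.log (weight m m₀))).congr_of_eventuallyEq ?_).fderiv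
      filter_upwards [hv] with v' hv' using simplexPhase_eq hε hv'
    have ht : Tendsto (fun t : ℝ => u + t • h) (𝓝 0) (𝓝 u) := by
      have : Continuous fun t : ℝ => u + t • h := by fun_prop
      simpa using this.tendsto 0
    filter_upwards [ht.eventually hev'] with t htt
    rw [htt, _root_.sum_apply]
    refine Finset.sum_congr rfl fun j _ => ?_
    rw [_root_.smul_apply, ContinuousLinearMap.proj_apply, logMeanGrad, lastCoord_add_smul]
    rfl
  rw [(hB.congr_of_eventuallyEq hev).unique hA |>.symm]
  have hsum : ∑ j, m j * h j = m₀ * κ := by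
    rw [hκ]
    field_simp
  have hpull : (κ / lastCoord m m₀ u ^ 2) * ∑ j, m j * h j = m₀ * (κ / lastCoord m m₀ u) ^ 2 := by
    rw [hsum]
    ring
  rw [← hpull, Finset.mul_sum, ← Finset.sum_add_distrib, Finset.sum_div, ← Finset.sum_neg_distrib]
  refine Finset.sum_congr rfl fun j _ => ?_
  rw [div_pow]
  field_simp
  ring

include hm hm₀ in
-- Nonpositivity is Jensen's inequality for the logarithm, proved with the tangent at `1 / weight`;
-- the summand `log weight` in the phase makes the maximum `0`. Concavity is read off from the
-- Hessian, a negative sum of squares.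
theorem isPhase_simplexPhase {ε : ℝ} (hε : 0 < ε) {K : Set (Fin r → ℝ)}
    (hK : K ⊆ simplexCore m m₀ ε) : IsPhase K (simplexPhase m m₀ ε) := by
  have hw := weight_pos hm hm₀
  refine ⟨contDiff_simplexPhase hε, fun u hu => ?_, fun u hu h hh => ?_⟩
  · obtain ⟨h1, h2⟩ := simplexCore_pos hε (hK hu)
    rw [simplexPhase_eq hε (mem_of_mem_nhds (simplexCore_mem_nhds hε (hK hu)))]
    have key : ∀ t : ℝ, 0 < t →
        Real.log t ≤ weight m m₀ * t - 1 - Real.log (weight m m₀) := fun t ht => by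
      have := Real.log_le_sub_one_of_pos (mul_pos hw ht)
      rw [Real.log_mul hw.ne' ht.ne'] at this
      linarith
    have hle : weight m m₀ * logMean m m₀ u ≤
        ∑ i, m i * (weight m m₀ * u i - 1 - Real.log (weight m m₀)) +
          m₀ * (weight m m₀ * lastCoord m m₀ u - 1 - Real.log (weight m m₀)) := by
      rw [weight_mul_logMean hm hm₀]
      exact add_le_add (Finset.sum_le_sum fun i _ =>
        mul_le_mul_of_nonneg_left (key _ (h1 i)) (hm i).le)
        (mul_le_mul_of_nonneg_left (key _ h2) hm₀.le)
    have heq : ∑ i, m i * (weight m m₀ * u i - 1 - Real.log (weight m m₀)) +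
          m₀ * (weight m m₀ * lastCoord m m₀ u - 1 - Real.log (weight m m₀)) =
        weight m m₀ * -Real.log (weight m m₀) := by
      have h3 : ∑ i, m i * (weight m m₀ * u i - 1 - Real.log (weight m m₀)) =
          weight m m₀ * ∑ i, m i * u i - (∑ i, m i) * (1 + Real.log (weight m m₀)) := by
        rw [Finset.mul_sum, Finset.sum_mul, ← Finset.sum_sub_distrib]
        exact Finset.sum_congr rfl fun i _ => by ring
      have h4 : ∑ i, m i = weight m m₀ - m₀ := by rw [weight]; ring
      rw [h3, h4, eq_sub_of_add_eq (sum_add_lastCoord (m := m) hm₀ u)]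
      ring
    rw [heq] at hle
    linarith [le_of_mul_le_mul_left hle hw]
  · obtain ⟨h1, h2⟩ := simplexCore_pos hε (hK hu)
    rw [fderiv_fderiv_simplexPhase hm hm₀ hε (hK hu), neg_lt_zero]
    obtain ⟨i, hi⟩ : ∃ i, h i ≠ 0 := by
      by_contra hcon
      push Not at hcon
      exact hh (funext hcon)
    have hpos : 0 < ∑ i, m i * (h i / u i) ^ 2 := by
      refine Finset.sum_pos' (fun j _ => mul_nonneg (hm j).le (sq_nonneg _))
        ⟨i, Finset.mem_univ i, mul_pos (hm i) ?_⟩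
      have := (h1 i).ne'
      positivity
    positivity

include hm hm₀ in
theorem injOn_simplexChart : InjOn (simplexChart m m₀)
    {u | (∀ i, 0 < u i) ∧ 0 < lastCoord m m₀ u} := fun u hu v hv h => by
  rw [← simplexCoord_simplexChart hm hm₀ hu.1 hu.2, h, simplexCoord_simplexChart hm hm₀ hv.1 hv.2]

include hm hm₀ in
/-- Integrals of complex powers of `height` are oscillatory integrals in the simplex chart. -/
theorem integral_height_cpow {ε : ℝ} (hε : 0 < ε) {K : Set (Fin r → ℝ)} (hKc : IsCompact K)
    (hK : K ⊆ simplexCore m m₀ ε) (s : ℂ) :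
    ∫ x in simplexChart m m₀ '' K, (height m m₀ x : ℂ) ^ (-s) =
      (weight m m₀ : ℂ) ^ (-s) *
        osc K (simplexPhase m m₀ ε) (fun u => (simplexAmplitude m m₀ ε u : ℂ)) s := by
  have hw := weight_pos hm hm₀
  rw [integral_image_eq_integral_abs_det_fderiv_smul volume hKc.measurableSet
    (f' := fun u => LinearMap.toContinuousLinearMap (Matrix.toLin' (simplexChartMatrix m m₀ u)))
    (fun u hu => (hasFDerivAt_simplexChart hm₀ (simplexCore_pos hε (hK hu)).1
      (simplexCore_pos hε (hK hu)).2).hasFDerivWithinAt)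
    ((injOn_simplexChart hm hm₀).mono fun u hu => simplexCore_pos hε (hK hu)), osc,
    ← integral_const_mul]
  refine setIntegral_congr_fun hKc.measurableSet fun u hu => ?_
  obtain ⟨h1, h2⟩ := simplexCore_pos hε (hK hu)
  have hdet : (LinearMap.toContinuousLinearMap (Matrix.toLin' (simplexChartMatrix m m₀ u))).det =
      (simplexChartMatrix m m₀ u).det := LinearMap.det_toLin' _
  simp only [hdet]
  rw [← simplexAmplitude_eq hm hm₀ hε (hK hu), height_simplexChart hm hm₀ h1 h2,
    simplexPhase_eq hε (mem_of_mem_nhds (simplexCore_mem_nhds hε (hK hu))), Complex.real_smul,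
    mul_left_comm]
  congr 1
  rw [Complex.cpow_def_of_ne_zero (by exact_mod_cast (Real.exp_pos _).ne'),
    Complex.cpow_def_of_ne_zero (by exact_mod_cast hw.ne'), ← Complex.exp_add,
    ← Complex.ofReal_log (Real.exp_pos _).le, Real.log_exp, ← Complex.ofReal_log hw.le]
  congr 1
  push_cast
  ring

include hm hm₀ in
theorem differentiable_integral_height_cpow {ε : ℝ} (hε : 0 < ε) {K : Set (Fin r → ℝ)}
    (hKc : IsCompact K) (hK : K ⊆ simplexCore m m₀ ε) :
    Differentiable ℂ fun s : ℂ => ∫ x in simplexChart m m₀ '' K, (height m m₀ x : ℂ) ^ (-s) := by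
  have hw : (weight m m₀ : ℂ) ≠ 0 := by exact_mod_cast (weight_pos hm hm₀).ne'
  simp only [integral_height_cpow hm hm₀ hε hKc hK]
  intro s
  exact ((differentiableAt_id.neg).const_cpow (Or.inl hw)).mul
    (hasDerivAt_osc hKc (contDiff_simplexPhase hε).continuous
      (Complex.continuous_ofReal.comp (contDiff_simplexAmplitude hε).continuous) s).differentiableAt

include hm hm₀ in
-- The general decay theorem, with the maximal exponential `weight ^ (-s)` removed. Nothing is
-- assumed about the position of the barycentre relative to `K`.
theorem isBigO_integral_height_cpow {ε : ℝ} (hε : 0 < ε) {K : Set (Fin r → ℝ)}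
    (hKp : IsPolytope K) (hK : K ⊆ simplexCore m m₀ ε) :
    (fun s : ℂ => s ^ ((r : ℂ) / 2) * (weight m m₀ : ℂ) ^ s *
      ∫ x in simplexChart m m₀ '' K, (height m m₀ x : ℂ) ^ (-s)) =O[𝓟 halfPlane]
        fun _ => (1 : ℝ) := by
  have hw : (weight m m₀ : ℂ) ≠ 0 := by exact_mod_cast (weight_pos hm hm₀).ne'
  have h := (decays r K _ hKp (isPhase_simplexPhase hm hm₀ hε hK)).1
    (fun u => (simplexAmplitude m m₀ ε u : ℂ))
    (Complex.ofRealCLM.contDiff.comp (contDiff_simplexAmplitude hε))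
  have h1 : (fun s : ℂ => s ^ ((r : ℂ) / 2)) =O[𝓟 halfPlane] fun s => ‖s‖ ^ ((r : ℝ) / 2) := by
    refine IsBigO.of_bound 1 ?_
    filter_upwards [mem_principal_self halfPlane] with s hs
    have hs0 : s ≠ 0 := norm_pos_iff.mp (one_pos.trans_le (one_le_norm hs))
    have : ((r : ℂ) / 2) = ((r : ℝ) / 2 : ℝ) := by push_cast; rfl
    rw [this, Complex.norm_cpow_real, one_mul, Real.norm_of_nonneg (by positivity)]
  refine (h1.mul h).congr' ?_ ?_
  · refine Eventually.of_forall fun s => ?_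
    dsimp only
    rw [integral_height_cpow hm hm₀ hε hKp.isCompact hK, Complex.cpow_neg]
    have := (Complex.cpow_ne_zero_iff (x := (weight m m₀ : ℂ)) (y := s)).mpr (Or.inl hw)
    field_simp
  · filter_upwards [mem_principal_self halfPlane] with s hs
    rw [← Real.rpow_add (one_pos.trans_le (one_le_norm hs))]
    simp [neg_div]

include hm hm₀ in
-- The gradient of `logMean` vanishes where all coordinates are equal, hence at the barycentre, and
-- Laplace's method applies there.
theorem tendsto_integral_height_cpow {ε : ℝ} (hε : 0 < ε) {K : Set (Fin r → ℝ)}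
    (hKp : IsPolytope K) (hK : K ⊆ simplexCore m m₀ ε)
    (hp : (fun _ => (weight m m₀)⁻¹) ∈ interior K) :
    Tendsto (fun s : ℂ => s ^ ((r : ℂ) / 2) * (weight m m₀ : ℂ) ^ s *
      ∫ x in simplexChart m m₀ '' K, (height m m₀ x : ℂ) ^ (-s)) (comap Complex.re atTop)
        (𝓝 ((√(Real.pi * weight m m₀ / 2) ^ r *
          √((∏ i, m i) * m₀ / weight m m₀) : ℝ) : ℂ)) := by
  have hw' := weight_pos hm hm₀
  have hw : (weight m m₀ : ℂ) ≠ 0 := by exact_mod_cast hw'.ne'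
  set n := weight m m₀ with hn
  set p : Fin r → ℝ := fun _ => n⁻¹ with hpdef
  have hpK := hK (interior_subset hp)
  have hlast : lastCoord m m₀ p = n⁻¹ := by
    have h4 : ∑ i, m i = n - m₀ := by rw [hn, weight]; ring
    rw [lastCoord, hpdef]
    simp only [← Finset.sum_mul, h4]
    field_simp
    ring
  have hphase := isPhase_simplexPhase hm hm₀ hε hK
  have hcrit : fderiv ℝ (simplexPhase m m₀ ε) p = 0 := by
    rw [fderiv_simplexPhase hm₀ hε hpK]
    refine Finset.sum_eq_zero fun j _ => ?_
    rw [logMeanGrad, hlast, hpdef]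
    simp
  have hp0 : simplexPhase m m₀ ε p = 0 := by
    rw [simplexPhase_eq hε (mem_of_mem_nhds (simplexCore_mem_nhds hε hpK)), logMean, hlast, hpdef,
      ← Finset.sum_mul, ← add_mul, add_comm (∑ i, m i), Real.log_inv]
    rw [← weight, ← hn]
    field_simp
    ring
  have h := tendsto_cpow_mul_osc hKp hphase hp hcrit hp0
    (w := fun u => (simplexAmplitude m m₀ ε u : ℂ))
    (Complex.ofRealCLM.contDiff.comp (contDiff_simplexAmplitude hε))
  have hamp : simplexAmplitude m m₀ ε p = ∏ i, (n * m i / 2) := by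
    rw [simplexAmplitude_eq hm hm₀ hε hpK, det_simplexChartMatrix hm hm₀
      (simplexCore_pos hε hpK).1 (simplexCore_pos hε hpK).2, hlast, ← hn, inv_inv,
      mul_div_cancel_right₀ _ hw'.ne']
    refine Finset.prod_congr rfl fun i _ => ?_
    rw [hpdef, inv_inv]
    ring
  -- At the barycentre half the Hessian is minus a diagonal form with entries `n m_i / 2` plus the
  -- rank one term of coefficient `n / (2 m₀)`; the perturbation multiplies the determinant by `n /
  -- m₀`.
  have hgauss : ∫ v, Real.exp (fderiv ℝ (fderiv ℝ (simplexPhase m m₀ ε)) p v v / 2) =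
      √Real.pi ^ r / √((∏ i, (n * m i / 2)) * (n / m₀)) := by
    have h1 := integral_exp_neg_diag_add_sq (a := fun i => n * m i / 2)
      (fun i => by have := hm i; positivity) m (b := n / (2 * m₀)) (by positivity)
    have h2 : 1 + n / (2 * m₀) * ∑ i, m i ^ 2 / (n * m i / 2) = n / m₀ := by
      have h3 : ∑ i, m i ^ 2 / (n * m i / 2) = 2 / n * (n - m₀) := by
        rw [show n - m₀ = ∑ i, m i by rw [hn, weight]; ring, Finset.mul_sum]
        refine Finset.sum_congr rfl fun i _ => ?_
        have := (hm i).ne'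
        field_simp
      rw [h3]
      field_simp
      ring
    rw [h2] at h1
    rw [← h1]
    congr 1 with v
    congr 1
    rw [fderiv_fderiv_simplexPhase hm hm₀ hε hpK, hlast, ← hn]
    simp only [hpdef]
    rw [neg_div]
    congr 1
    rw [add_div, add_div, Finset.sum_div, Finset.sum_div]
    congr 1
    · refine Finset.sum_congr rfl fun i _ => ?_
      field_simp
    · field_simp
  have hfinal : (simplexAmplitude m m₀ ε p : ℂ) *
      ((∫ v, Real.exp (fderiv ℝ (fderiv ℝ (simplexPhase m m₀ ε)) p v v / 2) : ℝ) : ℂ) =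
      ((√(Real.pi * n / 2) ^ r * √((∏ i, m i) * m₀ / n) : ℝ) : ℂ) := by
    rw [← Complex.ofReal_mul, hamp, hgauss]
    congr 1
    have hP : ∏ i, (n * m i / 2) = (n / 2) ^ r * ∏ i, m i := by
      simp only [fun i => show n * m i / 2 = n / 2 * m i by ring]
      rw [Finset.prod_mul_distrib, Finset.prod_const, Finset.card_univ, Fintype.card_fin]
    have hM : 0 < ∏ i, m i := Finset.prod_pos fun i _ => hm i
    have hD : 0 < ∏ i, (n * m i / 2) := by rw [hP]; positivity
    have e1 : √(Real.pi * n / 2) ^ r = √Real.pi ^ r * √((n / 2) ^ r) := by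
      rw [mul_div_assoc, Real.sqrt_mul Real.pi_pos.le, mul_pow]
      congr 1
      conv_rhs => rw [← Real.sq_sqrt (by positivity : 0 ≤ n / 2), ← pow_mul, mul_comm, pow_mul,
        Real.sqrt_sq (by positivity)]
    rw [e1, mul_assoc, ← Real.sqrt_mul (by positivity), mul_div_assoc', mul_comm (∏ i, _),
      mul_div_assoc]
    congr 1
    rw [div_eq_iff (by positivity), ← Real.sqrt_mul (by positivity), hP]
    rw [show (n / 2) ^ r * ((∏ i, m i) * m₀ / n) * ((n / 2) ^ r * (∏ i, m i) * (n / m₀)) =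
      ((n / 2) ^ r * ∏ i, m i) ^ 2 by field_simp, Real.sqrt_sq (by positivity)]
  rw [← hfinal]
  refine h.congr fun s => ?_
  rw [integral_height_cpow hm hm₀ hε hKp.isCompact hK, Complex.cpow_neg, ← hn]
  have := (Complex.cpow_ne_zero_iff (x := (n : ℂ)) (y := s)).mpr (Or.inl hw)
  field_simp

end SimplexIntegral

end OscillatoryIntegral

/-! ### Unfolding an integral over a quotient group. -/

namespace Arakelov

section Unfolding

variable {G : Type*} [AddCommGroup G] [TopologicalSpace G] [IsTopologicalAddGroup G]
  [PolishSpace G] [MeasurableSpace G] [BorelSpace G] {Γ : AddSubgroup G} [Countable Γ]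

omit [TopologicalSpace G] [IsTopologicalAddGroup G] [PolishSpace G] [BorelSpace G] in
theorem measurable_of_hasSum [MeasurableAdd G] {f : G → ℂ} (hf : Measurable f) {F : G → ℂ}
    (hF : ∀ x, HasSum (fun γ : Γ => f (x + γ)) (F x)) : Measurable F := by
  refine measurable_of_tendsto_metrizable' (atTop : Filter (Finset Γ))
    (f := fun (s : Finset Γ) x => ∑ γ ∈ s, f (x + γ)) (fun s => ?_)
    (tendsto_pi_nhds.mpr fun x => hF x)
  exact Finset.measurable_fun_sum s fun γ _ => hf.comp (measurable_add_const _)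

/-- The unfolding trick for the quotient of an abelian group by a countable subgroup. -/
theorem integral_quotient_eq_integral (hΓ : IsClosed (Γ : Set G)) [mQ : MeasurableSpace (G ⧸ Γ)] [BorelSpace (G ⧸ Γ)]
    {ν : Measure G} [SigmaFinite ν] [ν.IsAddLeftInvariant] [ν.IsAddRightInvariant] {𝓕 : Set G}
    (h𝓕 : IsAddFundamentalDomain Γ.op 𝓕 ν) {μ : Measure (G ⧸ Γ)} [μ.IsAddLeftInvariant]
    [IsFiniteMeasure μ] (hμ : ν 𝓕 = μ Set.univ) {f : G → ℂ} (hf : Measurable f)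
    (hfi : Integrable f ν) {F : G ⧸ Γ → ℂ}
    (hF : ∀ x : G, HasSum (fun γ : Γ => f (x + γ)) (F x)) :
    Integrable F μ ∧ ∫ x, F x ∂μ = ∫ x, f x ∂ν := by
  -- For a closed subgroup of a Polish group the Borel structure of the quotient topology is the
  -- quotient measurable structure.
  obtain rfl : mQ = Quotient.instMeasurableSpace := by
    have h1 := (inferInstance : BorelSpace (G ⧸ Γ)).measurable_eq
    have h2 := (QuotientAddGroup.borelSpace (G := G) (N := Γ)).measurable_eq
    exact h1.trans h2.symm
  have hfun : HasAddFundamentalDomain Γ.op G ν := ⟨⟨𝓕, h𝓕⟩⟩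
  -- Invariance determines the measure on the quotient up to a scalar, and the scalar is fixed by `ν
  -- 𝓕 = μ univ`.
  have hq : AddQuotientMeasureEqMeasurePreimage ν μ :=
    leftInvariantIsAddQuotientMeasureEqMeasurePreimage ν (by rw [h𝓕.covolume_eq_volume, hμ])
  have hmp : MeasurePreserving (QuotientAddGroup.mk : G → G ⧸ Γ) (ν.restrict 𝓕) μ :=
    h𝓕.measurePreserving_add_quotient_mk μ
  have hFm : Measurable (fun x : G => F x) := measurable_of_hasSum hf hF
  have hFq : Measurable F := fun s hs => by
    rw [measurableSet_quotient]
    exact hFm hs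
  have hFop : ∀ x : G, HasSum (fun γ : Γ.op => f (γ +ᵥ x)) (F x) := fun x =>
    (Γ.equivOp.hasSum_iff).mp (hF x)
  have hnorm : ∫⁻ x, ‖f x‖ₑ ∂ν = ∑' γ : Γ.op, ∫⁻ x in 𝓕, ‖f (γ +ᵥ x)‖ₑ ∂ν :=
    h𝓕.lintegral_eq_tsum'' _
  have hmeas : ∀ γ : Γ.op, Measurable fun x : G => f (γ +ᵥ x) := fun γ =>
    hf.comp (measurable_const_vadd γ)
  have hint : Integrable (fun x : G => F x) (ν.restrict 𝓕) := by
    refine ⟨hFm.aestronglyMeasurable, ?_⟩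
    refine lt_of_le_of_lt ?_ hfi.2
    rw [hnorm, ← lintegral_tsum fun γ => (hmeas γ).enorm.aemeasurable]
    refine lintegral_mono fun x => ?_
    dsimp only
    rw [← (hFop x).tsum_eq]
    exact enorm_tsum_le_tsum_enorm
  refine ⟨(hmp.integrable_comp hFq.aestronglyMeasurable).mp hint, ?_⟩
  rw [← hmp.map_eq, integral_map hmp.measurable.aemeasurable hFq.aestronglyMeasurable,
    h𝓕.integral_eq_tsum'' f hfi, ← integral_tsum fun γ => (hmeas γ).aestronglyMeasurable]
  · exact integral_congr_ae (Eventually.of_forall fun x => (hFop x).tsum_eq.symm)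
  · rw [← hnorm]
    exact hfi.2.ne

end Unfolding

end Arakelov

/-! ### Norms, ideals and finiteness of short vectors. -/

namespace Arakelov

section Norms

variable {k : Type*} [Field k] [NumberField k]

theorem countable_numberField (k : Type*) [Field k] [NumberField k] : Countable k :=
  (Module.finBasis ℚ k).equivFun.toEquiv.countable_iff.mpr inferInstance

instance : Countable (HeightOneSpectrum (𝓞 k)) := by
  have := countable_numberField k
  have h1 : Countable (𝓞 k) := RingOfIntegers.coe_injective.countable
  have h2 : Countable (Ideal (𝓞 k)) := by
    refine Function.Surjective.countable (f := fun s : Finset (𝓞 k) => Ideal.span (s : Set (𝓞 k)))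
      fun I => ?_
    obtain ⟨s, hs⟩ := IsNoetherian.noetherian I
    exact ⟨s, hs⟩
  exact Function.Injective.countable (f := HeightOneSpectrum.asIdeal)
    fun p q h => HeightOneSpectrum.ext h

instance : MeasurableSpace (FinDivisor k) := ⊤

instance : DiscreteMeasurableSpace (FinDivisor k) := ⟨fun _ => trivial⟩

/-- The local degree absorbs the distinction between real and complex places, so all places can be
treated alike. -/
theorem normSq_eq (D : Divisor k) (f : k) :
    normSq D f = ∑ v : InfinitePlace k,
      (v.mult : ℝ) * v f ^ 2 * Real.exp (-(2 / (v.mult : ℝ)) * D.2 v) := by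
  classical
  refine Finset.sum_congr rfl fun v _ => ?_
  by_cases hv : v.IsReal
  · rw [if_pos hv, InfinitePlace.mult_isReal ⟨v, hv⟩]
    simp
  · rw [if_neg hv, InfinitePlace.mult_isComplex ⟨v, InfinitePlace.not_isReal_iff_isComplex.mp hv⟩]
    norm_num
    ring

theorem normSq_pos (D : Divisor k) {f : k} (hf : f ≠ 0) : 0 < normSq D f := by
  rw [normSq_eq]
  refine Finset.sum_pos (fun v _ => ?_) Finset.univ_nonempty
  have := (InfinitePlace.pos_iff (w := v)).mpr hf
  have := InfinitePlace.mult_pos (w := v)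
  positivity

theorem continuous_normSq (f : k) : Continuous fun D : Divisor k => normSq D f := by
  simp only [normSq_eq]
  fun_prop

/-- The norm of the finite part of an Arakelov divisor. -/
noncomputable def finNorm (d : FinDivisor k) : ℝ :=
  d.prod fun p m => (Ideal.absNorm p.asIdeal : ℝ) ^ m

theorem finNorm_pos (d : FinDivisor k) : 0 < finNorm d :=
  Finset.prod_pos fun p _ => zpow_pos (lt_of_le_of_ne (Nat.cast_nonneg _)
    (absNorm_prime_ne_zero p).symm) _

theorem absNorm_eq (D : Divisor k) : absNorm D = finNorm D.1 * Real.exp (∑ v, D.2 v) := by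
  rw [absNorm, Real.exp_sum, finNorm]

theorem ideal_ne_zero (D : Divisor k) : ideal D ≠ 0 := by
  rw [ideal, Finsupp.prod]
  exact Finset.prod_ne_zero_iff.mpr fun p _ => zpow_ne_zero _ (by simpa using p.ne_bot)

theorem ideal_eq_of_fst_eq {D E : Divisor k} (h : D.1 = E.1) : ideal D = ideal E := by
  rw [ideal, ideal, h]

theorem ideal_neg (D : Divisor k) : ideal (-D) = (ideal D)⁻¹ := by
  refine eq_inv_of_mul_eq_one_left ?_
  rw [← ideal_add, neg_add_cancel]
  simp [ideal]

theorem count_ideal (D : Divisor k) (p : HeightOneSpectrum (𝓞 k)) :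
    FractionalIdeal.count k p (ideal D) = -D.1 p := by
  have h : ideal D = (-D.1).prod
      fun p m => (p.asIdeal : FractionalIdeal (𝓞 k)⁰ k) ^ m := by
    rw [ideal, Finsupp.prod_neg_index (by simp)]
  rw [h, FractionalIdeal.count_finsuppProd, Finsupp.neg_apply]

theorem fst_eq_of_ideal_eq {D E : Divisor k} (h : ideal D = ideal E) : D.1 = E.1 := by
  refine Finsupp.ext fun p => neg_injective ?_
  rw [← count_ideal, ← count_ideal, h]

theorem exists_ideal_eq {I : FractionalIdeal (𝓞 k)⁰ k} (hI : I ≠ 0) :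
    ∃ d : FinDivisor k, ∀ x, ideal (d, x) = I := by
  have hfin : (Function.support fun p : HeightOneSpectrum (𝓞 k) =>
      -FractionalIdeal.count k p I).Finite := by
    simpa [Function.support, Filter.eventually_cofinite] using FractionalIdeal.finite_factors I
  refine ⟨Finsupp.ofSupportFinite (fun p => -FractionalIdeal.count k p I) hfin, fun x => ?_⟩
  refine Eq.trans ?_ (FractionalIdeal.finprod_heightOneSpectrum_factorization' k hI)
  rw [ideal, Finsupp.prod]
  refine Eq.trans ?_ (finprod_eq_prod_of_mulSupport_subset (s := hfin.toFinset) _ ?_).symm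
  · have hs : (Finsupp.ofSupportFinite (fun p => -FractionalIdeal.count k p I) hfin).support =
        hfin.toFinset := by
      ext p
      simp [Finsupp.ofSupportFinite]
    rw [hs]
    exact Finset.prod_congr rfl fun p _ => by simp [Finsupp.ofSupportFinite]
  · intro p hp
    simp only [Set.Finite.coe_toFinset]
    intro h
    exact hp (by simp [neg_eq_zero.mp h])

theorem absNorm_ideal (D : Divisor k) :
    ((FractionalIdeal.absNorm (ideal D) : ℚ) : ℝ) = (finNorm D.1)⁻¹ := by
  rw [ideal, finNorm, Finsupp.prod, Finsupp.prod, map_prod, Rat.cast_prod, ← Finset.prod_inv_distrib]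
  refine Finset.prod_congr rfl fun p _ => ?_
  rw [map_zpow₀, FractionalIdeal.coeIdeal_absNorm, Rat.cast_zpow, Rat.cast_natCast, zpow_neg]

/-- The product formula: the norm of the principal ideal cancels the product of the archimedean
absolute values. -/
theorem absNorm_div (g : Additive kˣ) : absNorm (div g) = 1 := by
  have hg : (g.toMul : k) ≠ 0 := g.toMul.ne_zero
  have h1 : finNorm (div g).1 = |(Algebra.norm ℚ (g.toMul : k) : ℝ)| := by
    have h := absNorm_ideal (div g)
    have hinv : Algebra.norm ℚ (g.toMul : k)⁻¹ = (Algebra.norm ℚ (g.toMul : k))⁻¹ :=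
      eq_inv_of_mul_eq_one_left (by rw [← map_mul, inv_mul_cancel₀ hg, map_one])
    rw [ideal_div, FractionalIdeal.absNorm_span_singleton, hinv, abs_inv, Rat.cast_inv,
      Rat.cast_abs] at h
    exact (inv_injective h).symm
  rw [absNorm_eq, h1, ← Rat.cast_abs, ← InfinitePlace.prod_eq_abs_norm, Real.exp_sum,
    ← Finset.prod_mul_distrib]
  refine Finset.prod_eq_one fun v _ => ?_
  have hv := (InfinitePlace.pos_iff (w := v)).mpr hg
  have : (div g).2 v = -((v.mult : ℝ) * Real.log (v (g.toMul : k))) := rfl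
  rw [this, Real.exp_neg, ← Real.log_pow, Real.exp_log (pow_pos hv _),
    mul_inv_cancel₀ (pow_pos hv _).ne']

/-- The ideal `f I(D)⁻¹` is integral and nonzero, so its norm is a positive integer. -/
theorem one_le_abs_norm_mul_finNorm (D : Divisor k) {f : k} (hf : f ∈ ideal D) (hf0 : f ≠ 0) :
    1 ≤ |(Algebra.norm ℚ f : ℝ)| * finNorm D.1 := by
  have hI := ideal_ne_zero D
  obtain ⟨J, hJ⟩ : ∃ J : Ideal (𝓞 k), (J : FractionalIdeal (𝓞 k)⁰ k) =
      FractionalIdeal.spanSingleton (𝓞 k)⁰ f * (ideal D)⁻¹ := by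
    rw [← FractionalIdeal.le_one_iff_exists_coeIdeal]
    calc _ ≤ ideal D * (ideal D)⁻¹ := by
          gcongr
          exact (FractionalIdeal.spanSingleton_le_iff_mem).mpr hf
      _ = 1 := mul_inv_cancel₀ hI
  have h := congrArg (fun x => ((FractionalIdeal.absNorm x : ℚ) : ℝ)) hJ
  simp only [map_mul, map_inv₀, FractionalIdeal.absNorm_span_singleton,
    FractionalIdeal.coeIdeal_absNorm, Rat.cast_mul, Rat.cast_inv, absNorm_ideal, inv_inv,
    Rat.cast_natCast, Rat.cast_abs] at h
  rw [← h, Nat.one_le_cast, Nat.one_le_iff_ne_zero]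
  intro h0
  rw [Ideal.absNorm_eq_zero_iff] at h0
  rw [h0, FractionalIdeal.coeIdeal_bot, eq_comm, mul_eq_zero] at hJ
  rcases hJ with h | h
  · exact hf0 (FractionalIdeal.spanSingleton_eq_zero_iff.mp h)
  · exact inv_ne_zero hI h

/-- A common denominator moves the ideal into the integers, of which only finitely many have all
conjugates bounded. -/
theorem finite_ideal_bounded (I : FractionalIdeal (𝓞 k)⁰ k) (B : ℝ) :
    {f : k | f ∈ I ∧ ∀ v : InfinitePlace k, v f ≤ B}.Finite := by
  obtain ⟨a, ha, hint⟩ := I.isFractional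
  have ha0 : algebraMap (𝓞 k) k a ≠ 0 := by
    simpa using nonZeroDivisors.ne_zero ha
  obtain ⟨A, hA⟩ : ∃ A : ℝ, ∀ v : InfinitePlace k, v (algebraMap (𝓞 k) k a) ≤ A := by
    obtain ⟨v₀, -, h⟩ := Finset.univ.exists_max_image
      (fun v : InfinitePlace k => v (algebraMap (𝓞 k) k a)) Finset.univ_nonempty
    exact ⟨_, fun v => h v (Finset.mem_univ v)⟩
  refine Set.Finite.of_finite_image (f := fun f => algebraMap (𝓞 k) k a * f)
    ((Embeddings.finite_of_norm_le k ℂ (A * B)).subset ?_)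
    fun x _ y _ h => mul_left_cancel₀ ha0 h
  rintro _ ⟨f, ⟨hf, hb⟩, rfl⟩
  refine ⟨?_, ?_⟩
  · obtain ⟨y, hy⟩ := hint f hf
    dsimp only
    rw [← Algebra.smul_def, ← hy]
    exact RingOfIntegers.isIntegral_coe y
  · rw [← InfinitePlace.le_iff_le]
    intro v
    rw [map_mul]
    have h0 : 0 ≤ v f := apply_nonneg v f
    exact mul_le_mul (hA v) (hb v) h0 ((apply_nonneg v _).trans (hA v))

theorem finite_normSq_le (D : Divisor k) (B : ℝ) : {f : k | f ∈ ideal D ∧ normSq D f ≤ B}.Finite := by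
  obtain ⟨M, hM⟩ : ∃ M : ℝ, ∀ v : InfinitePlace k, Real.exp (2 / (v.mult : ℝ) * D.2 v) ≤ M := by
    obtain ⟨v₀, -, h⟩ := Finset.univ.exists_max_image
      (fun v : InfinitePlace k => Real.exp (2 / (v.mult : ℝ) * D.2 v)) Finset.univ_nonempty
    exact ⟨_, fun v => h v (Finset.mem_univ v)⟩
  refine (finite_ideal_bounded (ideal D) (√(B * M))).subset ?_
  rintro f ⟨hf, hB⟩
  refine ⟨hf, fun v => Real.le_sqrt_of_sq_le ?_⟩
  have h1 : (v.mult : ℝ) * v f ^ 2 * Real.exp (-(2 / (v.mult : ℝ)) * D.2 v) ≤ B := by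
    refine le_trans ?_ hB
    rw [normSq_eq]
    exact Finset.single_le_sum (f := fun v : InfinitePlace k => (v.mult : ℝ) * v f ^ 2 *
      Real.exp (-(2 / (v.mult : ℝ)) * D.2 v)) (fun v _ => by positivity) (Finset.mem_univ v)
  have hm : (1 : ℝ) ≤ v.mult := by exact_mod_cast InfinitePlace.mult_pos
  have hB0 : 0 ≤ B := le_trans (by positivity) h1
  have h2 : v f ^ 2 * Real.exp (-(2 / (v.mult : ℝ)) * D.2 v) ≤ B := by
    refine le_trans ?_ h1
    rw [mul_assoc]
    exact le_mul_of_one_le_left (by positivity) hm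
  rw [neg_mul, Real.exp_neg, ← div_eq_mul_inv, div_le_iff₀ (Real.exp_pos _)] at h2
  exact h2.trans (mul_le_mul_of_nonneg_left (hM v) hB0)

theorem exists_mem_ideal_ne_zero (D : Divisor k) : ∃ f ∈ ideal D, f ≠ 0 := by
  by_contra h
  push Not at h
  refine ideal_ne_zero D (FractionalIdeal.eq_zero_iff.mpr h)

theorem exists_minSq (D : Divisor k) :
    ∃ f ∈ ideal D, f ≠ 0 ∧ normSq D f = minSq D ∧
      ∀ g ∈ ideal D, g ≠ 0 → minSq D ≤ normSq D g := by
  obtain ⟨f₀, hf₀, h0⟩ := exists_mem_ideal_ne_zero D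
  have hfin : {f : k | (f ∈ ideal D ∧ f ≠ 0) ∧ normSq D f ≤ normSq D f₀}.Finite :=
    (finite_normSq_le D (normSq D f₀)).subset fun f hf => ⟨hf.1.1, hf.2⟩
  obtain ⟨f, hf, hmin⟩ := Set.exists_min_image _ (normSq D) hfin ⟨f₀, ⟨hf₀, h0⟩, le_rfl⟩
  have hle : ∀ g ∈ ideal D, g ≠ 0 → normSq D f ≤ normSq D g := fun g hg hg0 => by
    rcases le_total (normSq D g) (normSq D f₀) with h | h
    · exact hmin g ⟨⟨hg, hg0⟩, h⟩
    · exact hf.2.trans h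
  have heq : normSq D f = minSq D := by
    have hl : IsLeast (normSq D '' {f : k | f ∈ ideal D ∧ f ≠ 0}) (normSq D f) := by
      refine ⟨⟨f, hf.1, rfl⟩, ?_⟩
      rintro _ ⟨g, hg, rfl⟩
      exact hle g hg.1 hg.2
    exact hl.csInf_eq.symm
  exact ⟨f, hf.1.1, hf.1.2, heq, fun g hg hg0 => heq ▸ hle g hg hg0⟩

theorem minSq_pos (D : Divisor k) : 0 < minSq D := by
  obtain ⟨f, -, h0, h, -⟩ := exists_minSq D
  exact h ▸ normSq_pos D h0

end Norms

end Arakelov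

/-! ### Coordinates on degree zero divisors, units and ideal classes. -/

namespace Arakelov

open NumberField.Units NumberField.Units.dirichletUnitTheorem
open scoped Classical

section Coordinates

variable {k : Type*} [Field k] [NumberField k]

theorem finNorm_zero : finNorm (0 : FinDivisor k) = 1 := by simp [finNorm]

theorem absNorm_eq_one_iff (D : Divisor k) :
    absNorm D = 1 ↔ D.2 w₀ =
      -(Real.log (finNorm D.1) + ∑ w : {w : InfinitePlace k // w ≠ w₀}, D.2 w) := by
  have h := finNorm_pos D.1
  rw [absNorm_eq, ← Real.exp_log h, ← Real.exp_add, Real.exp_eq_one_iff,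
    Fintype.sum_eq_add_sum_subtype_ne _ w₀, Real.log_exp]
  constructor <;> intro h <;> linarith

/-- The infinite component at the distinguished place of a divisor of degree zero. -/
noncomputable def extendPlace (t : FinDivisor k × logSpace k) (v : InfinitePlace k) : ℝ :=
  if h : v = w₀ then -(Real.log (finNorm t.1) + ∑ w, t.2 w) else t.2 ⟨v, h⟩

theorem extendPlace_w₀ (t : FinDivisor k × logSpace k) :
    extendPlace t w₀ = -(Real.log (finNorm t.1) + ∑ w, t.2 w) := by
  rw [extendPlace, dif_pos rfl]

theorem extendPlace_coe (t : FinDivisor k × logSpace k) (w : {w : InfinitePlace k // w ≠ w₀}) :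
    extendPlace t w = t.2 w := by
  rw [extendPlace, dif_neg w.2]

theorem continuous_extendPlace :
    Continuous (extendPlace : FinDivisor k × logSpace k → InfinitePlace k → ℝ) := by
  refine continuous_pi fun v => ?_
  by_cases h : v = w₀
  · subst h
    simp only [extendPlace_w₀]
    have : Continuous fun t : FinDivisor k × logSpace k => Real.log (finNorm t.1) :=
      (continuous_of_discreteTopology (f := fun d : FinDivisor k => Real.log (finNorm d))).comp
        continuous_fst
    fun_prop
  · simp only [fun t : FinDivisor k × logSpace k => extendPlace_coe t ⟨v, h⟩]
    fun_prop

theorem extendPlace_mem (t : FinDivisor k × logSpace k) :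
    ((t.1, extendPlace t) : Divisor k) ∈ DivisorZero k := by
  change absNorm _ = 1
  rw [absNorm_eq_one_iff]
  simp only [extendPlace_w₀, extendPlace_coe]

variable (k) in
/-- A divisor of degree zero is determined by its finite part and by its infinite components away
from a distinguished place. -/
noncomputable def coordEquiv : DivisorZero k ≃ₜ+ (FinDivisor k × logSpace k) where
  toFun D := (D.1.1, fun w => D.1.2 w)
  invFun t := ⟨(t.1, extendPlace t), extendPlace_mem t⟩
  left_inv D := by
    refine Subtype.ext (Prod.ext rfl (funext fun v => ?_))
    by_cases h : v = w₀
    · subst h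
      exact (extendPlace_w₀ _).trans ((absNorm_eq_one_iff D.1).mp D.2).symm
    · exact extendPlace_coe _ ⟨v, h⟩
  right_inv t := Prod.ext rfl (funext fun w => extendPlace_coe t w)
  map_add' D E := rfl
  continuous_toFun := by fun_prop
  continuous_invFun :=
    (continuous_fst.prodMk continuous_extendPlace).subtype_mk _

theorem coordEquiv_symm_snd (t : FinDivisor k × logSpace k) :
    ((coordEquiv k).symm t).1.2 = extendPlace t := rfl

instance : PolishSpace (DivisorZero k) :=
  (coordEquiv k).toHomeomorph.isClosedEmbedding.polishSpace

/-- The homomorphism to the divisors of degree zero induced by `div`. -/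
noncomputable def divZero : Additive kˣ →+ DivisorZero k :=
  div.codRestrict (DivisorZero k) fun g => absNorm_div g

theorem divZero_coe (g : Additive kˣ) : (divZero g : Divisor k) = div g := rfl

theorem mem_principal {D : DivisorZero k} : D ∈ principal k ↔ ∃ g, divZero g = D := by
  rw [principal, AddSubgroup.mem_addSubgroupOf]
  exact exists_congr fun g => ⟨fun h => Subtype.ext h, fun h => congrArg Subtype.val h⟩

theorem divZero_mem (g : Additive kˣ) : divZero g ∈ principal k := mem_principal.mpr ⟨g, rfl⟩

instance : Countable (Additive kˣ) := by
  have := countable_numberField k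
  exact (Units.val_injective (α := k)).countable

instance : Countable (principal k) :=
  Function.Surjective.countable (f := fun g : Additive kˣ => (⟨divZero g, divZero_mem g⟩ : principal k))
    fun ⟨D, hD⟩ => by
      obtain ⟨g, hg⟩ := mem_principal.mp hD
      exact ⟨g, Subtype.ext hg⟩

/-- The units of the ring of integers in the multiplicative group of the field. -/
noncomputable def unitsToField : Additive (𝓞 k)ˣ →+ Additive kˣ :=
  (Units.map (algebraMap (𝓞 k) k).toMonoidHom).toAdditive

omit [NumberField k] in
theorem unitsToField_coe (u : Additive (𝓞 k)ˣ) :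
    ((unitsToField u).toMul : k) = algebraMap (𝓞 k) k (u.toMul : 𝓞 k) := rfl

omit [NumberField k] in
theorem unitsToField_injective : Function.Injective (unitsToField (k := k)) := fun u v h => by
  have h1 : ((unitsToField u).toMul : k) = ((unitsToField v).toMul : k) := by rw [h]
  rw [unitsToField_coe, unitsToField_coe] at h1
  exact Additive.toMul.injective (Units.ext (RingOfIntegers.coe_injective h1))

theorem div_fst_eq_zero_iff (g : Additive kˣ) :
    (div g).1 = 0 ↔ ∃ u, unitsToField u = g := by
  have hone : ideal (0 : Divisor k) = 1 := by simp [ideal]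
  have hg : (g.toMul : k) ≠ 0 := g.toMul.ne_zero
  have h1 : (div g).1 = 0 ↔ FractionalIdeal.spanSingleton (𝓞 k)⁰ (g.toMul : k)⁻¹ = 1 := by
    rw [← ideal_div, ← hone]
    exact ⟨fun h => ideal_eq_of_fst_eq h, fun h => fst_eq_of_ideal_eq h⟩
  have hle : ∀ x : k, FractionalIdeal.spanSingleton (𝓞 k)⁰ x ≤ 1 ↔
      ∃ y : 𝓞 k, algebraMap (𝓞 k) k y = x := fun x => by
    rw [FractionalIdeal.spanSingleton_le_iff_mem, FractionalIdeal.mem_one_iff]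
  rw [h1]
  constructor
  · intro h
    obtain ⟨y, hy⟩ := (hle _).mp h.le
    have h' : FractionalIdeal.spanSingleton (𝓞 k)⁰ (g.toMul : k) = 1 := by
      rw [← inv_inj, FractionalIdeal.spanSingleton_inv, h, inv_one]
    obtain ⟨z, hz⟩ := (hle _).mp h'.le
    have hzy : z * y = 1 := RingOfIntegers.coe_injective (by
      rw [map_mul, hz, hy, mul_inv_cancel₀ hg, map_one])
    refine ⟨Additive.ofMul (Units.mkOfMulEqOne z y hzy), ?_⟩
    exact Additive.toMul.injective (Units.ext hz)
  · rintro ⟨u, rfl⟩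
    refine le_antisymm ((hle _).mpr ⟨((u.toMul⁻¹ : (𝓞 k)ˣ) : 𝓞 k), ?_⟩) ?_
    · rw [unitsToField_coe]
      refine eq_inv_of_mul_eq_one_left ?_
      rw [← map_mul, Units.inv_mul, map_one]
    · rw [FractionalIdeal.one_le, FractionalIdeal.mem_spanSingleton]
      refine ⟨(u.toMul : 𝓞 k), ?_⟩
      rw [Algebra.smul_def, ← unitsToField_coe, mul_inv_cancel₀ hg]

/-- The sign and the factors `e_v` in `div` match the logarithmic embedding, so the principal
divisors of units form the unit lattice. -/
theorem coordEquiv_divZero_unit_snd (u : Additive (𝓞 k)ˣ) :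
    (coordEquiv k (divZero (unitsToField u))).2 = -logEmbedding k u := by
  funext w
  rfl

theorem coordEquiv_divZero_unit_fst (u : Additive (𝓞 k)ˣ) :
    (coordEquiv k (divZero (unitsToField u))).1 = 0 :=
  (div_fst_eq_zero_iff _).mpr ⟨u, rfl⟩

theorem mem_unitLattice {x : logSpace k} : x ∈ unitLattice k ↔ ∃ u, logEmbedding k u = x := by
  rw [unitLattice, Submodule.mem_map]
  simp

/-- The ideal class of the finite part of a divisor. -/
noncomputable def divisorClass (d : FinDivisor k) : ClassGroup (𝓞 k) :=
  ClassGroup.mk k (Units.mk0 (ideal (d, 0)) (ideal_ne_zero _))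

theorem divisorClass_add (d e : FinDivisor k) :
    divisorClass (d + e) = divisorClass d * divisorClass e := by
  rw [divisorClass, divisorClass, divisorClass, ← map_mul, ← Units.mk0_mul]
  · congr 2
    rw [← ideal_add, Prod.mk_add_mk, add_zero]
  · rw [← ideal_add]
    exact ideal_ne_zero _

theorem divisorClass_eq_one_iff (d : FinDivisor k) :
    divisorClass d = 1 ↔ ∃ g, (div g).1 = d := by
  rw [divisorClass, ClassGroup.mk_eq_one_iff, Units.val_mk0, FractionalIdeal.isPrincipal_iff]
  constructor
  · rintro ⟨x, hx⟩
    have hx0 : x ≠ 0 := fun h => ideal_ne_zero (d, 0) (by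
      rw [hx, h, FractionalIdeal.spanSingleton_zero])
    refine ⟨Additive.ofMul (Units.mk0 x hx0)⁻¹, ?_⟩
    refine fst_eq_of_ideal_eq (E := (d, 0)) ?_
    rw [ideal_div, hx]
    simp
  · rintro ⟨g, rfl⟩
    exact ⟨_, (ideal_eq_of_fst_eq rfl).trans (ideal_div g)⟩

theorem divisorClass_eq_iff (d e : FinDivisor k) :
    divisorClass d = divisorClass e ↔ ∃ g, e = d + (div g).1 := by
  have h : divisorClass e = divisorClass d * divisorClass (e - d) := by
    rw [← divisorClass_add, add_sub_cancel]
  rw [h, left_eq_mul, divisorClass_eq_one_iff]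
  exact exists_congr fun g => by rw [eq_comm, sub_eq_iff_eq_add']

theorem divisorClass_surjective : Function.Surjective (divisorClass (k := k)) := fun c => by
  obtain ⟨J, rfl⟩ := ClassGroup.mk0_surjective c
  obtain ⟨d, hd⟩ := exists_ideal_eq (k := k) (I := FractionalIdeal.mk0 k J) (Units.ne_zero _)
  refine ⟨d, ?_⟩
  rw [divisorClass, ← ClassGroup.mk_mk0 k]
  congr 1
  exact Units.ext (hd 0)

end Coordinates

end Arakelov

/-! ### A fundamental domain of the principal divisors. -/

namespace Arakelov

open NumberField.Units NumberField.Units.dirichletUnitTheorem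
open scoped Classical

section FundamentalDomain

variable (k : Type*) [Field k] [NumberField k]

/-- The product of the counting measure and Lebesgue measure on the divisors of degree zero. -/
noncomputable def volumeZero : Measure (DivisorZero k) :=
  ((Measure.count : Measure (FinDivisor k)).prod (volume : Measure (logSpace k))).map
    (coordEquiv k).symm

theorem measurable_coordEquiv : Measurable (coordEquiv k) :=
  (coordEquiv k).toHomeomorph.measurable

theorem measurable_coordEquiv_symm : Measurable (coordEquiv k).symm :=
  (coordEquiv k).symm.toHomeomorph.measurable

instance : SigmaFinite (volumeZero k) :=
  ((coordEquiv k).symm.toHomeomorph.toMeasurableEquiv).sigmaFinite_map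

instance : (volumeZero k).IsAddLeftInvariant :=
  isAddLeftInvariant_map
    (((coordEquiv k).symm.toAddEquiv : (FinDivisor k × logSpace k) ≃+ DivisorZero k) :
      (FinDivisor k × logSpace k) →ₙ+ DivisorZero k)
    (measurable_coordEquiv_symm k) (coordEquiv k).symm.surjective

/-- The fundamental domain of the unit lattice spanned by a basis. -/
noncomputable def unitDomain : Set (logSpace k) :=
  ZSpan.fundamentalDomain ((basisUnitLattice k).ofZLatticeBasis ℝ (unitLattice k))

theorem measurableSet_unitDomain : MeasurableSet (unitDomain k) :=
  ZSpan.fundamentalDomain_measurableSet _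

theorem isBounded_unitDomain : Bornology.IsBounded (unitDomain k) :=
  ZSpan.fundamentalDomain_isBounded _

theorem existsUnique_add_mem_unitDomain (x : logSpace k) :
    ∃! v : logSpace k, v ∈ unitLattice k ∧ v + x ∈ unitDomain k := by
  obtain ⟨v, hv, huniq⟩ := ZSpan.exist_unique_vadd_mem_fundamentalDomain
    ((basisUnitLattice k).ofZLatticeBasis ℝ (unitLattice k)) x
  have hspan := Module.Basis.ofZLatticeBasis_span ℝ (unitLattice k) (basisUnitLattice k)
  refine ⟨v, ⟨hspan.le v.2, hv⟩, ?_⟩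
  rintro y ⟨hy, hyx⟩
  exact congrArg Subtype.val (huniq ⟨y, hspan.ge hy⟩ hyx)

/-- The regulator is by definition the covolume of the unit lattice in these coordinates, so no
constant intervenes. -/
theorem volume_unitDomain : volume (unitDomain k) = ENNReal.ofReal (regulator k) := by
  have h := ZLattice.covolume_eq_measure_fundamentalDomain (unitLattice k) volume
    (ZLattice.isAddFundamentalDomain (basisUnitLattice k) volume)
  have hreg : regulator k = volume.real (unitDomain k) := h
  rw [hreg, measureReal_def, ENNReal.ofReal_toReal]
  exact (isBounded_unitDomain k).measure_lt_top.ne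

/-- A system of representatives of the ideal classes. -/
noncomputable def classRep (c : ClassGroup (𝓞 k)) : FinDivisor k :=
  Function.surjInv divisorClass_surjective c

theorem divisorClass_classRep (c : ClassGroup (𝓞 k)) : divisorClass (classRep k c) = c :=
  Function.surjInv_eq divisorClass_surjective c

/-- A fundamental domain of the group of principal divisors. -/
def chowDomain : Set (DivisorZero k) :=
  coordEquiv k ⁻¹' (Set.range (classRep k) ×ˢ unitDomain k)

theorem measurableSet_chowDomain : MeasurableSet (chowDomain k) :=
  measurable_coordEquiv k (MeasurableSet.of_discrete.prod (measurableSet_unitDomain k))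

/-- There is one copy of the unit domain for each ideal class. The result is the prescribed total
mass, so unfolding needs no further constant. -/
theorem volumeZero_chowDomain :
    volumeZero k (chowDomain k) = ENNReal.ofReal (classNumber k * regulator k) := by
  rw [volumeZero, Measure.map_apply (measurable_coordEquiv_symm k) (measurableSet_chowDomain k)]
  have h : (coordEquiv k).symm ⁻¹' chowDomain k = Set.range (classRep k) ×ˢ unitDomain k := by
    ext t
    simp [chowDomain]
  have hinj : Function.Injective (classRep k) := Function.injective_surjInv _
  rw [h, Measure.prod_prod, volume_unitDomain, Measure.count_apply MeasurableSet.of_discrete,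
    ← Set.image_univ, hinj.encard_image, Set.encard_univ, ENat.card_eq_coe_fintype_card,
    ENNReal.ofReal_mul (Nat.cast_nonneg _), ENNReal.ofReal_natCast]
  rfl

/-- A suitable `div g` moves the finite part to the representative of its class; `g` is then
determined up to a unit, and the unit lattice fixes the remaining freedom exactly once. -/
theorem existsUnique_add_mem_chowDomain (D : DivisorZero k) :
    ∃! γ : principal k, (D + γ : DivisorZero k) ∈ chowDomain k := by
  have hcls := divisorClass_classRep k (divisorClass D.1.1)
  obtain ⟨g, hg⟩ := (divisorClass_eq_iff _ _).mp hcls.symm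
  obtain ⟨v, ⟨hv, hvx⟩, -⟩ :=
    existsUnique_add_mem_unitDomain k (coordEquiv k (D + divZero g)).2
  obtain ⟨u, rfl⟩ := mem_unitLattice.mp hv
  refine ⟨⟨divZero (g - unitsToField u), divZero_mem _⟩, ?_, ?_⟩
  · change coordEquiv k (D + divZero (g - unitsToField u)) ∈ Set.range (classRep k) ×ˢ unitDomain k
    rw [map_sub, add_sub, map_sub]
    refine ⟨⟨divisorClass D.1.1, ?_⟩, ?_⟩
    · rw [Prod.fst_sub, coordEquiv_divZero_unit_fst, sub_zero]
      exact hg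
    · rw [Prod.snd_sub, coordEquiv_divZero_unit_snd, sub_neg_eq_add, add_comm]
      exact hvx
  · rintro ⟨γ, hγ⟩ hmem
    obtain ⟨g', rfl⟩ := mem_principal.mp hγ
    have hmem' : coordEquiv k (D + divZero g') ∈ Set.range (classRep k) ×ˢ unitDomain k := hmem
    obtain ⟨c, hc⟩ := hmem'.1
    have hc' : classRep k c = D.1.1 + (div g').1 := hc
    have hcc : c = divisorClass D.1.1 := by
      rw [← divisorClass_classRep k c]
      exact ((divisorClass_eq_iff _ _).mpr ⟨g', hc'⟩).symm
    rw [hcc, hg] at hc'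
    have hdiff : (div (g' - g)).1 = 0 := by
      rw [map_sub, Prod.fst_sub, ← add_left_cancel hc', sub_self]
    obtain ⟨u', hu'⟩ := (div_fst_eq_zero_iff _).mp hdiff
    have hg' : g' = g - unitsToField (-u') := by
      rw [map_neg, hu']
      abel
    have hvx' : logEmbedding k (-u') + (coordEquiv k (D + divZero g)).2 ∈ unitDomain k := by
      have h2 := hmem'.2
      rw [hg', map_sub, add_sub, map_sub, Prod.snd_sub, coordEquiv_divZero_unit_snd,
        sub_neg_eq_add, add_comm] at h2
      exact h2
    have heq := (existsUnique_add_mem_unitDomain k (coordEquiv k (D + divZero g)).2).unique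
      ⟨mem_unitLattice.mpr ⟨u, rfl⟩, hvx⟩ ⟨mem_unitLattice.mpr ⟨-u', rfl⟩, hvx'⟩
    refine Subtype.ext ((coordEquiv k).injective ?_)
    change coordEquiv k (divZero g') = coordEquiv k (divZero (g - unitsToField u))
    rw [hg', map_sub, map_sub, map_sub, map_sub]
    congr 1
    refine Prod.ext ?_ ?_
    · rw [coordEquiv_divZero_unit_fst, coordEquiv_divZero_unit_fst]
    · rw [coordEquiv_divZero_unit_snd, coordEquiv_divZero_unit_snd, heq]

theorem isAddFundamentalDomain_chowDomain :
    IsAddFundamentalDomain (principal k).op (chowDomain k) (volumeZero k) := by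
  refine IsAddFundamentalDomain.mk' (measurableSet_chowDomain k).nullMeasurableSet fun D => ?_
  obtain ⟨γ, hγ, huniq⟩ := existsUnique_add_mem_chowDomain k D
  refine ⟨(principal k).equivOp γ, hγ, fun γ' hγ' => ?_⟩
  rw [← huniq ((principal k).equivOp.symm γ') hγ', Equiv.apply_symm_apply]

/-- A principal divisor close to `0` has trivial finite part, so it comes from a unit, and the unit
lattice is discrete; discrete subgroups are closed. -/
theorem isClosed_principal : IsClosed (principal k : Set (DivisorZero k)) := by
  have hdisc : DiscreteTopology (principal k) := by
    refine discreteTopology_of_isOpen_singleton_zero ?_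
    obtain ⟨U, hU, hU0⟩ := isOpen_induced_iff.mp
      (isOpen_discrete ({0} : Set (unitLattice k)))
    have heq : ({0} : Set (principal k)) =
        (fun γ : principal k => coordEquiv k γ) ⁻¹' ({0} ×ˢ U) := by
      ext ⟨γ, hγ⟩
      obtain ⟨g, rfl⟩ := mem_principal.mp hγ
      constructor
      · intro h
        have h' : divZero g = 0 := congrArg Subtype.val h
        have h0 : (0 : logSpace k) ∈ U := by
          have : (0 : unitLattice k) ∈ Subtype.val ⁻¹' U := hU0 ▸ rfl
          exact this
        change coordEquiv k (divZero g) ∈ ({0} : Set (FinDivisor k)) ×ˢ U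
        rw [h', map_zero]
        exact ⟨rfl, h0⟩
      · rintro ⟨h1, h2⟩
        obtain ⟨u, rfl⟩ := (div_fst_eq_zero_iff g).mp h1
        change (coordEquiv k (divZero (unitsToField u))).2 ∈ U at h2
        rw [coordEquiv_divZero_unit_snd] at h2
        have hmem : -logEmbedding k u ∈ unitLattice k :=
          mem_unitLattice.mpr ⟨-u, map_neg _ _⟩
        have h3 : (⟨_, hmem⟩ : unitLattice k) ∈ ({0} : Set (unitLattice k)) := by
          rw [← hU0]
          exact h2
        have h4 : -logEmbedding k u = 0 := congrArg Subtype.val h3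
        refine Subtype.ext ((coordEquiv k).injective ?_)
        change coordEquiv k (divZero (unitsToField u)) = coordEquiv k 0
        rw [map_zero]
        refine Prod.ext (coordEquiv_divZero_unit_fst u) ?_
        rw [coordEquiv_divZero_unit_snd, h4]
        rfl
    rw [heq]
    exact ((isOpen_discrete {0}).prod hU).preimage
      ((coordEquiv k).continuous.comp continuous_subtype_val)
  exact AddSubgroup.isClosed_of_discrete

instance : CompactSpace (ChowZero k) := by
  have hK : IsCompact ((coordEquiv k).symm ''
      (Set.range (classRep k) ×ˢ closure (unitDomain k))) :=
    (((Set.finite_range (classRep k)).isCompact.prod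
      (isBounded_unitDomain k).isCompact_closure)).image (coordEquiv k).symm.continuous
  have himg := hK.image (QuotientAddGroup.continuous_mk (N := principal k))
  refine ⟨himg.of_isClosed_subset isClosed_univ fun x _ => ?_⟩
  obtain ⟨D, rfl⟩ := QuotientAddGroup.mk_surjective x
  obtain ⟨γ, hγ, -⟩ := existsUnique_add_mem_chowDomain k D
  refine ⟨D + γ, ⟨coordEquiv k (D + γ), ⟨hγ.1, subset_closure hγ.2⟩,
    (coordEquiv k).symm_apply_apply _⟩, ?_⟩
  exact QuotientAddGroup.mk_add_of_mem D γ.2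

theorem haar_univ : haar k Set.univ = ENNReal.ofReal (classNumber k * regulator k) := by
  rw [haar, Measure.smul_apply, smul_eq_mul, ENNReal.div_mul_cancel]
  · exact (Measure.measure_univ_pos.mpr (NeZero.ne _)).ne'
  · exact (isCompact_univ.measure_lt_top).ne

instance : IsFiniteMeasure (haar k) := ⟨by rw [haar_univ]; exact ENNReal.ofReal_lt_top⟩

instance : (haar k).IsAddLeftInvariant := by
  unfold haar
  infer_instance

end FundamentalDomain

end Arakelov

/-! ### Divisors with shortest vector `1`, and their periodization. -/

namespace Arakelov

open NumberField.Units NumberField.Units.dirichletUnitTheorem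
open scoped Classical

section MinDomain

variable {k : Type*} [Field k] [NumberField k]

theorem divZero_eq_zero_iff (g : Additive kˣ) :
    divZero g = 0 ↔ ∃ ζ : torsion k, unitsToField (Additive.ofMul (ζ : (𝓞 k)ˣ)) = g := by
  constructor
  · intro h
    have h1 : (div g).1 = 0 := congrArg (fun D : DivisorZero k => D.1.1) h
    obtain ⟨u, rfl⟩ := (div_fst_eq_zero_iff g).mp h1
    have h2 := coordEquiv_divZero_unit_snd u
    rw [h, map_zero, Prod.snd_zero, zero_eq_neg] at h2
    exact ⟨⟨u.toMul, logEmbedding_eq_zero_iff.mp h2⟩, rfl⟩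
  · rintro ⟨ζ, rfl⟩
    refine (coordEquiv k).injective ?_
    rw [map_zero]
    refine Prod.ext (coordEquiv_divZero_unit_fst _) ?_
    rw [coordEquiv_divZero_unit_snd, logEmbedding_eq_zero_iff.mpr ζ.2, neg_zero]
    rfl

theorem ncard_divZero_fiber (g₀ : Additive kˣ) :
    {g : Additive kˣ | divZero g = divZero g₀}.ncard = torsionOrder k := by
  have hinj : Function.Injective fun ζ : torsion k =>
      g₀ + unitsToField (Additive.ofMul (ζ : (𝓞 k)ˣ)) := fun ζ ξ h =>
    Subtype.ext (Additive.ofMul.injective (unitsToField_injective (add_left_cancel h)))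
  have heq : {g : Additive kˣ | divZero g = divZero g₀} = Set.range fun ζ : torsion k =>
      g₀ + unitsToField (Additive.ofMul (ζ : (𝓞 k)ˣ)) := by
    ext g
    rw [Set.mem_range, Set.mem_ofPred_eq, ← sub_eq_zero, ← map_sub, divZero_eq_zero_iff]
    exact exists_congr fun ζ => eq_sub_iff_add_eq'
  rw [heq, ← Set.image_univ, Set.ncard_image_of_injective _ hinj, Set.ncard_univ]
  rfl

variable (k) in
/-- The divisors of degree zero for which `1` is a shortest nonzero vector. -/
def minDomain : Set (DivisorZero k) :=
  {D | (1 : k) ∈ ideal D.1 ∧ ∀ f ∈ ideal D.1, f ≠ 0 → normSq D.1 1 ≤ normSq D.1 f}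

theorem mem_minDomain_iff {D : DivisorZero k} :
    D ∈ minDomain k ↔ (1 : k) ∈ ideal D.1 ∧ normSq D.1 1 = minSq D.1 := by
  obtain ⟨f, hf, hf0, heq, hmin⟩ := exists_minSq D.1
  refine and_congr_right fun h1 => ⟨fun h => ?_, fun h g hg hg0 => h ▸ hmin g hg hg0⟩
  exact le_antisymm (heq ▸ h f hf hf0) (hmin 1 h1 one_ne_zero)

theorem add_divZero_mem_minDomain_iff (D : DivisorZero k) (g : Additive kˣ) :
    D + divZero g ∈ minDomain k ↔
      (g.toMul : k) ∈ ideal D.1 ∧ normSq D.1 (g.toMul : k) = minSq D.1 := by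
  rw [mem_minDomain_iff, AddSubgroup.coe_add, divZero_coe, mem_ideal_add_div, normSq_add_div,
    minSq_add_div, one_mul]

/-- Translation by `div g` carries the vector `g` of `I(D)` to `1`, so shortest vectors correspond
to translations into `minDomain`. Zero is not counted, as the minimum is positive. -/
theorem kissing_eq_ncard (D : DivisorZero k) :
    kissing D.1 = {g : Additive kˣ | D + divZero g ∈ minDomain k}.ncard := by
  have hinj : Function.Injective fun g : Additive kˣ => (g.toMul : k) := fun g h hgh =>
    Additive.toMul.injective (Units.ext hgh)
  rw [← Set.ncard_image_of_injective _ hinj, kissing]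
  congr 1
  ext f
  constructor
  · rintro ⟨hf, hmin⟩
    have hf0 : f ≠ 0 := by
      rintro rfl
      have := minSq_pos D.1
      rw [← hmin, normSq_eq] at this
      simp at this
    exact ⟨Additive.ofMul (Units.mk0 f hf0),
      (add_divZero_mem_minDomain_iff _ _).mpr ⟨hf, hmin⟩, rfl⟩
  · rintro ⟨g, hg, rfl⟩
    exact (add_divZero_mem_minDomain_iff _ _).mp hg

theorem finite_add_divZero_mem (D : DivisorZero k) :
    {g : Additive kˣ | D + divZero g ∈ minDomain k}.Finite := by
  have hinj : Function.Injective fun g : Additive kˣ => (g.toMul : k) := fun g h hgh =>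
    Additive.toMul.injective (Units.ext hgh)
  refine Set.Finite.of_finite_image ((finite_normSq_le D.1 (minSq D.1)).subset ?_) hinj.injOn
  rintro _ ⟨g, hg, rfl⟩
  have := (add_divZero_mem_minDomain_iff _ _).mp hg
  exact ⟨this.1, this.2.le⟩

/-- Two elements have the same divisor exactly when they differ by a root of unity, so each
translate in `minDomain` accounts for `|μ(k)|` shortest vectors. -/
theorem exists_finset_principal (D : DivisorZero k) : ∃ A : Finset (principal k),
    (∀ γ : principal k, γ ∈ A ↔ (D + γ : DivisorZero k) ∈ minDomain k) ∧
      kissing D.1 = A.card * torsionOrder k := by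
  set S := (finite_add_divZero_mem D).toFinset with hS
  have hmemS : ∀ g, g ∈ S ↔ D + divZero g ∈ minDomain k := fun g => Set.Finite.mem_toFinset _
  set q : Additive kˣ → principal k := fun g => ⟨divZero g, divZero_mem g⟩ with hq
  refine ⟨S.image q, ?_, ?_⟩
  · rintro ⟨γ, hγ⟩
    obtain ⟨g, rfl⟩ := mem_principal.mp hγ
    rw [Finset.mem_image]
    constructor
    · rintro ⟨g', hg', h⟩
      have h' : divZero g' = divZero g := congrArg Subtype.val h
      change D + divZero g ∈ _
      rw [← h']
      exact (hmemS _).mp hg'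
    · intro h
      exact ⟨g, (hmemS _).mpr h, rfl⟩
  · rw [kissing_eq_ncard, Set.ncard_eq_toFinset_card _ (finite_add_divZero_mem D), ← hS,
      Finset.card_eq_sum_card_image q S, ← smul_eq_mul, ← Finset.sum_const]
    refine Finset.sum_congr rfl fun γ hγ => ?_
    obtain ⟨g₀, hg₀, rfl⟩ := Finset.mem_image.mp hγ
    rw [← ncard_divZero_fiber g₀, ← Set.ncard_coe_finset]
    congr 1
    ext g
    simp only [Finset.coe_filter, Set.mem_ofPred_eq]
    constructor
    · rintro ⟨-, h⟩
      exact congrArg Subtype.val h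
    · intro h
      refine ⟨(hmemS _).mpr ?_, Subtype.ext h⟩
      rw [h]
      exact (hmemS _).mp hg₀

/-- The function on divisors of degree zero whose periodization is `ν · a ^ (-s)`. -/
noncomputable def minDensity (s : ℂ) : DivisorZero k → ℂ :=
  (minDomain k).indicator fun D => (torsionOrder k : ℂ) * (normSq D.1 1 : ℂ) ^ (-s)

theorem hasSum_minDensity (s : ℂ) (D : DivisorZero k) :
    HasSum (fun γ : principal k => minDensity s (D + γ : DivisorZero k))
      ((ν k (D : ChowZero k) : ℂ) * (a k (D : ChowZero k) : ℂ) ^ (-s)) := by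
  obtain ⟨A, hA, hcard⟩ := exists_finset_principal D
  have h : HasSum (fun γ : principal k => minDensity s (D + γ : DivisorZero k))
      (∑ γ ∈ A, minDensity s (D + γ : DivisorZero k)) :=
    hasSum_sum_of_ne_finset_zero fun γ hγ =>
      Set.indicator_of_notMem (fun h => hγ ((hA γ).mpr h)) _
  convert h using 1
  change (kissing D.1 : ℂ) * (minSq D.1 : ℂ) ^ (-s) = _
  rw [hcard, Nat.cast_mul, mul_assoc, ← nsmul_eq_mul, ← Finset.sum_const]
  refine Finset.sum_congr rfl fun γ hγ => ?_
  have hmem := (hA γ).mp hγ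
  obtain ⟨g, hg⟩ := mem_principal.mp γ.2
  rw [minDensity, Set.indicator_of_mem hmem, (mem_minDomain_iff.mp hmem).2, AddSubgroup.coe_add,
    ← hg, divZero_coe, minSq_add_div]

theorem isClosed_minDomain : IsClosed (minDomain k) := by
  have hfin : ∀ f : k, IsClopen {D : DivisorZero k | f ∈ ideal D.1} := fun f => by
    have h : {D : DivisorZero k | f ∈ ideal D.1} =
        (fun D : DivisorZero k => D.1.1) ⁻¹' {d | f ∈ ideal ((d, 0) : Divisor k)} := by
      ext D
      change f ∈ ideal D.1 ↔ f ∈ ideal ((D.1.1, 0) : Divisor k)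
      rw [ideal_eq_of_fst_eq (D := D.1) (E := ((D.1.1, 0) : Divisor k)) rfl]
    rw [h]
    exact (isClopen_discrete _).preimage (by fun_prop)
  have heq : minDomain k = {D : DivisorZero k | (1 : k) ∈ ideal D.1} ∩ ⋂ f : k, ⋂ _ : f ≠ 0,
      ({D : DivisorZero k | f ∈ ideal D.1}ᶜ ∪ {D | normSq D.1 1 ≤ normSq D.1 f}) := by
    ext D
    simp only [minDomain, Set.mem_ofPred_eq, Set.mem_inter_iff, Set.mem_iInter, Set.mem_union,
      Set.mem_compl_iff]
    refine and_congr_right fun _ => forall_congr' fun f => ?_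
    tauto
  rw [heq]
  refine (hfin 1).1.inter (isClosed_iInter fun f => isClosed_iInter fun _ =>
    (hfin f).compl.1.union ?_)
  exact isClosed_le ((continuous_normSq 1).comp continuous_subtype_val)
    ((continuous_normSq f).comp continuous_subtype_val)

theorem continuous_normSq_cpow (s : ℂ) :
    Continuous fun D : DivisorZero k => (torsionOrder k : ℂ) * (normSq D.1 1 : ℂ) ^ (-s) := by
  refine continuous_const.mul (Continuous.cpow ?_ continuous_const fun D => Or.inl ?_)
  · exact Complex.continuous_ofReal.comp ((continuous_normSq 1).comp continuous_subtype_val)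
  · exact_mod_cast normSq_pos D.1 one_ne_zero

theorem measurable_minDensity (s : ℂ) : Measurable (minDensity (k := k) s) :=
  (continuous_normSq_cpow s).measurable.indicator isClosed_minDomain.measurableSet

variable (k) in
-- The minimum is invariant under principal divisors, so a compact set of representatives suffices.
-- Near a given `D` the finite part is constant, and the length of one fixed nonzero vector bounds
-- the minimum.
theorem exists_minSq_le : ∃ B : ℝ, 1 ≤ B ∧ ∀ D : DivisorZero k, minSq D.1 ≤ B := by
  have hK : IsCompact ((coordEquiv k).symm ''
      (Set.range (classRep k) ×ˢ closure (unitDomain k))) :=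
    (((Set.finite_range (classRep k)).isCompact.prod
      (isBounded_unitDomain k).isCompact_closure)).image (coordEquiv k).symm.continuous
  set K := (coordEquiv k).symm '' (Set.range (classRep k) ×ˢ closure (unitDomain k)) with hKdef
  have hb : ∃ B : ℝ, ∀ D ∈ K, minSq D.1 ≤ B := by
    refine hK.induction_on ⟨0, by simp⟩
      (fun s t hst ⟨B, hB⟩ => ⟨B, fun D hD => hB D (hst hD)⟩)
      (fun s t ⟨B, hB⟩ ⟨B', hB'⟩ => ⟨max B B', fun D hD => hD.elim
        (fun h => (hB D h).trans (le_max_left _ _)) fun h => (hB' D h).trans (le_max_right _ _)⟩)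
      fun D _ => ?_
    obtain ⟨f, hf, hf0⟩ := exists_mem_ideal_ne_zero D.1
    have h1 : ∀ᶠ E : DivisorZero k in 𝓝 D, E.1.1 = D.1.1 := by
      have hc : Continuous fun E : DivisorZero k => E.1.1 := by fun_prop
      exact hc.continuousAt.eventually (IsOpen.mem_nhds (isOpen_discrete {D.1.1}) rfl)
    have h2 : ∀ᶠ E : DivisorZero k in 𝓝 D, normSq E.1 f < normSq D.1 f + 1 :=
      ((continuous_normSq f).comp continuous_subtype_val).continuousAt.eventually
        (Iio_mem_nhds (lt_add_one _))
    refine ⟨_, mem_nhdsWithin_of_mem_nhds (h1.and h2), normSq D.1 f + 1, fun E hE => ?_⟩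
    obtain ⟨-, -, -, -, hmin⟩ := exists_minSq E.1
    exact (hmin f (ideal_eq_of_fst_eq hE.1 ▸ hf) hf0).trans hE.2.le
  obtain ⟨B, hB⟩ := hb
  refine ⟨max 1 B, le_max_left _ _, fun D => ?_⟩
  obtain ⟨γ, hγ, -⟩ := existsUnique_add_mem_chowDomain k D
  obtain ⟨g, hg⟩ := mem_principal.mp γ.2
  have h := hB (D + γ) ⟨coordEquiv k (D + γ), ⟨hγ.1, subset_closure hγ.2⟩,
    (coordEquiv k).symm_apply_apply _⟩
  rw [AddSubgroup.coe_add, ← hg, divZero_coe, minSq_add_div] at h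
  exact h.trans (le_max_right _ _)

/-- A divisor of degree zero with `1 ∈ I(D)` comes from an integral ideal. -/
theorem exists_ideal_inv_eq {D : Divisor k} (h1 : (1 : k) ∈ ideal D) :
    ∃ J : Ideal (𝓞 k), (J : FractionalIdeal (𝓞 k)⁰ k) = (ideal D)⁻¹ ∧
      (Ideal.absNorm J : ℝ) = finNorm D.1 := by
  have hI := ideal_ne_zero D
  obtain ⟨J, hJ⟩ : ∃ J : Ideal (𝓞 k), (J : FractionalIdeal (𝓞 k)⁰ k) = (ideal D)⁻¹ := by
    rw [← FractionalIdeal.le_one_iff_exists_coeIdeal]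
    calc (ideal D)⁻¹ = 1 * (ideal D)⁻¹ := (one_mul _).symm
      _ ≤ ideal D * (ideal D)⁻¹ := by
          gcongr
          rwa [FractionalIdeal.one_le]
      _ = 1 := mul_inv_cancel₀ hI
  refine ⟨J, hJ, ?_⟩
  have h := congrArg (fun x => ((FractionalIdeal.absNorm x : ℚ) : ℝ)) hJ
  simpa only [map_inv₀, FractionalIdeal.coeIdeal_absNorm, Rat.cast_inv, absNorm_ideal, inv_inv,
    Rat.cast_natCast] using h

theorem one_le_finNorm {D : Divisor k} (h1 : (1 : k) ∈ ideal D) : 1 ≤ finNorm D.1 := by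
  obtain ⟨J, -, hJ⟩ := exists_ideal_inv_eq h1
  have h := finNorm_pos D.1
  rw [← hJ] at h ⊢
  exact_mod_cast h

theorem two_le_finNorm {D : Divisor k} (h1 : (1 : k) ∈ ideal D) (hD : D.1 ≠ 0) :
    2 ≤ finNorm D.1 := by
  obtain ⟨J, hJI, hJ⟩ := exists_ideal_inv_eq h1
  have h := finNorm_pos D.1
  rw [← hJ] at h ⊢
  have hne : Ideal.absNorm J ≠ 1 := fun h1 => by
    rw [Ideal.absNorm_eq_one_iff] at h1
    rw [h1, FractionalIdeal.coeIdeal_top, ← ideal_neg] at hJI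
    have h2 := fst_eq_of_ideal_eq (D := (0 : Divisor k)) (E := -D) (by rw [← hJI]; simp [ideal])
    exact hD (neg_eq_zero.mp h2.symm)
  have h3 : 0 < Ideal.absNorm J := by exact_mod_cast h
  exact_mod_cast (by omega : 2 ≤ Ideal.absNorm J)

/-- Such `d` correspond injectively to integral ideals of norm at most `M`, of which there are
finitely many. -/
theorem finite_finNorm_le (M : ℝ) :
    {d : FinDivisor k | (1 : k) ∈ ideal ((d, 0) : Divisor k) ∧ finNorm d ≤ M}.Finite := by
  have hex : ∀ d : FinDivisor k, ∃ J : Ideal (𝓞 k), (1 : k) ∈ ideal ((d, 0) : Divisor k) →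
      (J : FractionalIdeal (𝓞 k)⁰ k) = (ideal (d, 0))⁻¹ ∧ (Ideal.absNorm J : ℝ) = finNorm d := by
    intro d
    by_cases h : (1 : k) ∈ ideal ((d, 0) : Divisor k)
    · obtain ⟨J, hJ⟩ := exists_ideal_inv_eq h
      exact ⟨J, fun _ => hJ⟩
    · exact ⟨⊥, fun h' => absurd h' h⟩
  choose J hJ using hex
  refine Set.Finite.of_finite_image (f := J)
    ((Ideal.finite_setOfPred_absNorm_le (S := 𝓞 k) ⌊M⌋₊).subset ?_) ?_
  · rintro _ ⟨d, ⟨h1, h2⟩, rfl⟩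
    refine Nat.le_floor ?_
    rw [(hJ d h1).2]
    exact h2
  · rintro d ⟨hd, -⟩ e ⟨he, -⟩ h
    have h' : (J d : FractionalIdeal (𝓞 k)⁰ k) = J e := by rw [h]
    rw [(hJ d hd).1, (hJ e he).1, inv_inj] at h'
    exact fst_eq_of_ideal_eq h'

end MinDomain

end Arakelov

/-! ### Compactness of `minDomain` and `C` as a finite sum. -/

namespace Arakelov

open NumberField.Units NumberField.Units.dirichletUnitTheorem
open scoped Classical

section FiniteSum

variable (k : Type*) [Field k] [NumberField k]

/-- The bound `‖1‖²_D ≤ B` forces `x_v ≥ -log B` at every place. Since the degree is zero and the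
finite norm is at least `1`, the sum of the `x_v` is `-log` of that norm and is nonpositive, which
bounds the `x_v` from above and the finite norm as well. -/
theorem exists_bound_minDomain : ∃ c : ℝ, 0 ≤ c ∧ ∀ D ∈ minDomain k,
    (∀ v, |D.1.2 v| ≤ c) ∧ finNorm D.1.1 ≤ Real.exp c ∧ normSq D.1 1 ≤ Real.exp c := by
  obtain ⟨B, hB1, hB⟩ := exists_minSq_le k
  have hlog : 0 ≤ Real.log B := Real.log_nonneg hB1
  have hB0 : 0 < B := one_pos.trans_le hB1
  set N := Fintype.card (InfinitePlace k) with hN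
  have hN1 : (1 : ℝ) ≤ N := by exact_mod_cast Fintype.card_pos
  have hc : Real.log B ≤ N * Real.log B := le_mul_of_one_le_left hlog hN1
  refine ⟨N * Real.log B, by positivity, fun D hD => ?_⟩
  have hmin := mem_minDomain_iff.mp hD
  have hle : normSq D.1 1 ≤ B := hmin.2 ▸ hB D
  have hlow : ∀ v, -Real.log B ≤ D.1.2 v := fun v => by
    have h1 : (v.mult : ℝ) * v (1 : k) ^ 2 * Real.exp (-(2 / (v.mult : ℝ)) * D.1.2 v) ≤ B := by
      refine le_trans ?_ hle
      rw [normSq_eq]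
      exact Finset.single_le_sum (f := fun v : InfinitePlace k => (v.mult : ℝ) * v (1 : k) ^ 2 *
        Real.exp (-(2 / (v.mult : ℝ)) * D.1.2 v)) (fun v _ => by positivity) (Finset.mem_univ v)
    have hm : (1 : ℝ) ≤ v.mult := by exact_mod_cast InfinitePlace.mult_pos
    have hm2 : (v.mult : ℝ) ≤ 2 := by
      rw [InfinitePlace.mult]
      split_ifs <;> norm_num
    rw [map_one, one_pow, mul_one] at h1
    have h2 : Real.exp (-(2 / (v.mult : ℝ)) * D.1.2 v) ≤ B :=
      (le_mul_of_one_le_left (Real.exp_pos _).le hm).trans h1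
    rw [← Real.le_log_iff_exp_le hB0] at h2
    have h3 : -(2 / (v.mult : ℝ)) * D.1.2 v * v.mult = -2 * D.1.2 v := by field_simp
    have h4 := mul_le_mul_of_nonneg_right h2 (zero_le_one.trans hm)
    rw [h3] at h4
    nlinarith
  have hsum : ∑ v, D.1.2 v = -Real.log (finNorm D.1.1) := by
    have h := D.2
    change absNorm D.1 = 1 at h
    rw [absNorm_eq_one_iff] at h
    rw [Fintype.sum_eq_add_sum_subtype_ne _ w₀, h]
    ring
  have hfin := Real.log_nonneg (one_le_finNorm hmin.1)
  have hcard : ∀ v, D.1.2 v - Real.log B * (N - 1) ≤ ∑ v, D.1.2 v := fun v => by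
    rw [← Finset.add_sum_erase _ _ (Finset.mem_univ v), sub_eq_add_neg]
    refine add_le_add_right ?_ _
    have := Finset.card_nsmul_le_sum (Finset.univ.erase v) (fun v => D.1.2 v) (-Real.log B)
      fun w _ => hlow w
    rw [Finset.card_erase_of_mem (Finset.mem_univ v), Finset.card_univ, nsmul_eq_mul,
      Nat.cast_sub Fintype.card_pos, ← hN] at this
    push_cast at this
    linarith
  refine ⟨fun v => abs_le.mpr ⟨by linarith [hlow v], ?_⟩, ?_, ?_⟩
  · have := hcard v
    rw [hsum] at this
    nlinarith
  · rw [← Real.log_le_iff_le_exp (finNorm_pos _)]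
    have := Finset.card_nsmul_le_sum Finset.univ (fun v => D.1.2 v) (-Real.log B)
      fun w _ => hlow w
    rw [hsum, Finset.card_univ, nsmul_eq_mul, ← hN] at this
    linarith
  · refine hle.trans ?_
    rw [← Real.log_le_iff_le_exp hB0]
    exact hc

variable {k} in
/-- The slice of `minDomain` with given finite part. -/
def slice (d : FinDivisor k) : Set (logSpace k) :=
  {x | (coordEquiv k).symm (d, x) ∈ minDomain k}

variable {k}

theorem isCompact_slice (d : FinDivisor k) : IsCompact (slice d) := by
  obtain ⟨c, hc, hb⟩ := exists_bound_minDomain k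
  refine Metric.isCompact_of_isClosed_isBounded
    (isClosed_minDomain.preimage ((coordEquiv k).symm.continuous.comp (by fun_prop)))
    ((Metric.isBounded_closedBall (x := (0 : logSpace k)) (r := c)).subset fun x hx => ?_)
  rw [mem_closedBall_zero_iff, pi_norm_le_iff_of_nonneg hc]
  intro w
  have := (hb _ hx).1 w
  rw [coordEquiv_symm_snd, extendPlace_coe] at this
  exact this

theorem continuous_slice_cpow (d : FinDivisor k) (s : ℂ) : Continuous fun x : logSpace k =>
    (torsionOrder k : ℂ) * (normSq ((coordEquiv k).symm (d, x)).1 1 : ℂ) ^ (-s) :=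
  (continuous_normSq_cpow s).comp ((coordEquiv k).symm.continuous.comp (by fun_prop))

theorem minDensity_slice (s : ℂ) (d : FinDivisor k) :
    (fun x : logSpace k => minDensity s ((coordEquiv k).symm (d, x))) = (slice d).indicator
      fun x => (torsionOrder k : ℂ) * (normSq ((coordEquiv k).symm (d, x)).1 1 : ℂ) ^ (-s) := by
  funext x
  rfl

variable (k)

/-- The finite parts of the divisors of degree zero having `1` as a shortest nonzero vector. -/
theorem exists_finset_slice : ∃ S : Finset (FinDivisor k), 0 ∈ S ∧
    (∀ d ∈ S, (1 : k) ∈ ideal ((d, 0) : Divisor k)) ∧ ∀ d ∉ S, slice d = ∅ := by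
  obtain ⟨c, hc, hb⟩ := exists_bound_minDomain k
  refine ⟨(finite_finNorm_le (k := k) (Real.exp c)).toFinset, ?_, ?_, ?_⟩
  · rw [Set.Finite.mem_toFinset]
    refine ⟨?_, ?_⟩
    · have : ideal ((0, 0) : Divisor k) = 1 := by simp [ideal]
      rw [this]
      exact FractionalIdeal.one_mem_one _
    · rw [finNorm_zero]
      exact Real.one_le_exp hc
  · intro d hd
    exact ((Set.Finite.mem_toFinset _).mp hd).1
  · intro d hd
    rw [Set.eq_empty_iff_forall_notMem]
    intro x hx
    refine hd ((Set.Finite.mem_toFinset _).mpr ⟨?_, (hb _ hx).2.1⟩)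
    rw [ideal_eq_of_fst_eq (D := ((d, 0) : Divisor k)) (E := ((coordEquiv k).symm (d, x)).1) rfl]
    exact (mem_minDomain_iff.mp hx).1

variable {k}

theorem integrable_minDensity (s : ℂ) : Integrable (minDensity (k := k) s) (volumeZero k) ∧
    ∀ S : Finset (FinDivisor k), (∀ d ∉ S, slice d = ∅) →
      ∫ D, minDensity s D ∂volumeZero k = ∑ d ∈ S, ∫ x in slice d,
        (torsionOrder k : ℂ) * (normSq ((coordEquiv k).symm (d, x)).1 1 : ℂ) ^ (-s) := by
  set e := (coordEquiv k).symm.toHomeomorph.toMeasurableEquiv with he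
  have hmap : volumeZero k = Measure.map e (Measure.count.prod volume) := rfl
  have hint : ∀ d : FinDivisor k, Integrable fun x : logSpace k =>
      minDensity s ((coordEquiv k).symm (d, x)) := fun d => by
    rw [minDensity_slice, integrable_indicator_iff (isCompact_slice d).measurableSet]
    exact (continuous_slice_cpow d s).continuousOn.integrableOn_compact (isCompact_slice d)
  obtain ⟨S₀, -, -, hS₀⟩ := exists_finset_slice k
  have hzero : ∀ d : FinDivisor k, slice d = ∅ →
      (fun x : logSpace k => minDensity s ((coordEquiv k).symm (d, x))) = fun _ => 0 := fun d hd => by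
    rw [minDensity_slice, hd, Set.indicator_empty]
  have hprod : Integrable (fun t => minDensity s ((coordEquiv k).symm t))
      ((Measure.count : Measure (FinDivisor k)).prod (volume : Measure (logSpace k))) := by
    have hmeas : Measurable fun t => minDensity s ((coordEquiv k).symm t) :=
      (measurable_minDensity s).comp (measurable_coordEquiv_symm k)
    rw [integrable_prod_iff hmeas.aestronglyMeasurable]
    refine ⟨Eventually.of_forall hint, ?_⟩
    rw [integrable_count_iff]
    refine summable_of_ne_finset_zero (s := S₀) fun d hd => ?_
    have := hzero d (hS₀ d hd)
    simp only [funext_iff] at this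
    simp [this]
  refine ⟨?_, fun S hS => ?_⟩
  · rw [hmap, integrable_map_equiv]
    exact hprod
  · rw [hmap, integral_map_equiv]
    change ∫ t, minDensity s ((coordEquiv k).symm t) ∂_ = _
    rw [integral_prod _ hprod, integral_countable hprod.integral_prod_left, tsum_eq_sum (s := S)]
    · refine Finset.sum_congr rfl fun d _ => ?_
      rw [minDensity_slice, integral_indicator (isCompact_slice d).measurableSet]
      simp
    · intro d hd
      rw [hzero d (hS d hd)]
      simp

theorem integrable_and_C_eq (s : ℂ) :
    Integrable (fun x : ChowZero k => (ν k x : ℂ) * (a k x : ℂ) ^ (-s)) (haar k) ∧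
      ∀ S : Finset (FinDivisor k), (∀ d ∉ S, slice d = ∅) →
        C k s = ∑ d ∈ S, (torsionOrder k : ℂ) *
          ∫ x in slice d, (normSq ((coordEquiv k).symm (d, x)).1 1 : ℂ) ^ (-s) := by
  have h := integral_quotient_eq_integral (isClosed_principal k)
    (isAddFundamentalDomain_chowDomain k) (μ := haar k)
    (by rw [haar_univ, volumeZero_chowDomain]) (measurable_minDensity s)
    (integrable_minDensity s).1
    (F := fun x : ChowZero k => (ν k x : ℂ) * (a k x : ℂ) ^ (-s)) (hasSum_minDensity s)
  refine ⟨h.1, fun S hS => ?_⟩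
  rw [C, h.2, (integrable_minDensity s).2 S hS]
  exact Finset.sum_congr rfl fun d _ => integral_const_mul _ _

end FiniteSum

end Arakelov

/-! ### The slices of `minDomain` as polytopes in the simplex. -/

namespace OscillatoryIntegral

theorem exists_affineMap_eq {r : ℕ} (a : Fin r → ℝ) (c : ℝ) :
    ∃ l : (Fin r → ℝ) →ᵃ[ℝ] ℝ, ∀ u, l u = ∑ i, a i * u i + c :=
  ⟨(∑ i, a i • LinearMap.proj (R := ℝ) (φ := fun _ : Fin r => ℝ) i).toAffineMap +
    AffineMap.const ℝ _ c, fun u => by simp⟩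

end OscillatoryIntegral

namespace Arakelov

open NumberField.Units NumberField.Units.dirichletUnitTheorem OscillatoryIntegral
open scoped Classical

section Polytopes

variable (k : Type*) [Field k] [NumberField k]

/-- The local degrees of the infinite places other than the distinguished one. -/
noncomputable def placeMult (i : Fin (rank k)) : ℝ := ((equivFinRank (K := k) i).1.mult : ℝ)

/-- The local degree of the distinguished infinite place. -/
noncomputable def placeMult₀ : ℝ := ((w₀ : InfinitePlace k).mult : ℝ)

theorem placeMult_pos (i : Fin (rank k)) : 0 < placeMult k i := by
  rw [placeMult]
  exact_mod_cast InfinitePlace.mult_pos (w := (equivFinRank (K := k) i).1)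

theorem placeMult₀_pos : 0 < placeMult₀ k := by
  rw [placeMult₀]
  exact_mod_cast InfinitePlace.mult_pos (w := (w₀ : InfinitePlace k))

variable {k}

omit [NumberField k] in
theorem one_le_mult (v : InfinitePlace k) : (1 : ℝ) ≤ v.mult := by
  exact_mod_cast InfinitePlace.mult_pos

theorem sum_places (F : InfinitePlace k → ℝ) :
    ∑ v, F v = ∑ i, F (equivFinRank (K := k) i).1 + F w₀ := by
  rw [Fintype.sum_eq_add_sum_subtype_ne F w₀, add_comm,
    ← Equiv.sum_comp (equivFinRank (K := k)) fun w => F w.1]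

variable (k) in
theorem weight_placeMult : weight (placeMult k) (placeMult₀ k) = Module.finrank ℚ k := by
  rw [weight, ← InfinitePlace.sum_mult_eq (K := k), Nat.cast_sum,
    sum_places fun v : InfinitePlace k => (v.mult : ℝ), add_comm]
  rfl

/-- A function on the infinite places given by its values at a distinguished place and at the
others. -/
noncomputable def onPlaces (u : Fin (rank k) → ℝ) (t : ℝ) (v : InfinitePlace k) : ℝ :=
  if h : v = w₀ then t else u ((equivFinRank (K := k)).symm ⟨v, h⟩)

theorem onPlaces_w₀ (u : Fin (rank k) → ℝ) (t : ℝ) : onPlaces (k := k) u t w₀ = t := by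
  rw [onPlaces, dif_pos rfl]

theorem onPlaces_equiv (u : Fin (rank k) → ℝ) (t : ℝ) (i : Fin (rank k)) :
    onPlaces u t (equivFinRank (K := k) i).1 = u i := by
  rw [onPlaces, dif_neg (equivFinRank (K := k) i).2, Subtype.coe_eta, Equiv.symm_apply_apply]

theorem forall_places {P : InfinitePlace k → Prop} :
    (∀ v, P v) ↔ (∀ i, P (equivFinRank (K := k) i).1) ∧ P w₀ := by
  refine ⟨fun h => ⟨fun i => h _, h _⟩, fun h v => ?_⟩
  by_cases hv : v = w₀
  · exact hv ▸ h.2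
  · have := h.1 ((equivFinRank (K := k)).symm ⟨v, hv⟩)
    rwa [Equiv.apply_symm_apply] at this

/-- All the simplex coordinates of a point. -/
noncomputable def placeCoord (u : Fin (rank k) → ℝ) : InfinitePlace k → ℝ :=
  onPlaces u (lastCoord (placeMult k) (placeMult₀ k) u)

/-- All the logarithmic coordinates of a point. -/
noncomputable def placeLog (x : Fin (rank k) → ℝ) : InfinitePlace k → ℝ :=
  onPlaces x (-∑ i, x i)

theorem mem_simplexCore_iff {ε : ℝ} {u : Fin (rank k) → ℝ} :
    u ∈ simplexCore (placeMult k) (placeMult₀ k) ε ↔ ∀ v, ε ≤ placeCoord u v := by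
  rw [forall_places]
  simp only [placeCoord, onPlaces_w₀, onPlaces_equiv]
  rfl

theorem sum_mult_placeCoord (u : Fin (rank k) → ℝ) :
    ∑ v : InfinitePlace k, (v.mult : ℝ) * placeCoord u v = 1 := by
  rw [sum_places]
  simp only [placeCoord, onPlaces_w₀, onPlaces_equiv]
  exact sum_add_lastCoord (m := placeMult k) (placeMult₀_pos k) u

theorem placeCoord_simplexCoord (x : Fin (rank k) → ℝ) (v : InfinitePlace k) :
    placeCoord (simplexCoord (placeMult k) (placeMult₀ k) x) v =
      Real.exp (-(2 / (v.mult : ℝ)) * placeLog x v) / height (placeMult k) (placeMult₀ k) x := by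
  revert v
  rw [forall_places]
  simp only [placeCoord, placeLog, onPlaces_w₀, onPlaces_equiv]
  refine ⟨fun i => rfl, ?_⟩
  rw [lastCoord_simplexCoord (placeMult_pos k) (placeMult₀_pos k), neg_mul_neg]
  rfl

/-- The squared length of a field element at a point of the simplex. -/
noncomputable def placeForm (f : k) (u : Fin (rank k) → ℝ) : ℝ :=
  ∑ v : InfinitePlace k, (v.mult : ℝ) * v f ^ 2 * placeCoord u v

/-- The logarithmic coordinates normalized by the norm of the finite part. -/
noncomputable def sliceChart (d : FinDivisor k) (x : Fin (rank k) → ℝ) : logSpace k :=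
  fun w => x ((equivFinRank (K := k)).symm w) -
    w.1.mult * (Real.log (finNorm d) / Module.finrank ℚ k)

theorem finrank_pos_real : (0 : ℝ) < Module.finrank ℚ k := by
  exact_mod_cast Module.finrank_pos

theorem extendPlace_sliceChart (d : FinDivisor k) (x : Fin (rank k) → ℝ) (v : InfinitePlace k) :
    extendPlace (d, sliceChart d x) v =
      placeLog x v - v.mult * (Real.log (finNorm d) / Module.finrank ℚ k) := by
  have hn := finrank_pos_real (k := k)
  revert v
  rw [forall_places]
  constructor
  · intro i
    rw [extendPlace_coe, placeLog, onPlaces_equiv]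
    simp only [sliceChart, Equiv.symm_apply_apply]
  · rw [extendPlace_w₀, placeLog, onPlaces_w₀]
    have h1 : ∑ w, sliceChart d x w = ∑ i, x i - (∑ i, placeMult k i) *
        (Real.log (finNorm d) / Module.finrank ℚ k) := by
      rw [← Equiv.sum_comp (equivFinRank (K := k)), Finset.sum_mul, ← Finset.sum_sub_distrib]
      refine Finset.sum_congr rfl fun i _ => ?_
      simp only [sliceChart, Equiv.symm_apply_apply]
      rfl
    have h2 : ∑ i, placeMult k i = Module.finrank ℚ k - placeMult₀ k := by
      rw [← weight_placeMult, weight]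
      ring
    simp only [h1, h2, placeMult₀]
    field_simp
    ring

/-- The shift by `m_v log N(d) / n` makes the infinite components sum to zero. It only scales
squared lengths by `N(d) ^ (2/n)`, and what remains is `height` times a form that is affine in the
simplex coordinates. -/
theorem normSq_sliceChart (d : FinDivisor k) (x : Fin (rank k) → ℝ) (f : k) :
    normSq ((coordEquiv k).symm (d, sliceChart d x)).1 f =
      Real.exp (2 * Real.log (finNorm d) / Module.finrank ℚ k) *
        (height (placeMult k) (placeMult₀ k) x *
          placeForm f (simplexCoord (placeMult k) (placeMult₀ k) x)) := by
  have hh := (height_pos (placeMult_pos k) (placeMult₀_pos k) x).ne'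
  rw [normSq_eq, placeForm, Finset.mul_sum, Finset.mul_sum]
  refine Finset.sum_congr rfl fun v _ => ?_
  have hm : (v.mult : ℝ) ≠ 0 := (one_pos.trans_le (one_le_mult v)).ne'
  rw [coordEquiv_symm_snd, extendPlace_sliceChart, placeCoord_simplexCoord]
  rw [show -(2 / (v.mult : ℝ)) * (placeLog x v - v.mult *
    (Real.log (finNorm d) / Module.finrank ℚ k)) = 2 * Real.log (finNorm d) / Module.finrank ℚ k +
      -(2 / (v.mult : ℝ)) * placeLog x v by field_simp; ring, Real.exp_add]
  field_simp

theorem placeForm_one (u : Fin (rank k) → ℝ) : placeForm (1 : k) u = 1 := by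
  rw [placeForm]
  simp only [map_one, one_pow, mul_one]
  exact sum_mult_placeCoord u

/-- The common positive factor cancels and the form of `1` is identically `1`; this is where
minimality becomes linear. -/
theorem sliceChart_mem_slice_iff {d : FinDivisor k} (hd : (1 : k) ∈ ideal ((d, 0) : Divisor k))
    (x : Fin (rank k) → ℝ) : sliceChart d x ∈ slice d ↔ ∀ f ∈ ideal ((d, 0) : Divisor k), f ≠ 0 →
      1 ≤ placeForm f (simplexCoord (placeMult k) (placeMult₀ k) x) := by
  have hh := height_pos (placeMult_pos k) (placeMult₀_pos k) x
  have hI : ideal ((coordEquiv k).symm (d, sliceChart d x)).1 = ideal ((d, 0) : Divisor k) :=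
    ideal_eq_of_fst_eq rfl
  rw [slice, Set.mem_ofPred_eq, minDomain, Set.mem_ofPred_eq, hI, and_iff_right hd]
  refine forall_congr' fun f => forall_congr' fun _ => forall_congr' fun _ => ?_
  rw [normSq_sliceChart, normSq_sliceChart, placeForm_one, mul_le_mul_iff_right₀ (Real.exp_pos _),
    mul_le_mul_iff_right₀ hh]

/-- The nonzero elements of an ideal that can impose conditions on the points of the simplex with
coordinates at least `ε`. -/
def shortElements (d : FinDivisor k) (ε : ℝ) : Set k :=
  {f | (f ∈ ideal ((d, 0) : Divisor k) ∧ ∀ v : InfinitePlace k, v f ≤ √ε⁻¹) ∧ f ≠ 0}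

theorem finite_shortElements (d : FinDivisor k) (ε : ℝ) : (shortElements d ε).Finite :=
  (finite_ideal_bounded (ideal ((d, 0) : Divisor k)) (√ε⁻¹)).subset fun _ hf => hf.1

/-- The polytope of the points of the simplex at which `1` is shortest. -/
def minPolytope (d : FinDivisor k) (ε : ℝ) : Set (Fin (rank k) → ℝ) :=
  {u | u ∈ simplexCore (placeMult k) (placeMult₀ k) ε ∧ ∀ f ∈ shortElements d ε, 1 ≤ placeForm f u}

theorem continuous_placeCoord (v : InfinitePlace k) :
    Continuous fun u : Fin (rank k) → ℝ => placeCoord u v := by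
  revert v
  rw [forall_places]
  simp only [placeCoord, onPlaces_w₀, onPlaces_equiv]
  exact ⟨fun i => by fun_prop, continuous_lastCoord _ _⟩

theorem continuous_placeForm (f : k) : Continuous (placeForm f) := by
  have h := continuous_placeCoord (k := k)
  unfold placeForm
  exact continuous_finsetSum _ fun v _ => continuous_const.mul (h v)

theorem exists_affineMap_placeCoord (v : InfinitePlace k) :
    ∃ (a : Fin (rank k) → ℝ) (c : ℝ), ∀ u, placeCoord u v = ∑ i, a i * u i + c := by
  revert v
  rw [forall_places]
  simp only [placeCoord, onPlaces_w₀, onPlaces_equiv]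
  refine ⟨fun i => ⟨Pi.single i 1, 0, fun u => by simp [Pi.single_apply]⟩,
    fun i => -(placeMult k i / placeMult₀ k), 1 / placeMult₀ k, fun u => ?_⟩
  rw [lastCoord, sub_div, Finset.sum_div, sub_eq_neg_add, ← Finset.sum_neg_distrib]
  congr 1
  exact Finset.sum_congr rfl fun i _ => by ring

theorem exists_affineMap_placeForm (f : k) :
    ∃ (a : Fin (rank k) → ℝ) (c : ℝ), ∀ u, placeForm f u = ∑ i, a i * u i + c := by
  choose a c h using exists_affineMap_placeCoord (k := k)
  refine ⟨fun i => ∑ v : InfinitePlace k, (v.mult : ℝ) * v f ^ 2 * a v i,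
    ∑ v : InfinitePlace k, (v.mult : ℝ) * v f ^ 2 * c v, fun u => ?_⟩
  simp only [placeForm, h, Finset.sum_mul]
  rw [Finset.sum_comm, ← Finset.sum_add_distrib]
  refine Finset.sum_congr rfl fun v _ => ?_
  rw [mul_add, Finset.mul_sum]
  congr 1
  exact Finset.sum_congr rfl fun i _ => by ring

theorem placeCoord_le_one {ε : ℝ} (hε : 0 < ε) {u : Fin (rank k) → ℝ}
    (hu : u ∈ simplexCore (placeMult k) (placeMult₀ k) ε) (v : InfinitePlace k) :
    placeCoord u v ≤ 1 := by
  rw [mem_simplexCore_iff] at hu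
  have hpos : ∀ v, 0 ≤ placeCoord u v := fun v => hε.le.trans (hu v)
  refine (le_mul_of_one_le_left (hpos v) (one_le_mult v)).trans ?_
  rw [← sum_mult_placeCoord u]
  exact Finset.single_le_sum (f := fun v : InfinitePlace k => (v.mult : ℝ) * placeCoord u v)
    (fun v _ => mul_nonneg (Nat.cast_nonneg _) (hpos v)) (Finset.mem_univ v)

theorem isPolytope_minPolytope (d : FinDivisor k) {ε : ℝ} (hε : 0 < ε) :
    IsPolytope (minPolytope d ε) := by
  have hset : minPolytope d ε = (⋂ v, {u | ε ≤ placeCoord u v}) ∩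
      ⋂ f ∈ shortElements d ε, {u | 1 ≤ placeForm f u} := by
    ext u
    simp [minPolytope, mem_simplexCore_iff]
  refine ⟨?_, ?_⟩
  · refine Metric.isCompact_of_isClosed_isBounded ?_
      ((Metric.isBounded_closedBall (x := (0 : Fin (rank k) → ℝ)) (r := 1)).subset fun u hu => ?_)
    · rw [hset]
      exact (isClosed_iInter fun v => isClosed_le continuous_const (continuous_placeCoord v)).inter
        (isClosed_biInter fun f _ => isClosed_le continuous_const (continuous_placeForm f))
    · rw [mem_closedBall_zero_iff, pi_norm_le_iff_of_nonneg zero_le_one]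
      intro i
      have h1 := placeCoord_le_one hε hu.1 (equivFinRank (K := k) i).1
      rw [placeCoord, onPlaces_equiv] at h1
      rw [Real.norm_of_nonneg (hε.le.trans (hu.1.1 i))]
      exact h1
  · choose a c h using exists_affineMap_placeCoord (k := k)
    choose a' c' h' using exists_affineMap_placeForm (k := k)
    choose l hl using fun (a : Fin (rank k) → ℝ) (c : ℝ) => exists_affineMap_eq a c
    refine ⟨Set.range (fun v => l (a v) (c v - ε)) ∪
      (fun f => l (a' f) (c' f - 1)) '' shortElements d ε,
      (Set.finite_range _).union ((finite_shortElements d ε).image _), ?_⟩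
    ext u
    simp only [Set.mem_ofPred_eq, Set.mem_union, or_imp, forall_and, Set.forall_mem_range,
      Set.forall_mem_image, hl, ← add_sub_assoc, ← h, ← h', sub_nonneg]
    rw [minPolytope, Set.mem_ofPred_eq, mem_simplexCore_iff]

/-- If some `|f|_v` exceeds `ε ^ (-1/2)`, the term of `v` alone is at least `1`, because the
coordinates are at least `ε`. So finitely many `f` imply the conditions for all. -/
theorem one_le_placeForm {d : FinDivisor k} {ε : ℝ} (hε : 0 < ε) {u : Fin (rank k) → ℝ}
    (hu : u ∈ minPolytope d ε) {f : k} (hf : f ∈ ideal ((d, 0) : Divisor k)) (hf0 : f ≠ 0) :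
    1 ≤ placeForm f u := by
  by_cases hF : f ∈ shortElements d ε
  · exact hu.2 f hF
  · obtain ⟨v, hv⟩ : ∃ v : InfinitePlace k, √ε⁻¹ < v f := by
      by_contra hcon
      push Not at hcon
      exact hF ⟨⟨hf, hcon⟩, hf0⟩
    have hcore := mem_simplexCore_iff.mp hu.1
    have h1 : ε⁻¹ ≤ v f ^ 2 := by
      rw [← Real.sq_sqrt (inv_nonneg.mpr hε.le)]
      exact pow_le_pow_left₀ (Real.sqrt_nonneg _) hv.le 2
    have h2 : 1 ≤ (v.mult : ℝ) * v f ^ 2 * placeCoord u v := by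
      calc (1 : ℝ) = 1 * ε⁻¹ * ε := by rw [one_mul, inv_mul_cancel₀ hε.ne']
        _ ≤ _ := mul_le_mul (mul_le_mul (one_le_mult v) h1 (by positivity) (by positivity))
          (hcore v) hε.le (by positivity)
    refine h2.trans ?_
    rw [placeForm]
    exact Finset.single_le_sum
      (f := fun v : InfinitePlace k => (v.mult : ℝ) * v f ^ 2 * placeCoord u v)
      (fun v _ => mul_nonneg (by positivity) (hε.le.trans (hcore v))) (Finset.mem_univ v)

variable (k) in
theorem exists_preimage_slice_eq : ∃ ε₀ : ℝ, 0 < ε₀ ∧ ∀ ε, 0 < ε → ε ≤ ε₀ →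
    ∀ d : FinDivisor k, (1 : k) ∈ ideal ((d, 0) : Divisor k) →
      sliceChart d ⁻¹' slice d = simplexChart (placeMult k) (placeMult₀ k) '' minPolytope d ε := by
  obtain ⟨c, hc, hb⟩ := exists_bound_minDomain k
  -- On `minDomain` one has `exp (-2 x_v / m_v) ≥ exp (-2 c)` and `‖1‖²_D ≤ exp c`, so every simplex
  -- coordinate, being their quotient, is at least `exp (-3 c)`.
  refine ⟨Real.exp (-3 * c), Real.exp_pos _, fun ε hε hle d hd => ?_⟩
  have hm := placeMult_pos k
  have hm₀ := placeMult₀_pos k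
  ext x
  rw [Set.mem_preimage]
  constructor
  · intro hx
    refine ⟨simplexCoord (placeMult k) (placeMult₀ k) x, ⟨?_, fun f hf => ?_⟩,
      simplexChart_simplexCoord hm hm₀ x⟩
    · rw [mem_simplexCore_iff]
      intro v
      refine hle.trans ?_
      obtain ⟨h1, -, h3⟩ := hb _ hx
      have hN := Real.exp_pos (2 * Real.log (finNorm d) / Module.finrank ℚ k)
      have hh := height_pos hm hm₀ x
      rw [normSq_sliceChart, placeForm_one, mul_one] at h3
      have h4 := h1 v
      rw [coordEquiv_symm_snd, extendPlace_sliceChart] at h4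
      have hmv : (v.mult : ℝ) ≠ 0 := (one_pos.trans_le (one_le_mult v)).ne'
      have h5 : Real.exp (-2 * c) ≤ Real.exp (2 * Real.log (finNorm d) / Module.finrank ℚ k) *
          Real.exp (-(2 / (v.mult : ℝ)) * placeLog x v) := by
        rw [← Real.exp_add, Real.exp_le_exp]
        have h6 : 2 * Real.log (finNorm d) / Module.finrank ℚ k +
            -(2 / (v.mult : ℝ)) * placeLog x v = -(2 / (v.mult : ℝ)) *
              (placeLog x v - v.mult * (Real.log (finNorm d) / Module.finrank ℚ k)) := by
          field_simp
          ring
        rw [h6]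
        have h7 : 2 / (v.mult : ℝ) ≤ 2 := div_le_self (by norm_num) (one_le_mult v)
        have h8 : 0 ≤ 2 / (v.mult : ℝ) := by positivity
        have h9 := (abs_le.mp h4).2
        nlinarith
      rw [placeCoord_simplexCoord, ← mul_div_mul_left _ _ hN.ne',
        le_div_iff₀ (mul_pos hN hh)]
      calc Real.exp (-3 * c) * _ ≤ Real.exp (-3 * c) * Real.exp c := by gcongr
        _ = Real.exp (-2 * c) := by rw [← Real.exp_add]; ring_nf
        _ ≤ _ := h5
    · exact (sliceChart_mem_slice_iff hd x).mp hx f hf.1.1 hf.2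
  · rintro ⟨u, hu, rfl⟩
    obtain ⟨h1, h2⟩ := simplexCore_pos hε hu.1
    rw [sliceChart_mem_slice_iff hd, simplexCoord_simplexChart hm hm₀ h1 h2]
    exact fun f hf hf0 => one_le_placeForm hε hu hf hf0

/-- The map `sliceChart` is a relabelling of coordinates followed by a translation, so it preserves
Lebesgue measure. -/
theorem integral_slice {ε : ℝ} {d : FinDivisor k}
    (h : sliceChart d ⁻¹' slice d = simplexChart (placeMult k) (placeMult₀ k) '' minPolytope d ε)
    (s : ℂ) :
    ∫ x in slice d, (normSq ((coordEquiv k).symm (d, x)).1 1 : ℂ) ^ (-s) =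
      (Real.exp (2 * Real.log (finNorm d) / Module.finrank ℚ k) : ℂ) ^ (-s) *
        ∫ x in simplexChart (placeMult k) (placeMult₀ k) '' minPolytope d ε,
          (height (placeMult k) (placeMult₀ k) x : ℂ) ^ (-s) := by
  obtain ⟨hmp, hemb⟩ : MeasurePreserving (sliceChart d) volume volume ∧
      MeasurableEmbedding (sliceChart d) := by
    set c : logSpace k := fun w => (w.1.mult : ℝ) * (Real.log (finNorm d) / Module.finrank ℚ k)
    have hfun : sliceChart d = (fun x => x - c) ∘
        MeasurableEquiv.piCongrLeft (fun _ : {w : InfinitePlace k // w ≠ w₀} => ℝ)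
          (equivFinRank (K := k)) := by
      funext x w
      obtain ⟨i, rfl⟩ := (equivFinRank (K := k)).surjective w
      rw [Function.comp_apply, Pi.sub_apply, MeasurableEquiv.coe_piCongrLeft,
        Equiv.piCongrLeft_apply_apply, sliceChart, Equiv.symm_apply_apply]
    rw [hfun]
    exact ⟨(measurePreserving_sub_right volume c).comp (volume_measurePreserving_piCongrLeft _ _),
      (MeasurableEquiv.subRight c).measurableEmbedding.comp (MeasurableEquiv.measurableEmbedding _)⟩
  rw [← hmp.setIntegral_preimage_emb hemb, h, ← integral_const_mul]
  congr 1 with x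
  rw [normSq_sliceChart, placeForm_one, mul_one, Complex.ofReal_mul,
    Complex.mul_cpow_ofReal_nonneg (Real.exp_pos _).le
      (height_pos (placeMult_pos k) (placeMult₀_pos k) x).le]

end Polytopes

end Arakelov

/-! ### The main term and the exponentially small terms. -/

namespace Arakelov

open NumberField.Units NumberField.Units.dirichletUnitTheorem OscillatoryIntegral
open scoped Classical

section Asymptotics

variable {k : Type*} [Field k] [NumberField k]

theorem placeCoord_const (v : InfinitePlace k) :
    placeCoord (fun _ : Fin (rank k) => (weight (placeMult k) (placeMult₀ k))⁻¹) v =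
      (Module.finrank ℚ k : ℝ)⁻¹ := by
  have hn := finrank_pos_real (k := k)
  have hm₀ := placeMult₀_pos k
  revert v
  rw [forall_places]
  simp only [placeCoord, onPlaces_w₀, onPlaces_equiv, weight_placeMult]
  refine ⟨fun _ => trivial, ?_⟩
  have h : ∑ i, placeMult k i = Module.finrank ℚ k - placeMult₀ k := by
    rw [← weight_placeMult, weight]
    ring
  rw [lastCoord, ← Finset.sum_mul, h]
  field_simp
  ring

theorem sum_mult_real : ∑ v : InfinitePlace k, (v.mult : ℝ) = Module.finrank ℚ k := by
  rw [← InfinitePlace.sum_mult_eq (K := k), Nat.cast_sum]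

theorem one_le_abs_norm {f : k} (hf : f ∈ ideal ((0, 0) : Divisor k)) (hf0 : f ≠ 0) :
    1 ≤ |(Algebra.norm ℚ f : ℝ)| := by
  have h := one_le_abs_norm_mul_finNorm _ hf hf0
  rwa [finNorm_zero, mul_one] at h

theorem sum_mult_log_nonneg {f : k} (hf : f ∈ ideal ((0, 0) : Divisor k)) (hf0 : f ≠ 0) :
    0 ≤ ∑ v : InfinitePlace k, (v.mult : ℝ) * Real.log (v f) := by
  have h := one_le_abs_norm hf hf0
  have h1 := InfinitePlace.prod_eq_abs_norm f
  have h2 : |(Algebra.norm ℚ f : ℝ)| = ∏ v : InfinitePlace k, v f ^ v.mult := by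
    rw [h1]
    push_cast
    rfl
  have h3 : Real.log |(Algebra.norm ℚ f : ℝ)| =
      ∑ v : InfinitePlace k, (v.mult : ℝ) * Real.log (v f) := by
    rw [h2, Real.log_prod fun v _ => pow_ne_zero _ (InfinitePlace.pos_iff.mpr hf0).ne']
    exact Finset.sum_congr rfl fun v _ => Real.log_pow _ _
  rw [← h3]
  exact Real.log_nonneg h

/-- The inequality of arithmetic and geometric means for the absolute values of an integer, with
its equality case. -/
theorem finrank_lt_sum_mult_sq {f : k} (hf : f ∈ ideal ((0, 0) : Divisor k)) (hf0 : f ≠ 0)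
    (h : ∃ v : InfinitePlace k, v f ≠ 1) :
    (Module.finrank ℚ k : ℝ) < ∑ v : InfinitePlace k, (v.mult : ℝ) * v f ^ 2 := by
  obtain ⟨w, hw⟩ := h
  have hpos : ∀ v : InfinitePlace k, 0 < v f := fun v => InfinitePlace.pos_iff.mpr hf0
  have key : ∑ v : InfinitePlace k, (v.mult : ℝ) * (2 * Real.log (v f)) <
      ∑ v : InfinitePlace k, (v.mult : ℝ) * (v f ^ 2 - 1) := by
    have hlog : ∀ v : InfinitePlace k, 2 * Real.log (v f) = Real.log (v f ^ 2) := fun v => by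
      rw [Real.log_pow]
      norm_num
    refine Finset.sum_lt_sum (fun v _ => ?_) ⟨w, Finset.mem_univ _, ?_⟩
    · rw [hlog]
      exact mul_le_mul_of_nonneg_left (Real.log_le_sub_one_of_pos (pow_pos (hpos v) 2))
        (Nat.cast_nonneg _)
    · rw [hlog]
      refine mul_lt_mul_of_pos_left (Real.log_lt_sub_one_of_pos (pow_pos (hpos w) 2) ?_)
        (one_pos.trans_le (one_le_mult w))
      exact fun h => hw ((pow_eq_one_iff_of_nonneg (hpos w).le two_ne_zero).mp h)
  have h1 := sum_mult_log_nonneg hf hf0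
  simp only [mul_sub, mul_one, Finset.sum_sub_distrib, sum_mult_real, mul_left_comm _ (2 : ℝ),
    ← Finset.mul_sum] at key
  linarith

/-- Finitely many conditions are involved. Each is strict at the barycentre, by the inequality of
means, unless all `|f|_v` equal `1`, and then the form is identically `1` and imposes nothing. -/
theorem center_mem_interior_minPolytope {ε : ℝ} (hε : ε < (Module.finrank ℚ k : ℝ)⁻¹) :
    (fun _ => (weight (placeMult k) (placeMult₀ k))⁻¹) ∈
      interior (minPolytope (0 : FinDivisor k) ε) := by
  set p : Fin (rank k) → ℝ := fun _ => (weight (placeMult k) (placeMult₀ k))⁻¹ with hp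
  have hn := finrank_pos_real (k := k)
  rw [mem_interior_iff_mem_nhds]
  have h1 : ∀ᶠ u in 𝓝 p, ∀ v : InfinitePlace k, ε ≤ placeCoord u v := by
    rw [eventually_all]
    intro v
    have h : ε < placeCoord p v := by rwa [hp, placeCoord_const]
    exact ((continuous_placeCoord v).continuousAt.eventually_const_lt h).mono fun _ h => h.le
  have h2 : ∀ᶠ u in 𝓝 p, ∀ f ∈ shortElements (0 : FinDivisor k) ε, 1 ≤ placeForm f u := by
    rw [eventually_all_finite (finite_shortElements _ _)]
    intro f hf
    by_cases h : ∃ v : InfinitePlace k, v f ≠ 1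
    · have h3 : 1 < placeForm f p := by
        simp only [placeForm, hp, placeCoord_const, ← Finset.sum_mul]
        rw [← div_eq_mul_inv, one_lt_div hn]
        exact finrank_lt_sum_mult_sq hf.1.1 hf.2 h
      exact ((continuous_placeForm f).continuousAt.eventually_const_lt h3).mono fun _ h => h.le
    · push Not at h
      refine Eventually.of_forall fun u => ?_
      simp only [placeForm, h, one_pow, mul_one]
      exact (sum_mult_placeCoord u).ge
  filter_upwards [h1, h2] with u hu1 hu2
  exact ⟨mem_simplexCore_iff.mpr hu1, hu2⟩

theorem prod_mult : ∏ v : InfinitePlace k, v.mult = 2 ^ InfinitePlace.nrComplexPlaces k := by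
  simp only [InfinitePlace.mult, Finset.prod_ite, Finset.prod_const_one, one_mul,
    Finset.prod_const, InfinitePlace.not_isReal_iff_isComplex]
  rw [InfinitePlace.nrComplexPlaces, Fintype.card_subtype]

theorem prod_placeMult :
    (∏ i, placeMult k i) * placeMult₀ k = 2 ^ InfinitePlace.nrComplexPlaces k := by
  have h : ((∏ v : InfinitePlace k, v.mult : ℕ) : ℝ) = 2 ^ InfinitePlace.nrComplexPlaces k := by
    rw [prod_mult]
    push_cast
    rfl
  rw [← h, Nat.cast_prod, Fintype.prod_eq_mul_prod_subtype_ne _ (w₀ : InfinitePlace k), mul_comm,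
    ← Equiv.prod_comp (equivFinRank (K := k)) fun w => ((w.1.mult : ℕ) : ℝ)]
  rfl

variable (k)

/-- Both sides are nonnegative, so squares are compared; the powers of `2` agree because `r + 1 = r₁
+ r₂`. -/
theorem α_eq : √(Real.pi * weight (placeMult k) (placeMult₀ k) / 2) ^ rank k *
    √((∏ i, placeMult k i) * placeMult₀ k / weight (placeMult k) (placeMult₀ k)) = α k := by
  have hn := finrank_pos_real (k := k)
  have hr : rank k + 1 = InfinitePlace.nrRealPlaces k + InfinitePlace.nrComplexPlaces k := by
    rw [← InfinitePlace.card_eq_nrRealPlaces_add_nrComplexPlaces, rank]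
    exact Nat.sub_add_cancel Fintype.card_pos
  rw [weight_placeMult, prod_placeMult]
  have hπn : 0 < Real.pi * Module.finrank ℚ k := by positivity
  refine (pow_left_inj₀ (by positivity) (by rw [α]; positivity) two_ne_zero).mp ?_
  rw [α, mul_pow, mul_pow, mul_pow, ← pow_mul, mul_comm (rank k), pow_mul,
    Real.sq_sqrt (by positivity), Real.sq_sqrt (by positivity), Real.sq_sqrt (by positivity),
    ← Real.rpow_natCast (_ ^ ((rank k : ℝ) / 2)), ← Real.rpow_mul hπn.le,
    ← Real.rpow_natCast (2 ^ _), ← Real.rpow_mul zero_le_two]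
  rw [show (rank k : ℝ) / 2 * (2 : ℕ) = (rank k : ℕ) by push_cast; ring,
    show -(InfinitePlace.nrRealPlaces k : ℝ) / 2 * (2 : ℕ) =
      -((InfinitePlace.nrRealPlaces k : ℕ) : ℝ) by push_cast; ring,
    Real.rpow_natCast, Real.rpow_neg zero_le_two, Real.rpow_natCast, div_pow]
  have h2 : (2 : ℝ) ^ rank k * 2 =
      2 ^ InfinitePlace.nrRealPlaces k * 2 ^ InfinitePlace.nrComplexPlaces k := by
    rw [← pow_succ, hr, pow_add]
  field_simp
  rw [h2, mul_comm]

theorem α_pos : 0 < α k := by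
  have hn := finrank_pos_real (k := k)
  rw [α]
  positivity

/-- The integral `C` is a finite sum of integrals over polytopes in the simplex. -/
theorem exists_C_eq : ∃ (ε : ℝ) (S : Finset (FinDivisor k)), 0 < ε ∧
    ε < (Module.finrank ℚ k : ℝ)⁻¹ ∧ 0 ∈ S ∧ (∀ d ∈ S, d ≠ 0 → 2 ≤ finNorm d) ∧
      ∀ s, C k s = ∑ d ∈ S, (torsionOrder k : ℂ) *
        ((Real.exp (2 * Real.log (finNorm d) / Module.finrank ℚ k) : ℂ) ^ (-s) *
          ∫ x in simplexChart (placeMult k) (placeMult₀ k) '' minPolytope d ε,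
            (height (placeMult k) (placeMult₀ k) x : ℂ) ^ (-s)) := by
  have hn := finrank_pos_real (k := k)
  obtain ⟨ε₀, hε₀, hε⟩ := exists_preimage_slice_eq k
  obtain ⟨S, h0, h1, hS⟩ := exists_finset_slice k
  -- One `ε` serves two purposes: it is small enough to describe all slices, and below `1 / n`, so
  -- that the barycentre satisfies the core inequalities strictly.
  have hpos : 0 < min ε₀ ((Module.finrank ℚ k : ℝ)⁻¹ / 2) := lt_min hε₀ (by positivity)
  refine ⟨_, S, hpos, (min_le_right _ _).trans_lt (half_lt_self (inv_pos.mpr hn)), h0,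
    fun d hd hd0 => two_le_finNorm (D := (d, 0)) (h1 d hd) hd0, fun s => ?_⟩
  rw [(integrable_and_C_eq s).2 S hS]
  refine Finset.sum_congr rfl fun d hd => ?_
  rw [integral_slice (hε _ hpos (min_le_left _ _) d (h1 d hd))]

theorem differentiable_C : Differentiable ℂ (C k) := by
  obtain ⟨ε, S, hε, -, -, -, hC⟩ := exists_C_eq k
  rw [funext hC]
  refine Differentiable.fun_sum fun d _ => (Differentiable.mul ?_ ?_).const_mul _
  · exact differentiable_neg.const_cpow
      (Or.inl (Complex.ofReal_ne_zero.mpr (Real.exp_pos _).ne'))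
  · exact differentiable_integral_height_cpow (placeMult_pos k) (placeMult₀_pos k) hε
      (isPolytope_minPolytope d hε).1 fun u hu => hu.1

theorem tendsto_cpow_neg_comap_re {c : ℝ} (hc : 1 < c) :
    Tendsto (fun s : ℂ => (c : ℂ) ^ (-s)) (comap Complex.re atTop) (𝓝 0) := by
  rw [tendsto_zero_iff_norm_tendsto_zero]
  have h0 : 0 < c := one_pos.trans hc
  have h : (fun s : ℂ => ‖(c : ℂ) ^ (-s)‖) = (fun x : ℝ => Real.exp (-(x * Real.log c))) ∘
      Complex.re := by
    funext s
    rw [Complex.norm_cpow_eq_rpow_re_of_pos h0, Function.comp_apply, Real.rpow_def_of_pos h0,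
      Complex.neg_re]
    ring_nf
  rw [h]
  exact (Real.tendsto_exp_neg_atTop_nhds_zero.comp
    (tendsto_id.atTop_mul_const (Real.log_pos hc))).comp tendsto_comap

/-- Only `d = 0` survives: for `d ≠ 0` a bounded function is multiplied by `(N(d) ^ (2/n)) ^ (-s)`
with `N(d) ≥ 2`, which tends to zero uniformly in `Im s`. -/
theorem tendsto_cpow_mul_C : Tendsto
    (fun s : ℂ => s ^ ((rank k : ℂ) / 2) * (Module.finrank ℚ k : ℂ) ^ s * C k s)
      (comap Complex.re atTop) (𝓝 ((torsionOrder k : ℂ) * (α k : ℂ))) := by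
  have hn := finrank_pos_real (k := k)
  obtain ⟨ε, S, hε, hlt, h0, h2, hC⟩ := exists_C_eq k
  have hm := placeMult_pos k
  have hm₀ := placeMult₀_pos k
  set J : FinDivisor k → ℂ → ℂ := fun d s => s ^ ((rank k : ℂ) / 2) *
    (weight (placeMult k) (placeMult₀ k) : ℂ) ^ s *
      ∫ x in simplexChart (placeMult k) (placeMult₀ k) '' minPolytope d ε,
        (height (placeMult k) (placeMult₀ k) x : ℂ) ^ (-s) with hJ
  set c : FinDivisor k → ℝ := fun d => Real.exp (2 * Real.log (finNorm d) / Module.finrank ℚ k)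
    with hcdef
  have hsum : (fun s : ℂ => s ^ ((rank k : ℂ) / 2) * (Module.finrank ℚ k : ℂ) ^ s * C k s) =
      fun s => ∑ d ∈ S, (torsionOrder k : ℂ) * ((c d : ℂ) ^ (-s) * J d s) := by
    funext s
    rw [hC, Finset.mul_sum]
    refine Finset.sum_congr rfl fun d _ => ?_
    simp only [hJ, hcdef, weight_placeMult, Complex.ofReal_natCast]
    ring
  have hlim : (torsionOrder k : ℂ) * (α k : ℂ) =
      ∑ d ∈ S, (torsionOrder k : ℂ) * (if d = 0 then (α k : ℂ) else 0) := by
    rw [← Finset.mul_sum, Finset.sum_ite_eq' S, if_pos h0]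
  rw [hsum, hlim]
  refine tendsto_finsetSum _ fun d hd => Tendsto.const_mul _ ?_
  split_ifs with hd0
  · subst hd0
    have hc : c 0 = 1 := by rw [hcdef]; simp [finNorm_zero]
    simp only [hc, Complex.ofReal_one, Complex.one_cpow, one_mul]
    rw [← α_eq k]
    exact tendsto_integral_height_cpow hm hm₀ hε (isPolytope_minPolytope 0 hε)
      (fun u hu => hu.1) (center_mem_interior_minPolytope hlt)
  · have hc : 1 < c d := by
      rw [hcdef, Real.one_lt_exp_iff]
      have := Real.log_pos (one_lt_two.trans_le (h2 d hd hd0))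
      positivity
    have hO := (isBigO_integral_height_cpow hm hm₀ hε (isPolytope_minPolytope d hε)
      fun u hu => hu.1).mono
        (le_principal_iff.mpr (preimage_mem_comap (Ici_mem_atTop (1 : ℝ))) :
          comap Complex.re atTop ≤ 𝓟 halfPlane)
    have h := ((Asymptotics.isLittleO_one_iff ℝ).mpr (tendsto_cpow_neg_comap_re hc)).mul_isBigO hO
    simp only [mul_one] at h
    exact (Asymptotics.isLittleO_one_iff ℝ).mp h

end Asymptotics

end Arakelov

theorem theorem4p3 (k : Type*) [Field k] [NumberField k] :
    (∀ s : ℂ, Integrable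
      (fun x : Arakelov.ChowZero k => (Arakelov.ν k x : ℂ) * (Arakelov.a k x : ℂ) ^ (-s))
      (Arakelov.haar k)) ∧
    Differentiable ℂ (Arakelov.C k) ∧
    Tendsto
      (fun s : ℂ => Arakelov.C k s /
        ((Units.torsionOrder k : ℂ) * (Arakelov.α k : ℂ) * s ^ (-((Units.rank k : ℂ) / 2)) *
          (Module.finrank ℚ k : ℂ) ^ (-s)))
      (comap Complex.re atTop) (𝓝 1) := by
  refine ⟨fun s => (Arakelov.integrable_and_C_eq s).1, Arakelov.differentiable_C k, ?_⟩
  have hne : (Units.torsionOrder k : ℂ) * (Arakelov.α k : ℂ) ≠ 0 :=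
    mul_ne_zero (Nat.cast_ne_zero.mpr (Units.torsionOrder_pos k).ne')
      (Complex.ofReal_ne_zero.mpr (Arakelov.α_pos k).ne')
  have h := (Arakelov.tendsto_cpow_mul_C k).div_const
    ((Units.torsionOrder k : ℂ) * (Arakelov.α k : ℂ))
  rw [div_self hne] at h
  refine h.congr fun s => ?_
  rw [Complex.cpow_neg, Complex.cpow_neg]
  simp only [div_eq_mul_inv, mul_inv, inv_inv]
  ring
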